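/- **Setting.** Let $\mathcal H_{\rm at}$ be a separable complex Hilbert space, $\mathcal F=\bigoplus_{n\ge 0}S_n(\otimes^n\mathfrak h)$ the symmetric Fock space over $\mathfrak h=L^2(\mathbb R^3\times\{1,2\})$ ($S_n$ is the orthogonal projection onto symmetric tensors), $\mathcal H=\mathcal H_{\rm at}\otimes\mathcal F$, and $H_f$ the second quantization of multiplication by $|k|:=|\mathbf k|$, $k=(\mathbf k,\lambda)$; $\int dk:=\sum_{\lambda}\int d^3\mathbf k$. Let $V\subset\mathbb C^\nu$ be open and invariant under complex conjugation. For each $s\in V$ let $H_{\rm at}(s)$ be a closed, densely defined operator in $\mathcal H_{\rm at}$ and let $G_s\in L^2(\mathbb R^3\times\{1,2\};\mathcal L(\mathcal H_{\rm at}))$, the Banach space of weakly measurable operator-valued functions $T$ with $\int\|T(k)\|^2dk<\infty$. The creation operator $a^*(G)$ is the closure of the linear operator given by $a^*(G)(\varphi\otimes\psi)=\sqrt n\,S_n(G\varphi\otimes\psi)$ for $\varphi\in\mathcal H_{\rm at}$, $\psi\in S_{n-1}(\otimes^{n-1}\mathfrak h)$; $a(G)=a^*(G)^*$; $W(s)=a(G_{\bar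 s})+a^*(G_s)$; and for $g\ge 0$, $H_g(s)$ is the closure of $H_{\rm at}(s)\otimes 1+1\otimes H_f+gW(s)$ defined on the algebraic tensor product $D(H_{\rm at}(s))\otimes D(H_f)$. **Hypotheses.** (I) $s\mapsto G_s$ is bounded and analytic on $V$ with values in $L^2(\mathbb R^3\times\{1,2\};\mathcal L(\mathcal H_{\rm at}))$, and for some $\mu>0$, $\sup_{s\in V}\int|k|^{-2-2\mu}\|G_s(k)\|^2dk<\infty$. (II) $H_{\rm at}(s)$, $s\in V$, is an analytic family in the sense of Kato, $H_{\rm at}(s)^*=H_{\rm at}(\bar s)$, and there is a point $s_0\in V\cap\mathbb R^\nu$ such that $E_0:=\inf\sigma(H_{\rm at}(s_0))$ is an isolated, non-degenerate eigenvalue of $H_{\rm at}(s_0)$. For $s$ near $s_0$ there is exactly one point of $\sigma(H_{\rm at}(s))$ near $E_0$, and it is a non-degenerate eigenvalue. Accordingly fix $r>0$ and let $D_r$ be the set of $s\in V$ for which $\sigma(H_{\rm at}(s))\cap\{|e-E_0|<r\}$ consists of exactly one point, called $E_{\rm at}(s)$, and the Riesz projection $P_{\rm at}(s)=\frac1{2\pi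 i}\oint_{|\zeta-E_{\rm at}(s)|=\epsilon}(\zeta-H_{\rm at}(s))^{-1}d\zeta$ ($\epsilon>0$ small) has rank one. Put $\overline P_{\rm at}(s)=1-P_{\rm at}(s)$. (III) $\mathcal U\subset D_r\times\mathbb C$ is an open neighbourhood of $(s_0,E_0)$ such that $|E_{\rm at}(s)-z|<\frac12$ for all $(s,z)\in\mathcal U$, and $$\sup_{(s,z)\in\mathcal U}\ \sup_{q\ge0}\ \Big\|\frac{q+1}{H_{\rm at}(s)-z+q}\,\overline P_{\rm at}(s)\Big\|<\infty,$$ where it is part of the condition that $H_{\rm at}(s)-z+q$ is bounded invertible in ${\rm Ran}\,\overline P_{\rm at}(s)$. Here an operator $A$ is *bounded invertible in* a (not necessarily closed) subspace $Y$ if $A:D(A)\cap Y\to Y$ is a bijection with bounded inverse. **Cutoffs and Feshbach pairs.** Let $\chi,\overline\chi\in C^\infty(\mathbb R;[0,1])$ with $\chi(t)=1$ for $t\le\frac34$, $\chi(t)=0$ for $t\ge1$, $\chi^2+\overline\chi^2=1$; let $\chi_1=\chi(H_f)$, $\overline\chi_1=\overline\chi(H_f)$ and $$\boldsymbol\chi(s)=P_{\rm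 at}(s)\otimes\chi_1,\qquad\overline{\boldsymbol\chi}(s)=\overline P_{\rm at}(s)\otimes1+P_{\rm at}(s)\otimes\overline\chi_1 .$$ For commuting nonzero bounded operators $\chi,\overline\chi$ on $\mathcal H$ with $\chi^2+\overline\chi^2=1$, a pair $(H,T)$ of closed operators with the same domain is a *Feshbach pair for $\chi$* if, with $W=H-T$ and $H_{\overline\chi}=T+\overline\chi W\overline\chi$ on $D(T)$: (a) $\chi T\subset T\chi$ and $\overline\chi T\subset T\overline\chi$; (b) $T$ and $H_{\overline\chi}$ are bounded invertible in ${\rm Ran}\,\overline\chi$; (c) $\overline\chi H_{\overline\chi}^{-1}\overline\chi W\chi$ is bounded on $D(T)$. **Effective Hamiltonian.** If $L$ is an operator in $\mathcal H$ that is defined and bounded on ${\rm Ran}\,P_{\rm at}(s)\otimes\mathcal F$, let $\langle L\rangle_{{\rm at},s}\in\mathcal L(\mathcal F)$ be the unique operator with $(P_{\rm at}(s)\otimes1)L(P_{\rm at}(s)\otimes1)=P_{\rm at}(s)\otimes\langle L\rangle_{{\rm at},s}$. On $\mathcal H_{\rm red}=P_{[0,1]}(H_f)\mathcal F$ put $$H_g^{(0)}[s,z]=\Big(E_{\rm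 at}(s)-z+H_f+g\langle\chi_1W(s)\chi_1\rangle_{{\rm at},s}-g^2\big\langle\chi_1W(s)\overline{\boldsymbol\chi}(s)(H_g(s)-z)_{\overline{\boldsymbol\chi}(s)}^{-1}\overline{\boldsymbol\chi}(s)W(s)\chi_1\big\rangle_{{\rm at},s}\Big)\Big|_{\mathcal H_{\rm red}} ,$$ where $(H_g(s)-z)_{\overline{\boldsymbol\chi}(s)}=(H_0(s)-z)+\overline{\boldsymbol\chi}(s)\,(H_g(s)-H_0(s))\,\overline{\boldsymbol\chi}(s)$ is inverted in ${\rm Ran}\,\overline{\boldsymbol\chi}(s)$. **Theorem.** Under hypotheses (I)-(III) there is $g_0>0$ such that for all $g\in[0,g_0)$: for every $(s,z)\in\mathcal U$ the pair $(H_g(s)-z,\,H_0(s)-z)$ is a Feshbach pair for $\boldsymbol\chi(s)$ (with complementary operator $\overline{\boldsymbol\chi}(s)$); the effective Hamiltonian $H_g^{(0)}[s,z]$ is a well-defined bounded operator on $\mathcal H_{\rm red}$ for every $(s,z)\in\mathcal U$; and $(s,z)\mapsto H_g^{(0)}[s,z]\in\mathcal L(\mathcal H_{\rm red})$ is (jointly)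 analytic on $\mathcal U$. -/

import Mathlib

open MeasureTheory Filter Topology
open scoped ENNReal NNReal ContDiff

namespace QED

noncomputable section

/-! ### One-photon space and symmetric Fock space -/

/-- Photon variables `k = (𝐤, λ) ∈ ℝ³ × {1, 2}` (wave vector and polarization). -/
abbrev Mode : Type := EuclideanSpace ℝ (Fin 3) × Fin 2

/-- `∫ dk = ∑_λ ∫ d³𝐤`. -/
def modeMeasure : Measure Mode :=
  (volume : Measure (EuclideanSpace ℝ (Fin 3))).prod Measure.count

instance : SigmaFinite modeMeasure := by
  unfold modeMeasure; infer_instance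

/-- The dispersion relation `ω(k) = |𝐤|`. -/
def omega (k : Mode) : ℝ := ‖k.1‖

/-- `dk₁ ⋯ dkₙ`. -/
def configMeasure (n : ℕ) : Measure (Fin n → Mode) :=
  Measure.pi fun _ => modeMeasure

theorem measurePreserving_perm {n : ℕ} (σ : Equiv.Perm (Fin n)) :
    MeasurePreserving (fun k : Fin n → Mode => fun i => k (σ i))
      (configMeasure n) (configMeasure n) := by
  have h := measurePreserving_piCongrLeft (fun _ : Fin n => modeMeasure) σ.symm
  have e : (fun k : Fin n → Mode => fun i => k (σ i)) =
      MeasurableEquiv.piCongrLeft (fun _ : Fin n => Mode) σ.symm := by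
    funext k i
    have := Equiv.piCongrLeft_apply_apply (P := fun _ : Fin n => Mode) σ.symm k (σ i)
    simp only [Equiv.symm_apply_apply] at this
    exact this.symm
  rw [e]
  exact h

section Fock

variable (E : Type*) [NormedAddCommGroup E] [InnerProductSpace ℂ E]

/-- The action of a permutation on `L²((ℝ³ × {1,2})ⁿ; E)`:
`(U_σ f)(k₁, …, kₙ) = f(k_{σ 1}, …, k_{σ n})`. -/
def permute {n : ℕ} (σ : Equiv.Perm (Fin n)) :
    Lp E 2 (configMeasure n) →ₗᵢ[ℂ] Lp E 2 (configMeasure n) :=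
  Lp.compMeasurePreservingₗᵢ ℂ _ (measurePreserving_perm σ)

/-- The symmetric functions in `L²((ℝ³ × {1,2})ⁿ; E)`. For `E = ℂ` this is `Sₙ(⊗ⁿ 𝔥)` with
`𝔥 = L²(ℝ³ × {1,2})`; in general it is `E ⊗ Sₙ(⊗ⁿ 𝔥)`. -/
def Sector (n : ℕ) : Submodule ℂ (Lp E 2 (configMeasure n)) where
  carrier := {f | ∀ σ : Equiv.Perm (Fin n), permute E σ f = f}
  add_mem' := fun ha hb σ => by rw [map_add, ha σ, hb σ]
  zero_mem' := fun σ => map_zero _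
  smul_mem' := fun c f hf σ => by rw [map_smul, hf σ]

theorem isClosed_sector (n : ℕ) :
    IsClosed (Sector E n : Set (Lp E 2 (configMeasure n))) := by
  have : (Sector E n : Set (Lp E 2 (configMeasure n))) =
      ⋂ σ : Equiv.Perm (Fin n), {f | permute E σ f = f} := by
    ext f; simp [Sector]
  rw [this]
  exact isClosed_iInter fun σ => isClosed_eq (permute E σ).continuous continuous_id

instance [CompleteSpace E] (n : ℕ) : CompleteSpace (Sector E n) :=
  (isClosed_sector E n).completeSpace_coe

/-- The Hilbert space direct sum `⨁ₙ E ⊗ Sₙ(⊗ⁿ 𝔥) = E ⊗ 𝓕`, in its standard realization by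
symmetric square integrable `E`-valued functions. `Fock ℂ` is the symmetric Fock space `𝓕`, and
`Fock Hat` is `𝓗_at ⊗ 𝓕`. -/
abbrev Fock : Type _ := lp (fun n : ℕ => Sector E n) 2

end Fock

section Operators

variable {E E' : Type*} [NormedAddCommGroup E] [InnerProductSpace ℂ E]
  [NormedAddCommGroup E'] [InnerProductSpace ℂ E']

theorem sector_ae {n : ℕ} (f : Sector E n) (σ : Equiv.Perm (Fin n)) :
    ∀ᵐ k ∂configMeasure n, (f : Lp E 2 (configMeasure n)) (fun i => k (σ i)) =
      (f : Lp E 2 (configMeasure n)) k := by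
  have h1 := Lp.coeFn_compMeasurePreserving (f : Lp E 2 (configMeasure n))
    (measurePreserving_perm σ)
  have h2 : Lp.compMeasurePreserving _ (measurePreserving_perm σ)
      (f : Lp E 2 (configMeasure n)) = f := f.2 σ
  rw [h2] at h1
  filter_upwards [h1] with k hk using hk.symm

theorem sector_of_ae {n : ℕ} (f : Lp E 2 (configMeasure n))
    (h : ∀ σ : Equiv.Perm (Fin n), ∀ᵐ k ∂configMeasure n, f (fun i => k (σ i)) = f k) :
    f ∈ Sector E n := by
  intro σ
  apply Lp.ext
  filter_upwards [Lp.coeFn_compMeasurePreserving f (measurePreserving_perm σ), h σ] with k h1 h2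
  exact h1.trans h2

/-- `A ⊗ 1` on the `n`-photon sector: `f ↦ A ∘ f`. -/
def ampSector (A : E →L[ℂ] E') (n : ℕ) : Sector E n →L[ℂ] Sector E' n :=
  ((A.compLpL 2 (configMeasure n)).comp (Sector E n).subtypeL).codRestrict (Sector E' n) (by
    intro f
    apply sector_of_ae
    intro σ
    have h := A.coeFn_compLp (f : Lp E 2 (configMeasure n))
    have h' := (measurePreserving_perm σ).quasiMeasurePreserving.ae h
    filter_upwards [h, h', sector_ae f σ] with k h1 h2 h3
    exact h2.trans ((congrArg A h3).trans h1.symm))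

theorem norm_ampSector_le (A : E →L[ℂ] E') (n : ℕ) : ‖ampSector A n‖ ≤ ‖A‖ :=
  ContinuousLinearMap.opNorm_le_bound _ (norm_nonneg A) fun f =>
    A.norm_compLp_le (f : Lp E 2 (configMeasure n))

/-- The bounded operator `A ⊗ 1 : E ⊗ 𝓕 → E' ⊗ 𝓕`. -/
def amp (A : E →L[ℂ] E') : Fock E →L[ℂ] Fock E' :=
  lp.mapCLM 2 (ampSector A) (norm_nonneg A) (norm_ampSector_le A)

/-- The elementary tensor `φ ⊗ ψ ∈ E ⊗ 𝓕`: `(φ ⊗ ψ)ₙ(k₁, …, kₙ) = ψₙ(k₁, …, kₙ) φ`. -/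
def tmul (φ : E) (ψ : Fock ℂ) : Fock E :=
  amp (ContinuousLinearMap.toSpanSingleton ℂ φ) ψ

theorem tmul_ae (φ : E) (ψ : Fock ℂ) (n : ℕ) : ∀ᵐ k ∂configMeasure n,
    (tmul φ ψ n : Lp E 2 (configMeasure n)) k = (ψ n : Lp ℂ 2 (configMeasure n)) k • φ :=
  (ContinuousLinearMap.toSpanSingleton ℂ φ).coeFn_compLp _

/-- The defining property of the inner product of the Hilbert space tensor product. -/
theorem inner_tmul (φ φ' : E) (ψ ψ' : Fock ℂ) :
    inner ℂ (tmul φ ψ) (tmul φ' ψ') = inner ℂ φ φ' * inner ℂ ψ ψ' := by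
  rw [lp.inner_eq_tsum, lp.inner_eq_tsum, ← tsum_mul_left]
  congr 1
  funext n
  change inner ℂ (tmul φ ψ n : Lp E 2 (configMeasure n)) (tmul φ' ψ' n : Lp E 2 (configMeasure n))
    = _ * inner ℂ (ψ n : Lp ℂ 2 (configMeasure n)) (ψ' n : Lp ℂ 2 (configMeasure n))
  rw [L2.inner_def, L2.inner_def, ← integral_const_mul]
  apply integral_congr_ae
  filter_upwards [tmul_ae φ ψ n, tmul_ae φ' ψ' n] with k h1 h2
  rw [h1, h2, inner_smul_left, inner_smul_right]
  simp
  ring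

/-- The total photon energy `|𝐤₁| + ⋯ + |𝐤ₙ|`, the value of `H_f` at `(k₁, …, kₙ)`. -/
def energy {n : ℕ} (k : Fin n → Mode) : ℝ := ∑ i, omega (k i)

theorem measurable_energy {n : ℕ} : Measurable (energy : (Fin n → Mode) → ℝ) := by
  unfold energy omega
  fun_prop

theorem energy_perm {n : ℕ} (σ : Equiv.Perm (Fin n)) (k : Fin n → Mode) :
    energy (fun i => k (σ i)) = energy k :=
  Equiv.sum_comp σ fun i => omega (k i)

/-- Bounded Borel functions `ℝ → ℂ`. -/
structure BddBorel where
  toFun : ℝ → ℂ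
  measurable : Measurable toFun
  bound : ℝ≥0
  norm_le : ∀ t, ‖toFun t‖ ≤ bound

theorem memLp_energy_smul (f : BddBorel) {n : ℕ} (ψ : Lp E 2 (configMeasure n)) :
    MemLp (fun k => f.toFun (energy k) • ψ k) 2 (configMeasure n) := by
  refine MemLp.of_le_mul (c := f.bound) (Lp.memLp ψ) ?_ ?_
  · exact (f.measurable.comp measurable_energy).aestronglyMeasurable.smul
      (Lp.aestronglyMeasurable ψ)
  · refine Eventually.of_forall fun k => ?_
    rw [norm_smul]
    exact mul_le_mul_of_nonneg_right (f.norm_le _) (norm_nonneg _)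

variable (E) in
/-- `1 ⊗ f(H_f)` on the `n`-photon sector, for a bounded Borel function `f`: multiplication by
`f(|𝐤₁| + ⋯ + |𝐤ₙ|)`. -/
def fnSector (f : BddBorel) (n : ℕ) : Sector E n →L[ℂ] Sector E n :=
  LinearMap.mkContinuous
    { toFun := fun ψ => ⟨(memLp_energy_smul f (ψ : Lp E 2 (configMeasure n))).toLp _, by
        apply sector_of_ae
        intro σ
        have h := (memLp_energy_smul f (ψ : Lp E 2 (configMeasure n))).coeFn_toLp
        have h' := (measurePreserving_perm σ).quasiMeasurePreserving.ae h
        filter_upwards [h, h', sector_ae ψ σ] with k h1 h2 h3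
        rw [h1, h2, h3, energy_perm]⟩
      map_add' := fun ψ η => by
        apply Subtype.ext
        apply Lp.ext
        have h0 := (memLp_energy_smul f ((ψ + η : Sector E n) : Lp E 2 (configMeasure n))).coeFn_toLp
        have h1 := (memLp_energy_smul f (ψ : Lp E 2 (configMeasure n))).coeFn_toLp
        have h2 := (memLp_energy_smul f (η : Lp E 2 (configMeasure n))).coeFn_toLp
        have h3 := Lp.coeFn_add (ψ : Lp E 2 (configMeasure n)) (η : Lp E 2 (configMeasure n))
        refine h0.trans ?_
        refine EventuallyEq.trans ?_ (Lp.coeFn_add _ _).symm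
        filter_upwards [h1, h2, h3] with k e1 e2 e3
        have e3' : ((ψ + η : Sector E n) : Lp E 2 (configMeasure n)) k =
          (ψ : Lp E 2 (configMeasure n)) k + (η : Lp E 2 (configMeasure n)) k := e3
        rw [Pi.add_apply, e1, e2, e3', smul_add]
      map_smul' := fun c ψ => by
        apply Subtype.ext
        apply Lp.ext
        have h0 := (memLp_energy_smul f ((c • ψ : Sector E n) : Lp E 2 (configMeasure n))).coeFn_toLp
        have h1 := (memLp_energy_smul f (ψ : Lp E 2 (configMeasure n))).coeFn_toLp
        have h3 := Lp.coeFn_smul c (ψ : Lp E 2 (configMeasure n))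
        refine h0.trans ?_
        refine EventuallyEq.trans ?_ (Lp.coeFn_smul _ _).symm
        filter_upwards [h1, h3] with k e1 e3
        have e3' : ((c • ψ : Sector E n) : Lp E 2 (configMeasure n)) k =
          c • (ψ : Lp E 2 (configMeasure n)) k := e3
        rw [Pi.smul_apply, RingHom.id_apply, e1, e3', smul_comm] }
    f.bound (fun ψ => by
      refine Lp.norm_le_mul_norm_of_ae_le_mul ?_
      have h1 := (memLp_energy_smul f (ψ : Lp E 2 (configMeasure n))).coeFn_toLp
      filter_upwards [h1] with k e1
      refine (congrArg norm e1).le.trans ?_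
      rw [norm_smul]
      exact mul_le_mul_of_nonneg_right (f.norm_le _) (norm_nonneg _))

variable (E) in
/-- The bounded operator `1 ⊗ f(H_f)` on `E ⊗ 𝓕`, for a bounded Borel function `f`. -/
def fnHf (f : BddBorel) : Fock E →L[ℂ] Fock E :=
  lp.mapCLM 2 (fnSector E f) f.bound.2
    fun _ => LinearMap.mkContinuous_norm_le _ f.bound.2 _

end Operators

/-- The field energy `H_f`, the second quantization of `ω`: the (maximal) operator of
multiplication by `|𝐤₁| + ⋯ + |𝐤ₙ|` in each `n`-photon sector of `𝓕`. -/
def Hf : Fock ℂ →ₗ.[ℂ] Fock ℂ :=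
  Submodule.toLinearPMap
    { carrier := {p | ∀ n, ∀ᵐ k ∂configMeasure n,
        (p.2 n : Lp ℂ 2 (configMeasure n)) k =
          (energy k : ℂ) * (p.1 n : Lp ℂ 2 (configMeasure n)) k}
      add_mem' := by
        intro p q hp hq n
        filter_upwards [hp n, hq n,
          Lp.coeFn_add (p.1 n : Lp ℂ 2 (configMeasure n)) (q.1 n : Lp ℂ 2 (configMeasure n)),
          Lp.coeFn_add (p.2 n : Lp ℂ 2 (configMeasure n)) (q.2 n : Lp ℂ 2 (configMeasure n))]
          with k h1 h2 h3 h4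
        refine h4.trans ?_
        refine Eq.trans ?_ (congrArg _ h3.symm)
        rw [Pi.add_apply, Pi.add_apply, h1, h2, mul_add]
      zero_mem' := by
        intro n
        filter_upwards [Lp.coeFn_zero ℂ 2 (configMeasure n)] with k h
        have h' : (((0 : Fock ℂ × Fock ℂ).1 n : Sector ℂ n) : Lp ℂ 2 (configMeasure n)) k = 0 := h
        exact h'.trans (by rw [h', mul_zero])
      smul_mem' := by
        intro c p hp n
        filter_upwards [hp n,
          Lp.coeFn_smul c (p.1 n : Lp ℂ 2 (configMeasure n)),
          Lp.coeFn_smul c (p.2 n : Lp ℂ 2 (configMeasure n))]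
          with k h1 h3 h4
        refine h4.trans ?_
        refine Eq.trans ?_ (congrArg _ h3.symm)
        rw [Pi.smul_apply, Pi.smul_apply, h1, smul_eq_mul, smul_eq_mul]
        ring }

/-- The spectral projection `P_{[0,1]}(H_f)` comes from the indicator function of `[0,1]`. -/
def unitIntervalIndicator : BddBorel where
  toFun := (Set.Icc (0 : ℝ) 1).indicator fun _ => 1
  measurable := measurable_const.indicator measurableSet_Icc
  bound := 1
  norm_le := fun t => by
    by_cases h : t ∈ Set.Icc (0 : ℝ) 1 <;> simp [h]

/-- The reduced space `𝓗_red = P_{[0,1]}(H_f) 𝓕`. -/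
def Hred : Submodule ℂ (Fock ℂ) := LinearMap.range (fnHf ℂ unitIntervalIndicator).toLinearMap

/-! ### The space `L²(ℝ³ × {1,2}; 𝓛(E))` -/

section WeakL2

variable (E : Type*) [NormedAddCommGroup E] [InnerProductSpace ℂ E]

/-- The operator norm of a weakly measurable operator-valued function is measurable. -/
theorem aemeasurable_opNorm [TopologicalSpace.SeparableSpace E] {T : Mode → (E →L[ℂ] E)}
    (hT : ∀ x y : E, AEMeasurable (fun k => inner ℂ x (T k y)) modeMeasure) :
    AEMeasurable (fun k => ‖T k‖ₑ) modeMeasure := by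
  have key : (fun k => ‖T k‖ₑ) = fun k => ⨆ i : ℕ, ⨆ j : ℕ,
      ‖inner ℂ (TopologicalSpace.denseSeq E i) (T k (TopologicalSpace.denseSeq E j))‖ₑ /
        (‖TopologicalSpace.denseSeq E i‖ₑ * ‖TopologicalSpace.denseSeq E j‖ₑ) := by
    funext k
    apply le_antisymm
    · set S := ⨆ i : ℕ, ⨆ j : ℕ,
        ‖inner ℂ (TopologicalSpace.denseSeq E i) (T k (TopologicalSpace.denseSeq E j))‖ₑ /
        (‖TopologicalSpace.denseSeq E i‖ₑ * ‖TopologicalSpace.denseSeq E j‖ₑ) with hS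
      by_cases htop : S = ⊤
      · rw [htop]; exact le_top
      have hd : ∀ i j : ℕ,
          ‖inner ℂ (TopologicalSpace.denseSeq E i) (T k (TopologicalSpace.denseSeq E j))‖ ≤
          S.toReal * ‖TopologicalSpace.denseSeq E i‖ * ‖TopologicalSpace.denseSeq E j‖ := by
        intro i j
        by_cases h0 : ‖TopologicalSpace.denseSeq E i‖ₑ * ‖TopologicalSpace.denseSeq E j‖ₑ = 0
        · rcases mul_eq_zero.1 h0 with h | h
          · rw [enorm_eq_zero] at h; simp [h]
          · rw [enorm_eq_zero] at h; simp [h]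
        have h1 : ‖inner ℂ (TopologicalSpace.denseSeq E i)
            (T k (TopologicalSpace.denseSeq E j))‖ₑ ≤
            S * (‖TopologicalSpace.denseSeq E i‖ₑ * ‖TopologicalSpace.denseSeq E j‖ₑ) := by
          rw [← ENNReal.div_le_iff h0 (ENNReal.mul_ne_top enorm_ne_top enorm_ne_top)]
          exact (le_iSup (fun j => ‖inner ℂ (TopologicalSpace.denseSeq E i)
            (T k (TopologicalSpace.denseSeq E j))‖ₑ / (‖TopologicalSpace.denseSeq E i‖ₑ *
            ‖TopologicalSpace.denseSeq E j‖ₑ)) j).trans (le_iSup (fun i => ⨆ j : ℕ,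
            ‖inner ℂ (TopologicalSpace.denseSeq E i) (T k (TopologicalSpace.denseSeq E j))‖ₑ /
            (‖TopologicalSpace.denseSeq E i‖ₑ * ‖TopologicalSpace.denseSeq E j‖ₑ)) i)
        have h2 := ENNReal.toReal_mono
          (ENNReal.mul_ne_top htop (ENNReal.mul_ne_top enorm_ne_top enorm_ne_top)) h1
        rw [ENNReal.toReal_mul, ENNReal.toReal_mul, toReal_enorm, toReal_enorm,
          toReal_enorm, ← mul_assoc] at h2
        exact h2
      have hall : ∀ x y : E, ‖inner ℂ x (T k y)‖ ≤ S.toReal * ‖x‖ * ‖y‖ := by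
        intro x y
        have hD := (TopologicalSpace.denseRange_denseSeq E).prodMap
          (TopologicalSpace.denseRange_denseSeq E)
        have hc : IsClosed {p : E × E | ‖inner ℂ p.1 (T k p.2)‖ ≤ S.toReal * ‖p.1‖ * ‖p.2‖} :=
          isClosed_le (by fun_prop) (by fun_prop)
        exact hD.induction_on (p := fun p : E × E =>
          ‖inner ℂ p.1 (T k p.2)‖ ≤ S.toReal * ‖p.1‖ * ‖p.2‖) (x, y) hc fun a => hd a.1 a.2
      have hop : ‖T k‖ ≤ S.toReal := by
        refine ContinuousLinearMap.opNorm_le_bound _ ENNReal.toReal_nonneg fun y => ?_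
        by_cases hy : ‖T k y‖ = 0
        · rw [hy]; exact mul_nonneg ENNReal.toReal_nonneg (norm_nonneg _)
        have h := hall (T k y) y
        rw [inner_self_eq_norm_sq_to_K, norm_pow, RCLike.norm_ofReal, abs_norm] at h
        have hpos : 0 < ‖T k y‖ := lt_of_le_of_ne (norm_nonneg _) (Ne.symm hy)
        nlinarith
      rw [← ofReal_norm]
      exact (ENNReal.ofReal_le_ofReal hop).trans ENNReal.ofReal_toReal_le
    · refine iSup_le fun i => iSup_le fun j => ?_
      apply ENNReal.div_le_of_le_mul
      rw [← ofReal_norm, ← ofReal_norm, ← ofReal_norm,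
        ← ofReal_norm, ← ENNReal.ofReal_mul (norm_nonneg _),
        ← ENNReal.ofReal_mul (norm_nonneg _)]
      apply ENNReal.ofReal_le_ofReal
      refine (norm_inner_le_norm _ _).trans ?_
      have := (T k).le_opNorm (TopologicalSpace.denseSeq E j)
      nlinarith [norm_nonneg (TopologicalSpace.denseSeq E i)]
  rw [key]
  exact AEMeasurable.iSup fun i => AEMeasurable.iSup fun j => ((hT _ _).enorm).div_const _

variable [TopologicalSpace.SeparableSpace E]

/-- The weakly measurable, square integrable functions `T : ℝ³ × {1,2} → 𝓛(E)`. -/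
def weakL2Submodule : Submodule ℂ (Mode → (E →L[ℂ] E)) where
  carrier := {T | (∀ x y : E, AEMeasurable (fun k => inner ℂ x (T k y)) modeMeasure) ∧
    ∫⁻ k, ‖T k‖ₑ ^ (2 : ℝ) ∂modeMeasure < ⊤}
  add_mem' := by
    rintro T S ⟨hT, hT'⟩ ⟨hS, hS'⟩
    refine ⟨fun x y => ?_, ?_⟩
    · simp only [Pi.add_apply, add_apply, inner_add_right]
      exact (hT x y).add (hS x y)
    · refine lt_of_le_of_lt (lintegral_mono fun k => ?_)
        (ENNReal.lintegral_rpow_add_lt_top_of_lintegral_rpow_lt_top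
          (aemeasurable_opNorm E hT) hT' hS' one_le_two)
      exact ENNReal.rpow_le_rpow (enorm_add_le (T k) (S k)) zero_le_two
  zero_mem' := by
    refine ⟨fun x y => ?_, ?_⟩
    · simp
    · have : ∀ k : Mode, ‖(0 : Mode → (E →L[ℂ] E)) k‖ₑ ^ (2 : ℝ) = 0 := fun k => by
        have h0 : ‖(0 : Mode → (E →L[ℂ] E)) k‖ₑ = 0 := enorm_zero (E := E →L[ℂ] E)
        rw [h0, ENNReal.zero_rpow_of_pos zero_lt_two]
      simp only [this, lintegral_zero, ENNReal.zero_lt_top]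
  smul_mem' := by
    rintro c T ⟨hT, hT'⟩
    refine ⟨fun x y => ?_, ?_⟩
    · simp only [Pi.smul_apply, smul_apply, inner_smul_right]
      exact (hT x y).const_mul c
    · have : ∀ k, ‖(c • T) k‖ₑ ^ (2 : ℝ) = ‖c‖ₑ ^ (2 : ℝ) * ‖T k‖ₑ ^ (2 : ℝ) := fun k => by
        rw [Pi.smul_apply, enorm_smul, ENNReal.mul_rpow_of_nonneg _ _ zero_le_two]
      simp only [this]
      rw [lintegral_const_mul' _ _ (ENNReal.rpow_ne_top_of_nonneg zero_le_two enorm_ne_top)]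
      exact ENNReal.mul_lt_top (ENNReal.rpow_lt_top_of_nonneg zero_le_two enorm_ne_top) hT'

/-- The space of weakly measurable functions `T : ℝ³ × {1,2} → 𝓛(E)` with
`‖T‖² = ∫ ‖T(k)‖² dk < ∞`; functions that agree almost everywhere are not yet identified. -/
def WeakL2 : Type _ := weakL2Submodule E

instance : AddCommGroup (WeakL2 E) := inferInstanceAs (AddCommGroup (weakL2Submodule E))

instance : Module ℂ (WeakL2 E) := inferInstanceAs (Module ℂ (weakL2Submodule E))

instance : CoeFun (WeakL2 E) fun _ => Mode → (E →L[ℂ] E) := ⟨fun T => T.1⟩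

instance : Norm (WeakL2 E) :=
  ⟨fun T => ((∫⁻ k, ‖T k‖ₑ ^ (2 : ℝ) ∂modeMeasure) ^ (1 / 2 : ℝ)).toReal⟩

theorem weakL2_core : SeminormedSpace.Core ℂ (WeakL2 E) where
  norm_nonneg := fun _ => ENNReal.toReal_nonneg
  norm_smul := by
    intro c T
    have : ∀ k, ‖(c • T) k‖ₑ ^ (2 : ℝ) = ‖c‖ₑ ^ (2 : ℝ) * ‖T k‖ₑ ^ (2 : ℝ) := fun k => by
      change ‖c • (T k)‖ₑ ^ (2 : ℝ) = _
      rw [enorm_smul, ENNReal.mul_rpow_of_nonneg _ _ zero_le_two]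
    change ((∫⁻ k, ‖(c • T) k‖ₑ ^ (2 : ℝ) ∂modeMeasure) ^ (1 / 2 : ℝ)).toReal = _
    simp only [this]
    rw [lintegral_const_mul' _ _ (ENNReal.rpow_ne_top_of_nonneg zero_le_two enorm_ne_top),
      ENNReal.mul_rpow_of_nonneg _ _ (by norm_num), ← ENNReal.rpow_mul, ENNReal.toReal_mul]
    rw [mul_one_div_cancel two_ne_zero, ENNReal.rpow_one, toReal_enorm]
    rfl
  norm_triangle := by
    intro T S
    have hfin : ∀ R : WeakL2 E, (∫⁻ k, ‖R k‖ₑ ^ (2 : ℝ) ∂modeMeasure) ^ (1 / 2 : ℝ) ≠ ⊤ :=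
      fun R => ENNReal.rpow_ne_top_of_nonneg (by norm_num) R.2.2.ne
    change ((∫⁻ k, ‖(T + S) k‖ₑ ^ (2 : ℝ) ∂modeMeasure) ^ (1 / 2 : ℝ)).toReal ≤
      ((∫⁻ k, ‖T k‖ₑ ^ (2 : ℝ) ∂modeMeasure) ^ (1 / 2 : ℝ)).toReal +
      ((∫⁻ k, ‖S k‖ₑ ^ (2 : ℝ) ∂modeMeasure) ^ (1 / 2 : ℝ)).toReal
    rw [← ENNReal.toReal_add (hfin T) (hfin S)]
    refine ENNReal.toReal_mono (ENNReal.add_ne_top.2 ⟨hfin T, hfin S⟩) ?_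
    refine le_trans ?_ (ENNReal.lintegral_Lp_add_le (aemeasurable_opNorm E T.2.1)
      (aemeasurable_opNorm E S.2.1) one_le_two)
    refine ENNReal.rpow_le_rpow (lintegral_mono fun k => ?_) (by norm_num)
    exact ENNReal.rpow_le_rpow (enorm_add_le (T k) (S k)) zero_le_two

instance : SeminormedAddCommGroup (WeakL2 E) := SeminormedAddCommGroup.ofCore (weakL2_core E)

instance : NormedSpace ℂ (WeakL2 E) where
  norm_smul_le := fun c T => ((weakL2_core E).norm_smul c T).le

/-- The normed space `L²(ℝ³ × {1,2}; 𝓛(E))`: functions modulo equality almost everywhere. -/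
abbrev OpL2 : Type _ := SeparationQuotient (WeakL2 E)

end WeakL2

/-! ### Partially defined operators -/

section PMap

variable {E F K : Type*} [NormedAddCommGroup E] [InnerProductSpace ℂ E]
  [NormedAddCommGroup F] [InnerProductSpace ℂ F] [NormedAddCommGroup K] [InnerProductSpace ℂ K]

/-- A bounded operator as an everywhere defined partial operator. -/
def ofBdd (A : E →L[ℂ] F) : E →ₗ.[ℂ] F := A.toLinearMap.toPMap ⊤

/-- The product `B A` with its natural domain `{x ∈ D(A) | A x ∈ D(B)}`. -/
def pcomp (B : F →ₗ.[ℂ] K) (A : E →ₗ.[ℂ] F) : E →ₗ.[ℂ] K where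
  domain :=
    { carrier := {x | ∃ h : x ∈ A.domain, A ⟨x, h⟩ ∈ B.domain}
      add_mem' := fun ⟨h, h'⟩ ⟨k, k'⟩ =>
        ⟨A.domain.add_mem h k, by
          have := B.domain.add_mem h' k'
          rwa [← LinearPMap.map_add] at this⟩
      zero_mem' := ⟨A.domain.zero_mem, by
          have := B.domain.zero_mem
          rwa [← LinearPMap.map_zero A] at this⟩
      smul_mem' := fun c _ ⟨h, h'⟩ =>
        ⟨A.domain.smul_mem c h, by
          have := B.domain.smul_mem c h'
          rwa [← LinearPMap.map_smul] at this⟩ }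
  toFun :=
    { toFun := fun x => B ⟨A ⟨x, x.2.1⟩, x.2.2⟩
      map_add' := fun x y => by
        rw [← LinearPMap.map_add]
        exact congrArg B (Subtype.ext (LinearPMap.map_add A ⟨x, x.2.1⟩ ⟨y, y.2.1⟩))
      map_smul' := fun c x => by
        rw [RingHom.id_apply, ← LinearPMap.map_smul]
        exact congrArg B (Subtype.ext (LinearPMap.map_smul A c ⟨x, x.2.1⟩)) }

local infixr:80 " ∘ₚ " => pcomp

/-- `A - z`, with the domain of `A`. -/
def subScalar (A : E →ₗ.[ℂ] E) (z : ℂ) : E →ₗ.[ℂ] E where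
  domain := A.domain
  toFun := A.toFun - z • A.domain.subtype

/-- `A` is bounded invertible in the (not necessarily closed) subspace `Y`:
`A : D(A) ∩ Y → Y` is a bijection with bounded inverse. -/
def BddInvertibleIn (A : E →ₗ.[ℂ] E) (Y : Submodule ℂ E) : Prop :=
  (∀ x : A.domain, (x : E) ∈ Y → A x ∈ Y) ∧
  (∀ y ∈ Y, ∃! x : A.domain, (x : E) ∈ Y ∧ A x = y) ∧
  ∃ C : ℝ, ∀ x : A.domain, (x : E) ∈ Y → ‖(x : E)‖ ≤ C * ‖A x‖

/-- The inverse of `A : D(A) ∩ Y → Y`, as a partial operator (with domain `Y` if `A` is bounded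
invertible in `Y`). -/
def inverseIn (A : E →ₗ.[ℂ] E) (Y : Submodule ℂ E) : E →ₗ.[ℂ] E := (A.domRestrict Y).inverse

/-- `R` is the bounded inverse of `z - A : D(A) → E`. -/
def IsResolventAt (A : E →ₗ.[ℂ] E) (z : ℂ) (R : E →L[ℂ] E) : Prop :=
  (∀ y : E, ∃ h : R y ∈ A.domain, z • R y - A ⟨R y, h⟩ = y) ∧
  ∀ x : A.domain, R (z • (x : E) - A x) = x

/-- The resolvent set `ρ(A)`. -/
def resSet (A : E →ₗ.[ℂ] E) : Set ℂ := {z | ∃ R, IsResolventAt A z R}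

/-- The spectrum `σ(A)`. -/
def spec (A : E →ₗ.[ℂ] E) : Set ℂ := (resSet A)ᶜ

open Classical in
/-- The resolvent `(z - A)⁻¹` for `z ∈ ρ(A)`, and `0` otherwise. -/
def res (A : E →ₗ.[ℂ] E) (z : ℂ) : E →L[ℂ] E :=
  if h : ∃ R, IsResolventAt A z R then h.choose else 0

/-- The eigenspace `ker (A - e)`. -/
def eigenspaceOf (A : E →ₗ.[ℂ] E) (e : ℂ) : Submodule ℂ E :=
  A.graph.comap (LinearMap.prod LinearMap.id (e • LinearMap.id))

/-- The Riesz projection `(2πi)⁻¹ ∮_{|z - e| = ε} (z - A)⁻¹ dz` of an isolated point `e` of the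
spectrum. The integral does not depend on `ε` for small `ε > 0`. -/
def rieszProj (A : E →ₗ.[ℂ] E) (e : ℂ) : E →L[ℂ] E :=
  limUnder (𝓝[>] (0 : ℝ)) fun ε =>
    (2 * Real.pi * Complex.I : ℂ)⁻¹ • circleIntegral (fun z => res A z) e ε

/-- `T(s)`, `s ∈ V ⊆ ℂ^ν`, is an analytic family of operators in the sense of Kato. -/
def IsKatoAnalytic {ν : ℕ} (T : (Fin ν → ℂ) → (E →ₗ.[ℂ] E)) (V : Set (Fin ν → ℂ)) : Prop :=
  (∀ s ∈ V, (T s).IsClosed ∧ (resSet (T s)).Nonempty) ∧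
  ∀ s₁ ∈ V, ∃ l : ℂ, (∀ᶠ s in 𝓝 s₁, l ∈ resSet (T s)) ∧
    AnalyticAt ℂ (fun s => res (T s) l) s₁

/-- `H_χ = T + χ W χ` with `W = H - T`. -/
def dressed (H T : E →ₗ.[ℂ] E) (χ : E →L[ℂ] E) : E →ₗ.[ℂ] E :=
  T + ofBdd χ ∘ₚ (H - T) ∘ₚ ofBdd χ

/-- `(H, T)` is a Feshbach pair for `χ`, where `χ'` is the complementary operator (usually written
as `χ` with a bar). -/
structure IsFeshbachPair (H T : E →ₗ.[ℂ] E) (χ χ' : E →L[ℂ] E) : Prop where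
  commute : χ * χ' = χ' * χ
  ne_zero : χ ≠ 0
  ne_zero' : χ' ≠ 0
  sq_add_sq : χ ^ 2 + χ' ^ 2 = 1
  closed_H : H.IsClosed
  closed_T : T.IsClosed
  domain_eq : H.domain = T.domain
  /-- `χ T ⊆ T χ` -/
  comm : ofBdd χ ∘ₚ T ≤ T ∘ₚ ofBdd χ
  comm' : ofBdd χ' ∘ₚ T ≤ T ∘ₚ ofBdd χ'
  inv_T : BddInvertibleIn T (LinearMap.range χ'.toLinearMap)
  inv_H : BddInvertibleIn (dressed H T χ') (LinearMap.range χ'.toLinearMap)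
  /-- `χ' (H_χ')⁻¹ χ' W χ` is defined on `D(T)` and bounded. -/
  bounded : ∃ C : ℝ, ∀ x ∈ T.domain,
    ∃ h : x ∈ (ofBdd χ' ∘ₚ inverseIn (dressed H T χ') (LinearMap.range χ'.toLinearMap) ∘ₚ
      ofBdd χ' ∘ₚ (H - T) ∘ₚ ofBdd χ).domain,
      ‖(ofBdd χ' ∘ₚ inverseIn (dressed H T χ') (LinearMap.range χ'.toLinearMap) ∘ₚ
        ofBdd χ' ∘ₚ (H - T) ∘ₚ ofBdd χ) ⟨x, h⟩‖ ≤ C * ‖x‖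

end PMap

/-! ### The Hamiltonian -/

section Model

local infixr:80 " ∘ₚ " => pcomp

variable {Hat : Type*} [NormedAddCommGroup Hat] [InnerProductSpace ℂ Hat] [CompleteSpace Hat]
  [TopologicalSpace.SeparableSpace Hat] {ν : ℕ}

/-- The creation operator `a*(G)`: the closure of the linear operator given by
`a*(G)(φ ⊗ ψ) = √(n+1) S_{n+1}(G φ ⊗ ψ)` for `φ ∈ 𝓗_at` and `ψ` in the `n`-photon sector, where
`S_{n+1}` is symmetrization. -/
def creation (G : WeakL2 Hat) : Fock Hat →ₗ.[ℂ] Fock Hat :=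
  (Submodule.span ℂ {p : Fock Hat × Fock Hat |
    ∃ (φ : Hat) (n : ℕ) (ψ : Sector ℂ n) (η : Sector Hat (n + 1)),
      (∀ᵐ k ∂configMeasure (n + 1), (η : Lp Hat 2 (configMeasure (n + 1))) k =
        ((Real.sqrt (n + 1) / (n + 1).factorial : ℝ) : ℂ) • ∑ σ : Equiv.Perm (Fin (n + 1)),
          (ψ : Lp ℂ 2 (configMeasure n)) (fun i => k (σ i.succ)) • G (k (σ 0)) φ) ∧
      p = (tmul φ (lp.single 2 n ψ), lp.single 2 (n + 1) η)}).toLinearPMap.closure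

/-- The annihilation operator `a(G) = a*(G)*`. -/
def annihilation (G : WeakL2 Hat) : Fock Hat →ₗ.[ℂ] Fock Hat := (creation G).adjoint

/-- `W(s) = a(G_{s̄}) + a*(G_s)`. -/
def interaction (G : (Fin ν → ℂ) → WeakL2 Hat) (s : Fin ν → ℂ) : Fock Hat →ₗ.[ℂ] Fock Hat :=
  annihilation (G (star s)) + creation (G s)

/-- `A ⊗ 1 + 1 ⊗ H_f` on the algebraic tensor product `D(A) ⊗ D(H_f)`. -/
def freeCore (A : Hat →ₗ.[ℂ] Hat) : Fock Hat →ₗ.[ℂ] Fock Hat :=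
  (Submodule.span ℂ {p : Fock Hat × Fock Hat | ∃ (φ : A.domain) (ψ : Hf.domain),
    p = (tmul (φ : Hat) (ψ : Fock ℂ),
      tmul (A φ) (ψ : Fock ℂ) + tmul (φ : Hat) (Hf ψ))}).toLinearPMap

/-- The Hamiltonian `H_g(s) = T(s) ⊗ 1 + 1 ⊗ H_f + g W(s)`, the closure of the operator defined by
this expression on `D(T(s)) ⊗ D(H_f)`; here `T` is the family of atomic Hamiltonians. -/
def Hg (T : (Fin ν → ℂ) → (Hat →ₗ.[ℂ] Hat)) (G : (Fin ν → ℂ) → WeakL2 Hat) (g : ℝ)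
    (s : Fin ν → ℂ) : Fock Hat →ₗ.[ℂ] Fock Hat :=
  (freeCore (T s) + (g : ℂ) • interaction G s).closure

/-! ### Atomic eigenvalue and eigenprojection -/

/-- The set of `s` for which the disc `|e - E₀| < r` contains exactly one point of the spectrum of
`T(s)` and this point is a non-degenerate eigenvalue (its Riesz projection has rank one). -/
def branchDomain (T : (Fin ν → ℂ) → (Hat →ₗ.[ℂ] Hat)) (E₀ r : ℝ) : Set (Fin ν → ℂ) :=
  {s | ∃ e : ℂ, spec (T s) ∩ Metric.ball (E₀ : ℂ) r = {e} ∧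
    Module.finrank ℂ (LinearMap.range (rieszProj (T s) e).toLinearMap) = 1}

/-- `E_at(s)`: the point of the spectrum of `T(s)` in the disc `|e - E₀| < r`. -/
def Eat (T : (Fin ν → ℂ) → (Hat →ₗ.[ℂ] Hat)) (E₀ r : ℝ) (s : Fin ν → ℂ) : ℂ :=
  Classical.epsilon fun e => spec (T s) ∩ Metric.ball (E₀ : ℂ) r = {e}

/-- `P_at(s)`: the Riesz projection of `T(s)` for the eigenvalue `E_at(s)`. -/
def Pat (T : (Fin ν → ℂ) → (Hat →ₗ.[ℂ] Hat)) (E₀ r : ℝ) (s : Fin ν → ℂ) : Hat →L[ℂ] Hat :=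
  rieszProj (T s) (Eat T E₀ r s)

/-! ### Smooth cutoffs and the effective Hamiltonian -/

/-- The smooth functions `χ, χ' : ℝ → [0,1]` with `χ² + χ'² = 1`, `χ = 1` on `(-∞, 3/4]` and
`χ = 0` on `[1, ∞)`. -/
structure Cutoff where
  chi : ℝ → ℝ
  chi' : ℝ → ℝ
  smooth : ContDiff ℝ ∞ chi
  smooth' : ContDiff ℝ ∞ chi'
  mem : ∀ t, chi t ∈ Set.Icc (0 : ℝ) 1
  mem' : ∀ t, chi' t ∈ Set.Icc (0 : ℝ) 1
  eq_one : ∀ t ≤ 3 / 4, chi t = 1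
  eq_zero : ∀ t, 1 ≤ t → chi t = 0
  sq_add_sq : ∀ t, chi t ^ 2 + chi' t ^ 2 = 1

/-- A continuous function with values in `[0,1]` as a bounded Borel function. -/
def bddBorelOf (f : ℝ → ℝ) (hf : Continuous f) (h : ∀ t, f t ∈ Set.Icc (0 : ℝ) 1) : BddBorel where
  toFun := fun t => (f t : ℂ)
  measurable := (Complex.continuous_ofReal.comp hf).measurable
  bound := 1
  norm_le := fun t => by
    rw [Complex.norm_real, Real.norm_eq_abs, abs_of_nonneg (h t).1]
    exact (h t).2

variable (Hat) in
/-- `χ₁ = 1 ⊗ χ(H_f)` on `𝓗_at ⊗ 𝓕`. -/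
def Cutoff.chi₁ (c : Cutoff) : Fock Hat →L[ℂ] Fock Hat :=
  fnHf Hat (bddBorelOf c.chi c.smooth.continuous c.mem)

variable (Hat) in
/-- `χ'₁ = 1 ⊗ χ'(H_f)` on `𝓗_at ⊗ 𝓕`. -/
def Cutoff.chi'₁ (c : Cutoff) : Fock Hat →L[ℂ] Fock Hat :=
  fnHf Hat (bddBorelOf c.chi' c.smooth'.continuous c.mem')

/-- `𝛘 = P ⊗ χ₁`. -/
def boldChi (c : Cutoff) (P : Hat →L[ℂ] Hat) : Fock Hat →L[ℂ] Fock Hat :=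
  amp P * c.chi₁ Hat

/-- `𝛘' = (1 - P) ⊗ 1 + P ⊗ χ'₁`. -/
def boldChi' (c : Cutoff) (P : Hat →L[ℂ] Hat) : Fock Hat →L[ℂ] Fock Hat :=
  amp (1 - P) + amp P * c.chi'₁ Hat

/-- `B = ⟨L⟩_at`, i.e. `L` is defined on `Ran P ⊗ 𝓕` and `(P ⊗ 1) L (P ⊗ 1) = P ⊗ B`, for a rank
one projection `P`. -/
def IsAtExpectation (P : Hat →L[ℂ] Hat) (L : Fock Hat →ₗ.[ℂ] Fock Hat)
    (B : Fock ℂ →L[ℂ] Fock ℂ) : Prop :=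
  ∀ (φ : Hat) (ψ : Fock ℂ), ∃ h : tmul (P φ) ψ ∈ L.domain,
    amp P (L ⟨tmul (P φ) ψ, h⟩) = tmul (P φ) (B ψ)

/-- `B` is the effective Hamiltonian `H_g^{(0)}[s,z]` on `𝓗_red`: the restriction to `𝓗_red` of
`e - z + H_f + g ⟨χ₁ W χ₁⟩ - g² ⟨χ₁ W 𝛘' (H - z)_{𝛘'}⁻¹ 𝛘' W χ₁⟩`, where `H = H_g(s)`,
`H₀ = H_0(s)`, `W = W(s)`, `P = P_at(s)`, `e = E_at(s)`. -/
def IsEffectiveHamiltonian (c : Cutoff) (H H₀ W : Fock Hat →ₗ.[ℂ] Fock Hat) (P : Hat →L[ℂ] Hat)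
    (e : ℂ) (g : ℝ) (z : ℂ) (B : Hred →L[ℂ] Hred) : Prop :=
  ∃ B₁ B₂ : Fock ℂ →L[ℂ] Fock ℂ,
    IsAtExpectation P (ofBdd (c.chi₁ Hat) ∘ₚ W ∘ₚ ofBdd (c.chi₁ Hat)) B₁ ∧
    IsAtExpectation P (ofBdd (c.chi₁ Hat) ∘ₚ W ∘ₚ ofBdd (boldChi' c P) ∘ₚ
      inverseIn (dressed (subScalar H z) (subScalar H₀ z) (boldChi' c P))
        (LinearMap.range (boldChi' c P).toLinearMap) ∘ₚ
      ofBdd (boldChi' c P) ∘ₚ W ∘ₚ ofBdd (c.chi₁ Hat)) B₂ ∧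
    ∀ ψ : Hred, ∃ h : (ψ : Fock ℂ) ∈ Hf.domain,
      (B ψ : Fock ℂ) = (e - z) • (ψ : Fock ℂ) + Hf ⟨ψ, h⟩ + (g : ℂ) • B₁ ψ - (g : ℂ) ^ 2 • B₂ ψ

/-! ### The hypotheses -/

/-- Hypothesis on the coupling functions: `s ↦ G_s` is a bounded analytic function on `V` with
values in `L²(ℝ³ × {1,2}; 𝓛(𝓗_at))`, and `sup_{s ∈ V} ∫ |k|^{-2-2μ} ‖G_s(k)‖² dk < ∞` for some
`μ > 0`. -/
structure HypG (V : Set (Fin ν → ℂ)) (G : (Fin ν → ℂ) → WeakL2 Hat) : Prop where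
  analytic : AnalyticOnNhd ℂ (fun s => (SeparationQuotient.mk (G s) : OpL2 Hat)) V
  bounded : ∃ C : ℝ, ∀ s ∈ V, ‖G s‖ ≤ C
  infrared : ∃ μ : ℝ, 0 < μ ∧ ∃ C : ℝ≥0, ∀ s ∈ V,
    ∫⁻ k, ‖G s k‖ₑ ^ (2 : ℝ) / ENNReal.ofReal (omega k ^ (2 + 2 * μ)) ∂modeMeasure ≤ C

/-- Hypothesis on the atomic Hamiltonians: `T(s)` is an analytic family in the sense of Kato,
`T(s)* = T(s̄)`, and at the real point `s₀ ∈ V` the number `E₀ = inf σ(T(s₀))` is an isolated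
non-degenerate eigenvalue. -/
structure HypH (V : Set (Fin ν → ℂ)) (T : (Fin ν → ℂ) → (Hat →ₗ.[ℂ] Hat)) (s₀ : Fin ν → ℂ)
    (E₀ : ℝ) : Prop where
  kato : IsKatoAnalytic T V
  dense : ∀ s ∈ V, Dense ((T s).domain : Set Hat)
  adjoint : ∀ s ∈ V, (T s).adjoint = T (star s)
  mem : s₀ ∈ V
  real : star s₀ = s₀
  isGLB : IsGLB {x : ℝ | (x : ℂ) ∈ spec (T s₀)} E₀
  isolated : ∃ δ > 0, spec (T s₀) ∩ Metric.ball (E₀ : ℂ) δ = {(E₀ : ℂ)}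
  nondegenerate : Module.finrank ℂ (eigenspaceOf (T s₀) E₀) = 1

/-- Hypothesis on the reduced atomic resolvent: `𝒰` is an open neighbourhood of `(s₀, E₀)` over
which `E_at` and `P_at` are defined, `|E_at(s) - z| < 1/2` on `𝒰`, and
`sup_{(s,z) ∈ 𝒰} sup_{q ≥ 0} ‖(q + 1)(T(s) - z + q)⁻¹ (1 - P_at(s))‖ < ∞`. -/
structure HypR (V : Set (Fin ν → ℂ)) (T : (Fin ν → ℂ) → (Hat →ₗ.[ℂ] Hat)) (s₀ : Fin ν → ℂ)
    (E₀ r : ℝ) (𝒰 : Set ((Fin ν → ℂ) × ℂ)) : Prop where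
  isOpen : IsOpen 𝒰
  mem : (s₀, (E₀ : ℂ)) ∈ 𝒰
  subset : ∀ p ∈ 𝒰, p.1 ∈ V ∧ p.1 ∈ branchDomain T E₀ r
  close : ∀ p ∈ 𝒰, ‖Eat T E₀ r p.1 - p.2‖ < 1 / 2
  bound : ∃ C : ℝ, ∀ p ∈ 𝒰, ∀ q : ℝ, 0 ≤ q →
    BddInvertibleIn (subScalar (T p.1) (p.2 - q))
      (LinearMap.range (1 - Pat T E₀ r p.1).toLinearMap) ∧
    ∀ x : Hat, ∃ h : (1 - Pat T E₀ r p.1) x ∈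
        (inverseIn (subScalar (T p.1) (p.2 - q))
          (LinearMap.range (1 - Pat T E₀ r p.1).toLinearMap)).domain,
      (q + 1) * ‖inverseIn (subScalar (T p.1) (p.2 - q))
        (LinearMap.range (1 - Pat T E₀ r p.1).toLinearMap) ⟨(1 - Pat T E₀ r p.1) x, h⟩‖ ≤
        C * ‖x‖

end Model

end

end QED

/-!
The idea is to express every unbounded operator of the problem through bounded operators on
`𝓗 = 𝓗_at ⊗ 𝓕`, whose dependence on `(s, z)` can be controlled in norm.

*The interaction.* A Cauchy–Schwarz inequality with weights `ω(k)` (`norm_symm_sum_sq_le`) shows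
that `a*(G) (1 + H_f)⁻¹` and `(1 + H_f)⁻¹ a*(G)` extend to bounded operators, with norm at most the
norm of `G` in `L²((1 + 1/ω) dk)`. Taking adjoints, `W(s) (1 + H_f)⁻¹` is the bounded operator
`boundedInteraction G s` (`interaction_resHf_mem`). With a cutoff of the photon energies below `δ`
it depends continuously on `G` in the unweighted norm, hence analytically on `s`; the infrared
condition makes the limit `δ → 0` uniform on `V` (`HypG.exists_uniform`), and Osgood's lemma
(`osgoodSpace_fin`) turns holomorphy along lines into joint analyticity
(`analyticOnNhd_boundedInteraction`).

*The free Hamiltonian.* `H_0(s) - z` acts at photon energy `q` as `H_at(s) - z + q`. On the range of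
`1 - P_at(s)` hypothesis (III) bounds the inverse by `C/(q + 1)`. On the range of `P_at(s)` the
operator is `E_at(s) - z + q`, which may vanish for small `q`. Since the cutoff `χ'` vanishes for
`q ≤ 3/4`, the energy `q` may be replaced there by `θ(q) = max(q, 3/4)`, and
`|E_at(s) - z| < 1/2` makes `E_at(s) - z + θ(q)` invertible. The inverse of the modified operator
`H_0(s) - z + P_at(s) ⊗ (θ(H_f) - H_f)` is `R = opFn (freeRes ..)`, and
`ρ = (1 + H_f) R = opFn (regRes ..)` is bounded uniformly on `𝒰`; here `opFn F` is the operator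
that acts as `F(q)` where the photons have total energy `q`. The Riesz projection and the
eigenvalue depend analytically on `s` (`HypR.analyticAt_proj`), and so does each value of the
uniformly bounded function `q ↦ ρ(q)`; therefore `ρ` is analytic in the supremum norm
(`HypR.analyticOnNhd_regRes`).

*The Feshbach pair.* With `K = P_at ⊗ (θ(H_f) - H_f)`, the operator `B = g W ρ` has norm less than
one for small `g`, uniformly on `𝒰`, and the graph of `H_g(s) - z` is
`{(R u, u - K R u + B u)}` (`graph_closure_perturbed`, `IsAtomicPoint.graph_Hg`). Since `K χ' = 0`,
the operator dressed with `χ'` acts on `Ran χ'` as `(1 + χ' B χ') R⁻¹`, which a Neumann series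
inverts. This is the content of `FeshbachData.isFeshbachPair`, an abstract statement about `R`, `K`,
`B` and the cutoffs.

*The effective Hamiltonian.* Writing `χ₁ = (1 + H_f)⁻¹ (1 + H_f) χ₁` turns both terms of the
effective Hamiltonian into products of `W (1 + H_f)⁻¹`, `ρ`, `(1 + χ' B χ')⁻¹` and bounded functions
of `H_f`. For the rank one projection `P_at` the partial expectation of a bounded operator is given
by an explicit formula (`isAtExpectation_iff`). Hence `H_g^{(0)}[s, z]` exists, is unique, and
equals an expression that is analytic in `(s, z)` (`isEffectiveHamiltonian_iff`,
`analyticAt_effectiveFamily`).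
-/

namespace QED

noncomputable section

/-! ### Holomorphic functions with values in a Banach space -/

/-- Holomorphy along every complex line. -/
def LineHolomorphicOn {M X : Type*} [NormedAddCommGroup M] [NormedSpace ℂ M]
    [NormedAddCommGroup X] [NormedSpace ℂ X] (f : M → X) (U : Set M) : Prop :=
  ∀ x ∈ U, ∀ v : M, DifferentiableAt ℂ (fun t : ℂ => f (x + t • v)) 0

theorem LineHolomorphicOn.differentiableAt {M X : Type*} [NormedAddCommGroup M] [NormedSpace ℂ M]
    [NormedAddCommGroup X] [NormedSpace ℂ X]
    {f : M → X} {U : Set M} (h : LineHolomorphicOn f U) {x v : M} {t : ℂ} (ht : x + t • v ∈ U) :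
    DifferentiableAt ℂ (fun t : ℂ => f (x + t • v)) t := by
  have h1 := h _ ht v
  have h2 : DifferentiableAt ℂ (fun t' : ℂ => f (x + t • v + t' • v)) (t - t) := by
    rwa [sub_self]
  have h3 := h2.comp t (f := fun t' : ℂ => t' - t) (by fun_prop)
  refine h3.congr_of_eventuallyEq (Eventually.of_forall fun t' => ?_)
  simp only [Function.comp_apply]
  congr 1
  module

theorem isOpen_line_preimage {M : Type*} [NormedAddCommGroup M] [NormedSpace ℂ M] {U : Set M}
    (hU : IsOpen U) (x v : M) : IsOpen {t : ℂ | x + t • v ∈ U} :=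
  hU.preimage (f := fun t : ℂ => x + t • v) (by fun_prop)

theorem lineHolomorphicOn_of_analyticOnNhd {M X : Type*} [NormedAddCommGroup M] [NormedSpace ℂ M]
    [NormedAddCommGroup X] [NormedSpace ℂ X]
    {f : M → X} {U : Set M} (h : AnalyticOnNhd ℂ f U) : LineHolomorphicOn f U := by
  intro x hx v
  have h1 : DifferentiableAt ℂ f (x + (0 : ℂ) • v) := by
    simpa using (h x hx).differentiableAt
  exact h1.comp (0 : ℂ) (f := fun t : ℂ => x + t • v) (by fun_prop)

section Holomorphy

variable {X Y : Type*} [NormedAddCommGroup X] [NormedSpace ℂ X] [CompleteSpace X]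
  [NormedAddCommGroup Y] [NormedSpace ℂ Y] [CompleteSpace Y]

/-- A bounded function on a plane domain is holomorphic if it is holomorphic after composition with
each member of a norming family of operators: the Schwarz lemma makes it continuous, hence it is its
own Cauchy integral. -/
theorem differentiableOn_of_norming {ι : Type*} {D : Set ℂ} (hD : IsOpen D) {g : ℂ → X} {C : ℝ}
    (hb : ∀ z ∈ D, ‖g z‖ ≤ C) (l : ι → X →L[ℂ] Y) (hl : ∀ i x, ‖l i x‖ ≤ ‖x‖)
    (hn : ∀ x c, 0 ≤ c → (∀ i, ‖l i x‖ ≤ c) → ‖x‖ ≤ c)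
    (hd : ∀ i, DifferentiableOn ℂ (fun z => l i (g z)) D) : DifferentiableOn ℂ g D := by
  have hcont : ContinuousOn g D := by
    intro z₀ hz₀
    apply ContinuousAt.continuousWithinAt
    obtain ⟨r, hr, hrD⟩ := Metric.isOpen_iff.1 hD z₀ hz₀
    have hC : 0 ≤ C := (norm_nonneg _).trans (hb z₀ hz₀)
    have key : ∀ z ∈ Metric.ball z₀ r, ‖g z - g z₀‖ ≤ (2 * C) / r * dist z z₀ := by
      intro z hz
      refine hn _ _ (by positivity) fun i => ?_
      have := Complex.dist_le_div_mul_dist_of_mapsTo_ball (R₂ := 2 * C) ((hd i).mono hrD) (by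
        intro w hw
        rw [Metric.mem_closedBall, dist_eq_norm, ← map_sub]
        refine (hl i _).trans ((norm_sub_le _ _).trans ?_)
        linarith [hb w (hrD hw), hb z₀ hz₀]) hz
      rwa [dist_eq_norm, ← map_sub] at this
    rw [Metric.continuousAt_iff']
    intro ε hε
    have h0 : Tendsto (fun z => (2 * C) / r * dist z z₀) (𝓝 z₀) (𝓝 0) := by
      have : Continuous (fun z => (2 * C) / r * dist z z₀) := by fun_prop
      simpa using this.tendsto z₀
    filter_upwards [Metric.ball_mem_nhds z₀ hr, h0.eventually (gt_mem_nhds hε)] with z h1 h2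
    rw [dist_eq_norm]
    exact (key z h1).trans_lt h2
  intro z₀ hz₀
  obtain ⟨r, hr, hrD⟩ := Metric.nhds_basis_closedBall.mem_iff.1 (hD.mem_nhds hz₀)
  lift r to ℝ≥0 using hr.le
  have hr' : 0 < r := by exact_mod_cast hr
  have hci : CircleIntegrable g z₀ r :=
    (hcont.mono (Metric.sphere_subset_closedBall.trans hrD)).circleIntegrable r.2
  have hA := hasFPowerSeriesOn_cauchy_integral hci hr'
  have hA' := hA.analyticAt.differentiableAt
  apply DifferentiableAt.differentiableWithinAt
  refine hA'.congr_of_eventuallyEq ?_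
  filter_upwards [Metric.ball_mem_nhds z₀ hr] with w hw
  rw [← sub_eq_zero, ← norm_le_zero_iff]
  refine hn _ _ le_rfl fun i => ?_
  rw [norm_le_zero_iff, map_sub, sub_eq_zero, map_smul]
  have h2 := Complex.two_pi_I_inv_smul_circleIntegral_sub_inv_smul_of_differentiable_on_off_countable
    Set.countable_empty hw (((l i).continuous.comp_continuousOn hcont).mono hrD)
    (fun x hx => ((hd i).mono hrD).differentiableAt
      (Filter.mem_of_superset (Metric.isOpen_ball.mem_nhds hx.1) Metric.ball_subset_closedBall))
  have h3 : (l i) (∮ z in C(z₀, r), (z - w)⁻¹ • g z) =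
      ∮ z in C(z₀, r), (z - w)⁻¹ • (l i) (g z) := by
    have hint : CircleIntegrable (fun z => (z - w)⁻¹ • g z) z₀ r := by
      refine ContinuousOn.circleIntegrable r.2 (ContinuousOn.smul ?_
        (hcont.mono (Metric.sphere_subset_closedBall.trans hrD)))
      refine ContinuousOn.inv₀ (by fun_prop) fun z hz h => ?_
      rw [sub_eq_zero] at h
      rw [h, mem_sphere_iff_norm] at hz
      rw [mem_ball_iff_norm] at hw
      exact hw.ne hz
    rw [circleIntegral, circleIntegral, ← ContinuousLinearMap.intervalIntegral_comp_comm _ hint.out]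
    simp only [map_smul]
  rw [h3]
  exact h2.symm

/-- Bounded functions that are holomorphic after composition with a norming family, several
variables. -/
theorem LineHolomorphicOn.of_norming {M ι : Type*} [NormedAddCommGroup M] [NormedSpace ℂ M]
    {U : Set M} (hU : IsOpen U) {f : M → X} {C : ℝ}
    (hb : ∀ z ∈ U, ‖f z‖ ≤ C) (l : ι → X →L[ℂ] Y) (hl : ∀ i x, ‖l i x‖ ≤ ‖x‖)
    (hn : ∀ x c, 0 ≤ c → (∀ i, ‖l i x‖ ≤ c) → ‖x‖ ≤ c)
    (hd : ∀ i, LineHolomorphicOn (fun z => l i (f z)) U) : LineHolomorphicOn f U := by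
  intro x hx v
  have h := differentiableOn_of_norming (isOpen_line_preimage hU x v) (g := fun t => f (x + t • v))
    (fun t ht => hb _ ht) l hl hn
    (fun i t ht => ((hd i).differentiableAt ht).differentiableWithinAt)
  exact h.differentiableAt ((isOpen_line_preimage hU x v).mem_nhds (by simpa using hx))

/-- Uniform limits of functions that are holomorphic along lines. -/
theorem LineHolomorphicOn.of_tendstoUniformlyOn {M ι : Type*} [NormedAddCommGroup M]
    [NormedSpace ℂ M] {U : Set M} (hU : IsOpen U) {f : M → X} {F : ι → M → X} {φ : Filter ι}
    [φ.NeBot] (hF : TendstoUniformlyOn F f φ U) (h : ∀ᶠ i in φ, LineHolomorphicOn (F i) U) :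
    LineHolomorphicOn f U := by
  intro x hx v
  have h0 := (hF.comp (fun t : ℂ => x + t • v)).tendstoLocallyUniformlyOn
  have h1 := h0.differentiableOn (U := (fun t : ℂ => x + t • v) ⁻¹' U)
    (h.mono fun i hi t ht => (hi.differentiableAt ht).differentiableWithinAt)
    (isOpen_line_preimage hU x v)
  exact h1.differentiableAt ((isOpen_line_preimage hU x v).mem_nhds (by simpa using hx))

/-- The extension by zero of a function on a circle. -/
def circleExtend {X : Type*} [NormedAddCommGroup X] [NormedSpace ℂ X] {c : ℂ} {R : ℝ}
    (f : BoundedContinuousFunction (Metric.sphere c R) X) : ℂ → X :=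
  open Classical in fun z => if h : z ∈ Metric.sphere c R then f ⟨z, h⟩ else 0

theorem circleExtend_apply {X : Type*} [NormedAddCommGroup X] [NormedSpace ℂ X] {c : ℂ} {R : ℝ}
    (f : BoundedContinuousFunction (Metric.sphere c R) X) {z : ℂ} (h : z ∈ Metric.sphere c R) :
    circleExtend f z = f ⟨z, h⟩ := dif_pos h

theorem continuousOn_circleExtend {X : Type*} [NormedAddCommGroup X] [NormedSpace ℂ X] {c : ℂ}
    {R : ℝ} (f : BoundedContinuousFunction (Metric.sphere c R) X) :
    ContinuousOn (circleExtend f) (Metric.sphere c R) := by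
  rw [continuousOn_iff_continuous_domRestrict]
  refine f.continuous.congr fun z => ?_
  exact (circleExtend_apply f z.2).symm

/-- The integral `(2πi)⁻¹ ∮ k(ζ) f(ζ) dζ` against a continuous kernel, as an operator acting on the
boundary values `f`. -/
def circleOperator (X : Type*) [NormedAddCommGroup X] [NormedSpace ℂ X] {c : ℂ} {R : ℝ}
    (hR : 0 ≤ R) (k : ℂ → ℂ) (hk : ContinuousOn k (Metric.sphere c R)) {C : ℝ}
    (hC : ∀ z ∈ Metric.sphere c R, ‖k z‖ ≤ C) :
    BoundedContinuousFunction (Metric.sphere c R) X →L[ℂ] X :=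
  LinearMap.mkContinuous
    { toFun := fun f => (2 * Real.pi * Complex.I : ℂ)⁻¹ • ∮ z in C(c, R), k z • circleExtend f z
      map_add' := fun f g => by
        have h := circleIntegral.integral_add
          (f := fun z => k z • circleExtend f z) (g := fun z => k z • circleExtend g z)
          ((hk.smul (continuousOn_circleExtend f)).circleIntegrable hR)
          ((hk.smul (continuousOn_circleExtend g)).circleIntegrable hR)
        rw [← smul_add, ← h]
        congr 1
        refine circleIntegral.integral_congr hR fun z hz => ?_
        simp only [circleExtend_apply _ hz, BoundedContinuousFunction.add_apply, smul_add]
      map_smul' := fun a f => by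
        rw [RingHom.id_apply, smul_comm a, ← circleIntegral.integral_smul a (fun z => k z • circleExtend f z)]
        congr 1
        refine circleIntegral.integral_congr hR fun z hz => ?_
        simp only [circleExtend_apply _ hz, BoundedContinuousFunction.smul_apply]
        rw [smul_comm] }
    (R * C) (fun f => by
      change ‖(2 * Real.pi * Complex.I : ℂ)⁻¹ • ∮ z in C(c, R), k z • circleExtend f z‖ ≤ _
      rw [mul_assoc R]
      refine circleIntegral.norm_two_pi_i_inv_smul_integral_le_of_norm_le_const hR fun z hz => ?_
      rw [norm_smul, circleExtend_apply _ hz]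
      exact mul_le_mul (hC z hz) (f.norm_coe_le_norm _) (norm_nonneg _)
        ((norm_nonneg _).trans (hC z hz)))

theorem circleOperator_apply {X : Type*} [NormedAddCommGroup X] [NormedSpace ℂ X] {c : ℂ} {R : ℝ}
    (hR : 0 ≤ R) (k : ℂ → ℂ) (hk : ContinuousOn k (Metric.sphere c R)) {C : ℝ}
    (hC : ∀ z ∈ Metric.sphere c R, ‖k z‖ ≤ C)
    (f : BoundedContinuousFunction (Metric.sphere c R) X) (F : ℂ → X)
    (hF : ∀ z : Metric.sphere c R, f z = F z) :
    circleOperator X hR k hk hC f =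
      (2 * Real.pi * Complex.I : ℂ)⁻¹ • ∮ z in C(c, R), k z • F z := by
  change (2 * Real.pi * Complex.I : ℂ)⁻¹ • (∮ z in C(c, R), k z • circleExtend f z) = _
  congr 1
  refine circleIntegral.integral_congr hR fun z hz => ?_
  simp only [circleExtend_apply _ hz, hF]

/-- The Cauchy integrals `f ↦ (2πi)⁻¹ ∮ (ζ - w)⁻¹ f(ζ) dζ` form a holomorphic family of operators
on boundary values. -/
theorem exists_cauchyOperator (X : Type*) [NormedAddCommGroup X] [NormedSpace ℂ X]
    [CompleteSpace X] (c : ℂ) {R : ℝ} (hR : 0 < R) :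
    ∃ K : ℂ → (BoundedContinuousFunction (Metric.sphere c R) X →L[ℂ] X),
      (∀ w ∈ Metric.ball c R, ∀ f : BoundedContinuousFunction (Metric.sphere c R) X, ∀ F : ℂ → X,
        (∀ z : Metric.sphere c R, f z = F z) →
        K w f = (2 * Real.pi * Complex.I : ℂ)⁻¹ • ∮ z in C(c, R), (z - w)⁻¹ • F z) ∧
      AnalyticOnNhd ℂ K (Metric.ball c R) := by
  classical
  have hne : ∀ w ∈ Metric.ball c R, ∀ z ∈ Metric.sphere c R, R - dist w c ≤ ‖z - w‖ := by
    intro w hw z hz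
    rw [Metric.mem_sphere] at hz
    have := dist_triangle z w c
    rw [← dist_eq_norm]
    linarith
  have hcts : ∀ w ∈ Metric.ball c R, ContinuousOn (fun z : ℂ => (z - w)⁻¹) (Metric.sphere c R) := by
    intro w hw
    refine ContinuousOn.inv₀ (by fun_prop) fun z hz h => ?_
    have h1 := hne w hw z hz
    rw [h, norm_zero] at h1
    rw [Metric.mem_ball] at hw
    linarith
  have hbd : ∀ w ∈ Metric.ball c R, ∀ z ∈ Metric.sphere c R, ‖(z - w)⁻¹‖ ≤ (R - dist w c)⁻¹ := by
    intro w hw z hz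
    rw [norm_inv]
    rw [Metric.mem_ball] at hw
    exact inv_anti₀ (by linarith) (hne w hw z hz)
  let K : ℂ → (BoundedContinuousFunction (Metric.sphere c R) X →L[ℂ] X) := fun w =>
    if hw : w ∈ Metric.ball c R then circleOperator X hR.le _ (hcts w hw) (hbd w hw) else 0
  have hK : ∀ w ∈ Metric.ball c R, ∀ f (F : ℂ → X), (∀ z : Metric.sphere c R, f z = F z) →
      K w f = (2 * Real.pi * Complex.I : ℂ)⁻¹ • ∮ z in C(c, R), (z - w)⁻¹ • F z := by
    intro w hw f F hF
    simp only [K, dif_pos hw]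
    exact circleOperator_apply _ _ _ _ _ _ hF
  refine ⟨K, hK, ?_⟩
  intro w₀ hw₀
  -- On a smaller disc the operators are uniformly bounded; evaluations at unit vectors are norming.
  have hw₀' : dist w₀ c < R := hw₀
  obtain ⟨ρ, hρ0, hρR⟩ := exists_between hw₀'
  have hsub : Metric.ball c ρ ⊆ Metric.ball c R := Metric.ball_subset_ball hρR.le
  have hd := differentiableOn_of_norming (D := Metric.ball c ρ)
    (ι := {f : BoundedContinuousFunction (Metric.sphere c R) X // ‖f‖ ≤ 1})
    Metric.isOpen_ball (g := K) (C := R * (R - ρ)⁻¹) (by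
      intro w hw
      have hw' : dist w c < ρ := hw
      simp only [K, dif_pos (hsub hw)]
      have hle : R * (R - dist w c)⁻¹ ≤ R * (R - ρ)⁻¹ :=
        mul_le_mul_of_nonneg_left (inv_anti₀ (by linarith) (by linarith)) hR.le
      exact (LinearMap.mkContinuous_norm_le _
        (mul_nonneg hR.le (inv_nonneg.2 (by linarith))) _).trans hle)
    (fun f => ContinuousLinearMap.apply ℂ X f.1)
    (by
      intro f A
      exact (A.le_opNorm _).trans (mul_le_of_le_one_right (norm_nonneg _) f.2))
    (by
      intro A a ha h
      refine ContinuousLinearMap.opNorm_le_of_unit_norm ha fun f hf => h ⟨f, hf.le⟩)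
    (by
      intro f w hw
      apply DifferentiableAt.differentiableWithinAt
      lift R to ℝ≥0 using hR.le
      have hA := hasFPowerSeriesOn_cauchy_integral
        ((continuousOn_circleExtend f.1).circleIntegrable hR.le) (by exact_mod_cast hR)
      have hA' := (hA.analyticAt_of_mem (y := w) (by
        rw [Metric.eball_coe]; exact hsub hw)).differentiableAt
      refine hA'.congr_of_eventuallyEq ?_
      filter_upwards [Metric.isOpen_ball.mem_nhds (hsub hw)] with w' hw'
      exact hK w' hw' f.1 (circleExtend f.1) fun z => (circleExtend_apply f.1 z.2).symm)
  exact hd.analyticAt (Metric.isOpen_ball.mem_nhds hρ0)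

/-- Bounded functions that are holomorphic along lines, with values in Banach spaces of the universe
`u`, are analytic on open subsets of `M`. -/
def OsgoodSpace.{u, v} (M : Type v) [NormedAddCommGroup M] [NormedSpace ℂ M] : Prop :=
  ∀ (X : Type u) [NormedAddCommGroup X] [NormedSpace ℂ X] [CompleteSpace X] (f : M → X) (U : Set M)
    (C : ℝ), IsOpen U → (∀ x ∈ U, ‖f x‖ ≤ C) → LineHolomorphicOn f U → AnalyticOnNhd ℂ f U

/-- Induction step of Osgood's lemma: `f(w, y)` is the Cauchy integral in `w` of its boundary values
`f(·, y)`, which are an analytic function of `y` with values in a space of continuous functions on a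
circle. -/
theorem OsgoodSpace.prod.{u, v} {M : Type v} [NormedAddCommGroup M] [NormedSpace ℂ M]
    (hM : OsgoodSpace.{u} M) : OsgoodSpace.{u} (ℂ × M) := by
  classical
  intro X _ _ _ f U C hU hb hf p hp
  obtain ⟨c, y₀⟩ := p
  obtain ⟨R, hR, hRU⟩ := Metric.nhds_basis_closedBall.mem_iff.1 (hU.mem_nhds hp)
  have hmem : ∀ w ∈ Metric.closedBall c R, ∀ y ∈ Metric.ball y₀ R, (w, y) ∈ U := fun w hw y hy =>
    hRU (by
      rw [← closedBall_prod_same]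
      exact ⟨hw, Metric.ball_subset_closedBall hy⟩)
  have hdiff1 : ∀ y ∈ Metric.ball y₀ R, ∀ w ∈ Metric.closedBall c R,
      DifferentiableAt ℂ (fun w => f (w, y)) w := by
    intro y hy w hw
    have h := hf.differentiableAt (x := ((0 : ℂ), y)) (v := ((1 : ℂ), (0 : M))) (t := w)
      (by simpa using hmem w hw y hy)
    simpa using h
  have hcont1 : ∀ y ∈ Metric.ball y₀ R, Continuous fun z : Metric.sphere c R => f (z, y) := by
    intro y hy
    rw [continuous_iff_continuousAt]
    intro z
    exact (hdiff1 y hy z (Metric.sphere_subset_closedBall z.2)).continuousAt.comp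
      continuous_subtype_val.continuousAt
  let F : M → BoundedContinuousFunction (Metric.sphere c R) X := fun y =>
    if hy : y ∈ Metric.ball y₀ R then
      BoundedContinuousFunction.ofNormedAddCommGroup (fun z => f (z, y)) (hcont1 y hy) C
        (fun z => hb _ (hmem z (Metric.sphere_subset_closedBall z.2) y hy))
    else 0
  have hF : ∀ y ∈ Metric.ball y₀ R, ∀ z : Metric.sphere c R, F y z = f (z, y) := by
    intro y hy z
    simp only [F, dif_pos hy]
    rfl
  have hC : 0 ≤ C := (norm_nonneg _).trans (hb _ hp)
  have hFan : AnalyticOnNhd ℂ F (Metric.ball y₀ R) := by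
    refine hM _ F _ C Metric.isOpen_ball ?_ ?_
    · intro y hy
      refine (BoundedContinuousFunction.norm_le hC).2 fun z => ?_
      rw [hF y hy]
      exact hb _ (hmem z (Metric.sphere_subset_closedBall z.2) y hy)
    · refine LineHolomorphicOn.of_norming Metric.isOpen_ball (C := C) ?_
        (fun z : Metric.sphere c R => BoundedContinuousFunction.evalCLM ℂ z)
        (fun z g => g.norm_coe_le_norm z)
        (fun g a ha h => (BoundedContinuousFunction.norm_le ha).2 h) ?_
      · intro y hy
        refine (BoundedContinuousFunction.norm_le hC).2 fun z => ?_
        rw [hF y hy]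
        exact hb _ (hmem z (Metric.sphere_subset_closedBall z.2) y hy)
      · intro z y hy v
        have h := hf _ (hmem z (Metric.sphere_subset_closedBall z.2) y hy) ((0 : ℂ), v)
        refine h.congr_of_eventuallyEq ?_
        have hop := (isOpen_line_preimage (Metric.isOpen_ball (x := y₀) (ε := R)) y v).mem_nhds
          (show (0 : ℂ) ∈ _ by simpa using hy)
        filter_upwards [hop] with t ht
        simp only [BoundedContinuousFunction.evalCLM_apply]
        rw [hF _ ht]
        simp
  obtain ⟨K, hK, hKan⟩ := exists_cauchyOperator X c hR
  have h1 : AnalyticAt ℂ (fun q : ℂ × M => K q.1) (c, y₀) :=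
    (hKan c (Metric.mem_ball_self hR)).comp_of_eq analyticAt_fst rfl
  have h2 : AnalyticAt ℂ (fun q : ℂ × M => F q.2) (c, y₀) :=
    (hFan y₀ (Metric.mem_ball_self hR)).comp_of_eq analyticAt_snd rfl
  have h3 : AnalyticAt ℂ (fun q : ℂ × M => K q.1 (F q.2)) (c, y₀) :=
    AnalyticAt.comp₂
      (h := fun q : (BoundedContinuousFunction (Metric.sphere c R) X →L[ℂ] X) × _ => q.1 q.2)
      (ContinuousLinearMap.analyticAt_bilinear (ContinuousLinearMap.id ℂ
        (BoundedContinuousFunction (Metric.sphere c R) X →L[ℂ] X)) (K c, F y₀)) h1 h2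
  refine h3.congr ?_
  have hnb : Metric.ball c R ×ˢ Metric.ball y₀ R ∈ 𝓝 (c, y₀) :=
    prod_mem_nhds (Metric.ball_mem_nhds c hR) (Metric.ball_mem_nhds y₀ hR)
  filter_upwards [hnb] with q hq
  obtain ⟨w, y⟩ := q
  change K w (F y) = f (w, y)
  rw [hK w hq.1 (F y) (fun z => f (z, y)) (hF y hq.2)]
  exact Complex.two_pi_I_inv_smul_circleIntegral_sub_inv_smul_of_differentiable_on_off_countable
    Set.countable_empty hq.1
    (fun w hw => (hdiff1 y hq.2 w hw).continuousAt.continuousWithinAt)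
    (fun w hw => hdiff1 y hq.2 w (Metric.ball_subset_closedBall hw.1))

theorem OsgoodSpace.congr.{u, v, w} {M : Type v} {N : Type w} [NormedAddCommGroup M]
    [NormedSpace ℂ M] [NormedAddCommGroup N] [NormedSpace ℂ N] (e : N ≃L[ℂ] M)
    (hM : OsgoodSpace.{u} M) : OsgoodSpace.{u} N := by
  intro X _ _ _ f U C hU hb hf p hp
  have h := hM X (f ∘ e.symm) (e.symm ⁻¹' U) C (hU.preimage e.symm.continuous)
    (fun x hx => hb _ hx) (by
      intro x hx v
      have := hf (e.symm x) hx (e.symm v)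
      simpa [Function.comp_def] using this) (e p) (by simpa using hp)
  have h2 := h.comp (f := fun x : N => e x) (e.toContinuousLinearMap.analyticAt p)
  simpa [Function.comp_def] using h2

/-- **Osgood's lemma** on `ℂⁿ`. -/
theorem osgoodSpace_fin.{u} (n : ℕ) : OsgoodSpace.{u} (Fin n → ℂ) := by
  induction n with
  | zero =>
    intro X _ _ _ f U C _ _ _ p _
    have : f = fun _ => f p := by
      funext x
      rw [Subsingleton.elim x p]
    rw [this]
    exact analyticAt_const
  | succ n ih => exact OsgoodSpace.congr (Fin.consEquivL ℂ fun _ => ℂ).symm ih.prod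

/-- **Osgood's lemma** on `ℂⁿ × ℂ`. -/
theorem osgoodSpace_fin_prod.{u} (n : ℕ) : OsgoodSpace.{u} ((Fin n → ℂ) × ℂ) :=
  OsgoodSpace.congr (ContinuousLinearEquiv.prodComm ℂ _ _) (osgoodSpace_fin n).prod

end Holomorphy

/-! ### Operators on Fock space given by almost everywhere formulas -/

section FockTools

/-- The bounded operator with a given additive, homogeneous and bounded underlying function. -/
def clmOfBound {A B : Type*} [NormedAddCommGroup A] [NormedSpace ℂ A] [NormedAddCommGroup B]
    [NormedSpace ℂ B] (f : A → B) (hadd : ∀ a b, f (a + b) = f a + f b)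
    (hsmul : ∀ (c : ℂ) a, f (c • a) = c • f a) (C : ℝ) (hC : ∀ a, ‖f a‖ ≤ C * ‖a‖) : A →L[ℂ] B :=
  LinearMap.mkContinuous ⟨⟨f, hadd⟩, hsmul⟩ C hC

variable {E E' : Type*} [NormedAddCommGroup E] [InnerProductSpace ℂ E]
  [NormedAddCommGroup E'] [InnerProductSpace ℂ E']

theorem sector_add_ae {n : ℕ} (f g : Sector E n) : ∀ᵐ k ∂configMeasure n,
    ((f + g : Sector E n) : Lp E 2 (configMeasure n)) k =
      (f : Lp E 2 (configMeasure n)) k + (g : Lp E 2 (configMeasure n)) k :=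
  Lp.coeFn_add (f : Lp E 2 (configMeasure n)) (g : Lp E 2 (configMeasure n))

theorem sector_smul_ae {n : ℕ} (c : ℂ) (f : Sector E n) : ∀ᵐ k ∂configMeasure n,
    ((c • f : Sector E n) : Lp E 2 (configMeasure n)) k =
      c • (f : Lp E 2 (configMeasure n)) k :=
  Lp.coeFn_smul c (f : Lp E 2 (configMeasure n))

theorem sector_ext_ae {n : ℕ} {f g : Sector E n}
    (h : ∀ᵐ k ∂configMeasure n, (f : Lp E 2 (configMeasure n)) k =
      (g : Lp E 2 (configMeasure n)) k) : f = g :=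
  Subtype.ext (Lp.ext h)

theorem fock_ext_ae {f g : Fock E} (h : ∀ n, ∀ᵐ k ∂configMeasure n,
    (f n : Lp E 2 (configMeasure n)) k = (g n : Lp E 2 (configMeasure n)) k) : f = g := by
  apply lp.ext
  funext n
  exact sector_ext_ae (h n)

theorem fock_add_ae (f g : Fock E) (n : ℕ) : ∀ᵐ k ∂configMeasure n,
    ((f + g : Fock E) n : Lp E 2 (configMeasure n)) k =
      (f n : Lp E 2 (configMeasure n)) k + (g n : Lp E 2 (configMeasure n)) k :=
  sector_add_ae (f n) (g n)

theorem fock_smul_ae (c : ℂ) (f : Fock E) (n : ℕ) : ∀ᵐ k ∂configMeasure n,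
    ((c • f : Fock E) n : Lp E 2 (configMeasure n)) k =
      c • (f n : Lp E 2 (configMeasure n)) k :=
  sector_smul_ae c (f n)

theorem fock_zero_ae (n : ℕ) : ∀ᵐ k ∂configMeasure n,
    ((0 : Fock E) n : Lp E 2 (configMeasure n)) k = 0 :=
  Lp.coeFn_zero E 2 (configMeasure n)

/-- The bounded operator from the `n`-photon to the `m`-photon sector whose value at `ψ` is given
almost everywhere by the function `Φ ψ`. -/
def sectorOp {n m : ℕ} (Φ : Sector E n → (Fin m → Mode) → E')
    (hmem : ∀ ψ, AEStronglyMeasurable (Φ ψ) (configMeasure m))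
    (hsym : ∀ ψ (σ : Equiv.Perm (Fin m)), ∀ᵐ k ∂configMeasure m,
      Φ ψ (fun i => k (σ i)) = Φ ψ k)
    (hadd : ∀ ψ η, ∀ᵐ k ∂configMeasure m, Φ (ψ + η) k = Φ ψ k + Φ η k)
    (hsmul : ∀ (c : ℂ) ψ, ∀ᵐ k ∂configMeasure m, Φ (c • ψ) k = c • Φ ψ k)
    (C : ℝ≥0) (hC : ∀ ψ, eLpNorm (Φ ψ) 2 (configMeasure m) ≤ C * ‖ψ‖ₑ) :
    Sector E n →L[ℂ] Sector E' m :=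
  have hm : ∀ ψ, MemLp (Φ ψ) 2 (configMeasure m) := fun ψ =>
    ⟨hmem ψ, (hC ψ).trans_lt (ENNReal.mul_lt_top ENNReal.coe_lt_top enorm_lt_top)⟩
  clmOfBound
    (fun ψ => ⟨(hm ψ).toLp (Φ ψ), by
        apply sector_of_ae
        intro σ
        have h := (hm ψ).coeFn_toLp
        have h' := (measurePreserving_perm σ).quasiMeasurePreserving.ae h
        filter_upwards [h, h', hsym ψ σ] with k h1 h2 h3
        rw [h1, h2, h3]⟩)
    (fun ψ η => by
        apply sector_ext_ae
        filter_upwards [(hm (ψ + η)).coeFn_toLp, (hm ψ).coeFn_toLp, (hm η).coeFn_toLp, hadd ψ η,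
          sector_add_ae (⟨(hm ψ).toLp _, _⟩ : Sector E' m) (⟨(hm η).toLp _, _⟩ : Sector E' m)]
          with k h1 h2 h3 h4 h5
        rw [h5, h1, h2, h3, h4])
    (fun c ψ => by
        apply sector_ext_ae
        filter_upwards [(hm (c • ψ)).coeFn_toLp, (hm ψ).coeFn_toLp, hsmul c ψ,
          sector_smul_ae c (⟨(hm ψ).toLp _, _⟩ : Sector E' m)] with k h1 h2 h4 h5
        rw [h5, h1, h2, h4])
    C (fun ψ => by
      change ‖(hm ψ).toLp (Φ ψ)‖ ≤ C * ‖ψ‖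
      rw [Lp.norm_toLp]
      have := ENNReal.toReal_mono (ENNReal.mul_ne_top ENNReal.coe_ne_top enorm_ne_top) (hC ψ)
      rwa [ENNReal.toReal_mul, toReal_enorm] at this)

theorem sectorOp_ae {n m : ℕ} (Φ : Sector E n → (Fin m → Mode) → E') (hmem hsym hadd hsmul)
    (C : ℝ≥0) (hC) (ψ : Sector E n) : ∀ᵐ k ∂configMeasure m,
      (sectorOp Φ hmem hsym hadd hsmul C hC ψ : Lp E' 2 (configMeasure m)) k = Φ ψ k :=
  MemLp.coeFn_toLp (f := Φ ψ)
    ⟨hmem ψ, (hC ψ).trans_lt (ENNReal.mul_lt_top ENNReal.coe_lt_top enorm_lt_top)⟩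

theorem norm_sectorOp_le {n m : ℕ} (Φ : Sector E n → (Fin m → Mode) → E') (hmem hsym hadd hsmul)
    (C : ℝ≥0) (hC) : ‖sectorOp Φ hmem hsym hadd hsmul C hC‖ ≤ C :=
  ContinuousLinearMap.opNorm_le_bound _ C.2 fun ψ => by
    rw [← coe_nnnorm, ← coe_nnnorm, ← NNReal.coe_mul, NNReal.coe_le_coe, ← ENNReal.coe_le_coe,
      ENNReal.coe_mul]
    refine le_trans (le_of_eq ?_) (hC ψ)
    change ‖((sectorOp Φ hmem hsym hadd hsmul C hC ψ : Sector E' m) :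
      Lp E' 2 (configMeasure m))‖ₑ = _
    rw [Lp.enorm_def]
    exact eLpNorm_congr_ae (sectorOp_ae Φ hmem hsym hadd hsmul C hC ψ)

theorem amp_ae (A : E →L[ℂ] E') (f : Fock E) (n : ℕ) : ∀ᵐ k ∂configMeasure n,
    (amp A f n : Lp E' 2 (configMeasure n)) k = A ((f n : Lp E 2 (configMeasure n)) k) :=
  A.coeFn_compLp _

theorem fnHf_ae (b : BddBorel) (f : Fock E) (n : ℕ) : ∀ᵐ k ∂configMeasure n,
    (fnHf E b f n : Lp E 2 (configMeasure n)) k =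
      b.toFun (energy k) • (f n : Lp E 2 (configMeasure n)) k :=
  (memLp_energy_smul b (f n : Lp E 2 (configMeasure n))).coeFn_toLp

theorem energy_nonneg {n : ℕ} (k : Fin n → Mode) : 0 ≤ energy k :=
  Finset.sum_nonneg fun _ _ => norm_nonneg _

/-- The total photon energy as a nonnegative real number. -/
def nnEnergy {n : ℕ} (k : Fin n → Mode) : ℝ≥0 := (energy k).toNNReal

theorem coe_nnEnergy {n : ℕ} (k : Fin n → Mode) : (nnEnergy k : ℝ) = energy k :=
  Real.coe_toNNReal _ (energy_nonneg k)

theorem measurable_nnEnergy {n : ℕ} : Measurable (nnEnergy : (Fin n → Mode) → ℝ≥0) :=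
  measurable_energy.real_toNNReal

variable (E) in
/-- Bounded norm continuous functions of the photon energy with values in `𝓛(E)`. -/
abbrev EnergyFn : Type _ := BoundedContinuousFunction ℝ≥0 (E →L[ℂ] E)

/-- `F(H_f)` on the `n`-photon sector of `E ⊗ 𝓕`, for an operator-valued function `F`. -/
def opSector (F : EnergyFn E) (n : ℕ) : Sector E n →L[ℂ] Sector E n :=
  sectorOp (fun ψ k => F (nnEnergy k) ((ψ : Lp E 2 (configMeasure n)) k))
    (fun ψ => by
      have h1 : AEStronglyMeasurable (fun k : Fin n → Mode => F (nnEnergy k)) (configMeasure n) :=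
        (F.continuous.stronglyMeasurable.comp_measurable measurable_nnEnergy).aestronglyMeasurable
      exact (isBoundedBilinearMap_apply (𝕜 := ℂ) (E := E) (F := E)).continuous.comp_aestronglyMeasurable
        (h1.prodMk (Lp.aestronglyMeasurable (ψ : Lp E 2 (configMeasure n)))))
    (fun ψ σ => by
      filter_upwards [sector_ae ψ σ] with k hk
      rw [hk, nnEnergy, energy_perm, nnEnergy])
    (fun ψ η => by
      filter_upwards [sector_add_ae ψ η] with k hk
      rw [hk, map_add])
    (fun c ψ => by
      filter_upwards [sector_smul_ae c ψ] with k hk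
      rw [hk, map_smul])
    ‖F‖₊ (fun ψ => by
      have h := eLpNorm_le_nnreal_smul_eLpNorm_of_ae_le_mul (p := 2) (μ := configMeasure n)
        (f := fun k => F (nnEnergy k) ((ψ : Lp E 2 (configMeasure n)) k))
        (g := (ψ : Lp E 2 (configMeasure n))) (c := ‖F‖₊)
        (Eventually.of_forall fun k => (F (nnEnergy k)).le_of_opNorm_le (F.norm_coe_le_norm _) _)
      rwa [ENNReal.smul_def, smul_eq_mul, ← Lp.enorm_def] at h)

/-- `F(H_f)` on `E ⊗ 𝓕`, for an operator-valued function `F`: the operator that multiplies by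
`F(|𝐤₁| + ⋯ + |𝐤ₙ|) ∈ 𝓛(E)`. -/
def opFn (F : EnergyFn E) : Fock E →L[ℂ] Fock E :=
  lp.mapCLM 2 (opSector F) (norm_nonneg F) fun _ => norm_sectorOp_le _ _ _ _ _ _ _

theorem opFn_ae (F : EnergyFn E) (f : Fock E) (n : ℕ) : ∀ᵐ k ∂configMeasure n,
    (opFn F f n : Lp E 2 (configMeasure n)) k =
      F (nnEnergy k) ((f n : Lp E 2 (configMeasure n)) k) :=
  sectorOp_ae _ _ _ _ _ _ _ (f n)

theorem norm_opFn_le (F : EnergyFn E) : ‖opFn F‖ ≤ ‖F‖ := lp.norm_mapCLM_le _ _ _ _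

theorem opFn_mul (F F' : EnergyFn E) : opFn (F * F') = opFn F * opFn F' := by
  ext1 f
  refine fock_ext_ae fun n => ?_
  filter_upwards [opFn_ae (F * F') f n, opFn_ae F (opFn F' f) n, opFn_ae F' f n] with k h1 h2 h3
  rw [h1]
  refine Eq.trans ?_ h2.symm
  rw [h3]
  rfl

theorem opFn_add (F F' : EnergyFn E) : opFn (F + F') = opFn F + opFn F' := by
  ext1 f
  refine fock_ext_ae fun n => ?_
  filter_upwards [opFn_ae (F + F') f n, opFn_ae F f n, opFn_ae F' f n,
    fock_add_ae (opFn F f) (opFn F' f) n] with k h1 h2 h3 h4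
  refine h1.trans (Eq.trans ?_ h4.symm)
  rw [h2, h3]
  rfl

theorem opFn_smul (c : ℂ) (F : EnergyFn E) : opFn (c • F) = c • opFn F := by
  ext1 f
  refine fock_ext_ae fun n => ?_
  filter_upwards [opFn_ae (c • F) f n, opFn_ae F f n, fock_smul_ae c (opFn F f) n] with k h1 h2 h4
  refine h1.trans (Eq.trans ?_ h4.symm)
  rw [h2]
  rfl

theorem opFn_one : opFn (1 : EnergyFn E) = 1 := by
  ext1 f
  refine fock_ext_ae fun n => ?_
  filter_upwards [opFn_ae (1 : EnergyFn E) f n] with k h1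
  exact h1

variable (E) in
/-- The functional calculus `F ↦ F(H_f)` as a bounded operator. -/
def opFnL : EnergyFn E →L[ℂ] (Fock E →L[ℂ] Fock E) :=
  clmOfBound (A := EnergyFn E) (B := Fock E →L[ℂ] Fock E) opFn
    (fun F F' => opFn_add (E := E) F F') (fun c F => opFn_smul (E := E) c F) 1
    (fun F => by rw [one_mul]; exact norm_opFn_le (E := E) F)

theorem opFn_sub (F F' : EnergyFn E) : opFn (F - F') = opFn F - opFn F' :=
  map_sub (opFnL E) F F'

theorem opFn_injective_of {F : EnergyFn E} (h : ∀ q x, F q x = 0 → x = 0) {f : Fock E}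
    (hf : opFn F f = 0) : f = 0 := by
  refine fock_ext_ae fun n => ?_
  filter_upwards [opFn_ae F f n, fock_zero_ae (E := E) n] with k h1 h2
  rw [h2]
  apply h (nnEnergy k)
  rw [← h1, hf, h2]

theorem amp_eq_opFn (A : E →L[ℂ] E) :
    amp A = opFn (BoundedContinuousFunction.const ℝ≥0 A : EnergyFn E) := by
  ext1 f
  refine fock_ext_ae fun n => ?_
  filter_upwards [opFn_ae (BoundedContinuousFunction.const ℝ≥0 A : EnergyFn E) f n, amp_ae A f n]
    with k h1 h2
  rw [h1, h2]
  rfl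

theorem fnHf_eq_opFn {b : BddBorel} {F : EnergyFn E} (h : ∀ q : ℝ≥0, F q = b.toFun q • 1) :
    fnHf E b = opFn F := by
  ext1 f
  refine fock_ext_ae fun n => ?_
  filter_upwards [opFn_ae F f n, fnHf_ae b f n] with k h1 h2
  rw [h1, h2, h, coe_nnEnergy]
  rfl

theorem amp_comp_fnHf (A : E →L[ℂ] E') (b : BddBorel) (f : Fock E) :
    amp A (fnHf E b f) = fnHf E' b (amp A f) := by
  refine fock_ext_ae fun n => ?_
  filter_upwards [amp_ae A (fnHf E b f) n, fnHf_ae b f n, fnHf_ae b (amp A f) n, amp_ae A f n]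
    with k h1 h2 h3 h4
  rw [h1, h2, h3, h4, map_smul]

theorem amp_add (A B : E →L[ℂ] E') : amp (A + B) = amp A + amp B := by
  ext1 f
  refine fock_ext_ae fun n => ?_
  filter_upwards [amp_ae (A + B) f n, amp_ae A f n, amp_ae B f n, fock_add_ae (amp A f) (amp B f) n]
    with k h1 h2 h3 h4
  refine h1.trans (Eq.trans ?_ h4.symm)
  rw [h2, h3]
  rfl

theorem amp_smul (c : ℂ) (A : E →L[ℂ] E') : amp (c • A) = c • amp A := by
  ext1 f
  refine fock_ext_ae fun n => ?_
  filter_upwards [amp_ae (c • A) f n, amp_ae A f n, fock_smul_ae c (amp A f) n] with k h1 h2 h3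
  refine h1.trans (Eq.trans ?_ h3.symm)
  rw [h2]
  rfl

variable (E E') in
/-- `A ↦ A ⊗ 1` as a bounded operator. -/
def ampL : (E →L[ℂ] E') →L[ℂ] (Fock E →L[ℂ] Fock E') :=
  clmOfBound (A := E →L[ℂ] E') (B := Fock E →L[ℂ] Fock E') amp
    (fun A B => amp_add (E := E) (E' := E') A B) (fun c A => amp_smul (E := E) (E' := E') c A) 1
    (fun A => by
      rw [one_mul]
      exact lp.norm_mapCLM_le 2 (ampSector A) (norm_nonneg A) (norm_ampSector_le A))

theorem amp_tmul (A : E →L[ℂ] E') (φ : E) (ψ : Fock ℂ) : amp A (tmul φ ψ) = tmul (A φ) ψ := by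
  refine fock_ext_ae fun n => ?_
  filter_upwards [amp_ae A (tmul φ ψ) n, tmul_ae φ ψ n, tmul_ae (A φ) ψ n] with k h1 h2 h3
  rw [h1, h2, h3, map_smul]

theorem fnHf_tmul (b : BddBorel) (φ : E) (ψ : Fock ℂ) :
    fnHf E b (tmul φ ψ) = tmul φ (fnHf ℂ b ψ) := (amp_comp_fnHf _ _ _).symm

/-- `A ⊗ 1` has the adjoint `A† ⊗ 1`; the case of a functional. -/
theorem inner_tmul_left [CompleteSpace E] (φ : E) (ψ : Fock ℂ) (f : Fock E) :
    inner ℂ (tmul φ ψ) f = inner ℂ ψ (amp (innerSL ℂ φ) f) := by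
  rw [lp.inner_eq_tsum, lp.inner_eq_tsum]
  congr 1
  funext n
  change inner ℂ (tmul φ ψ n : Lp E 2 (configMeasure n)) (f n : Lp E 2 (configMeasure n))
    = inner ℂ (ψ n : Lp ℂ 2 (configMeasure n)) (amp (innerSL ℂ φ) f n : Lp ℂ 2 (configMeasure n))
  rw [L2.inner_def, L2.inner_def]
  apply integral_congr_ae
  filter_upwards [tmul_ae φ ψ n, amp_ae (innerSL ℂ φ) f n] with k h1 h2
  rw [h1, h2, inner_smul_left]
  simp [mul_comm]

/-- The adjoint of `F(H_f)` is `F*(H_f)`. -/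
theorem inner_opFn_left [CompleteSpace E] {F F' : EnergyFn E}
    (h : ∀ q, F' q = ContinuousLinearMap.adjoint (F q)) (f g : Fock E) :
    inner ℂ (opFn F f) g = inner ℂ f (opFn F' g) := by
  rw [lp.inner_eq_tsum, lp.inner_eq_tsum]
  congr 1
  funext n
  change inner ℂ (opFn F f n : Lp E 2 (configMeasure n)) (g n : Lp E 2 (configMeasure n))
    = inner ℂ (f n : Lp E 2 (configMeasure n)) (opFn F' g n : Lp E 2 (configMeasure n))
  rw [L2.inner_def, L2.inner_def]
  apply integral_congr_ae
  filter_upwards [opFn_ae F f n, opFn_ae F' g n] with k h1 h2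
  rw [h1, h2, h, ContinuousLinearMap.adjoint_inner_right]

/-- `F(H_f)` has dense range if every `F(q)` is surjective. -/
theorem dense_range_opFn [CompleteSpace E] {F : EnergyFn E} (hF : ∀ q, Function.Surjective (F q)) :
    Dense ((LinearMap.range (opFn F).toLinearMap : Submodule ℂ (Fock E)) : Set (Fock E)) := by
  rw [Submodule.dense_iff_topologicalClosure_eq_top, Submodule.topologicalClosure_eq_top_iff,
    Submodule.eq_bot_iff]
  intro f hf
  let F' : EnergyFn E := BoundedContinuousFunction.ofNormedAddCommGroup
    (fun q => ContinuousLinearMap.adjoint (F q))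
    (ContinuousLinearMap.adjoint.continuous.comp F.continuous) ‖F‖ fun q => by
      rw [LinearIsometryEquiv.norm_map]; exact F.norm_coe_le_norm q
  refine opFn_injective_of (F := F') (fun q x hx => ?_) (f := f) ?_
  · obtain ⟨y, rfl⟩ := hF q x
    have h1 : inner ℂ (F q y) (F q y) = 0 := by
      rw [← ContinuousLinearMap.adjoint_inner_right]
      change inner ℂ y (F' q _) = _
      rw [hx, inner_zero_right]
    exact inner_self_eq_zero.1 h1
  · rw [Submodule.mem_orthogonal] at hf
    have h1 := hf (opFn F (opFn F' f)) ⟨_, rfl⟩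
    rw [inner_opFn_left (F' := F') (fun _ => rfl)] at h1
    exact inner_self_eq_zero.1 h1

/-- The elementary tensors `φ ⊗ ψ`, with `ψ` in a sector of fixed photon number, are total. -/
theorem dense_span_tmul [CompleteSpace E] [TopologicalSpace.SeparableSpace E] :
    Dense ((Submodule.span ℂ {f : Fock E | ∃ (φ : E) (n : ℕ) (ψ : Sector ℂ n),
      f = tmul φ (lp.single 2 n ψ)} : Submodule ℂ (Fock E)) : Set (Fock E)) := by
  rw [Submodule.dense_iff_topologicalClosure_eq_top, Submodule.topologicalClosure_eq_top_iff,
    Submodule.eq_bot_iff]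
  intro f hf
  rw [Submodule.mem_orthogonal] at hf
  refine fock_ext_ae fun n => ?_
  have h1 : ∀ φ : E, amp (innerSL ℂ φ) f = 0 := by
    intro φ
    have h2 : ∀ n (ψ : Sector ℂ n), inner ℂ (lp.single 2 n ψ : Fock ℂ) (amp (innerSL ℂ φ) f) = 0 := by
      intro n ψ
      rw [← inner_tmul_left]
      exact hf _ (Submodule.subset_span ⟨φ, n, ψ, rfl⟩)
    apply lp.ext
    funext n
    have h3 := h2 n (amp (innerSL ℂ φ) f n)
    rw [lp.inner_single_left] at h3
    exact inner_self_eq_zero.1 h3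
  have h2 : ∀ᵐ k ∂configMeasure n, ∀ i : ℕ, inner ℂ (TopologicalSpace.denseSeq E i)
      ((f n : Lp E 2 (configMeasure n)) k) = (0 : ℂ) := by
    rw [ae_all_iff]
    intro i
    filter_upwards [amp_ae (innerSL ℂ (TopologicalSpace.denseSeq E i)) f n,
      fock_zero_ae (E := ℂ) n] with k h3 h4
    rw [h1, h4] at h3
    exact h3.symm
  filter_upwards [h2, fock_zero_ae (E := E) n] with k h3 h4
  rw [h4]
  have h5 : ∀ x : E, inner ℂ x ((f n : Lp E 2 (configMeasure n)) k) = (0 : ℂ) := by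
    intro x
    have hc : IsClosed {x : E | inner ℂ x ((f n : Lp E 2 (configMeasure n)) k) = (0 : ℂ)} :=
      isClosed_eq (by fun_prop) continuous_const
    exact (TopologicalSpace.denseRange_denseSeq E).induction_on (p := fun x =>
      inner ℂ x ((f n : Lp E 2 (configMeasure n)) k) = (0 : ℂ)) x hc h3
  exact inner_self_eq_zero.1 (h5 _)

end FockTools

/-! ### Measurability of weakly measurable operator-valued functions -/

section WeakMeasurability

variable {E : Type*} [NormedAddCommGroup E] [InnerProductSpace ℂ E] [CompleteSpace E]
  [TopologicalSpace.SeparableSpace E]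

variable (E) in
theorem exists_countable_hilbertBasis :
    ∃ (w : Set E) (_ : HilbertBasis w ℂ E), Countable w := by
  obtain ⟨w, b, hb⟩ := exists_hilbertBasis ℂ E
  refine ⟨w, b, ?_⟩
  have ho : Orthonormal ℂ ((↑) : w → E) := hb ▸ b.orthonormal
  -- Balls of radius `1/2` around an orthonormal set are disjoint.
  have hd : w.PairwiseDisjoint fun x => Metric.ball x (1 / 2 : ℝ) := by
    intro x hx y hy hxy
    apply Metric.ball_disjoint_ball
    have h1 : ‖x - y‖ * ‖x - y‖ = 2 := by
      have h2 : inner ℂ x y = (0 : ℂ) := ho.2 (i := ⟨x, hx⟩) (j := ⟨y, hy⟩) (by simpa using hxy)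
      have h3 := norm_sub_sq (𝕜 := ℂ) x y
      have hx1 : ‖x‖ = 1 := ho.1 ⟨x, hx⟩
      have hy1 : ‖y‖ = 1 := ho.1 ⟨y, hy⟩
      rw [h2, hx1, hy1] at h3
      norm_num at h3
      nlinarith
    rw [dist_eq_norm]
    nlinarith [norm_nonneg (x - y)]
  exact (hd.countable_of_isOpen (fun _ _ => Metric.isOpen_ball)
    fun x _ => ⟨x, Metric.mem_ball_self (by norm_num)⟩).to_subtype

theorem aestronglyMeasurable_of_inner {α : Type*} [MeasurableSpace α] {μ : Measure α} {h : α → E}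
    (hh : ∀ x : E, AEMeasurable (fun a => inner ℂ x (h a)) μ) : AEStronglyMeasurable h μ := by
  obtain ⟨w, b, hw⟩ := exists_countable_hilbertBasis E
  refine aestronglyMeasurable_of_tendsto_ae (atTop : Filter (Finset w))
    (f := fun s a => ∑ i ∈ s, (b.repr (h a) : w → ℂ) i • b i) (fun s => ?_)
    (Eventually.of_forall fun a => b.hasSum_repr (h a))
  refine Finset.aestronglyMeasurable_fun_sum _ fun i _ => ?_
  simp only [b.repr_apply_apply]
  exact (hh _).aestronglyMeasurable.smul_const _

theorem aestronglyMeasurable_apply {α : Type*} [MeasurableSpace α] {μ : Measure α}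
    {T : Mode → (E →L[ℂ] E)}
    (hT : ∀ x y : E, AEMeasurable (fun k => inner ℂ x (T k y)) modeMeasure) {f : α → Mode}
    (hf : Measure.QuasiMeasurePreserving f μ modeMeasure) {g : α → E}
    (hg : AEStronglyMeasurable g μ) : AEStronglyMeasurable (fun a => T (f a) (g a)) μ := by
  obtain ⟨w, b, hw⟩ := exists_countable_hilbertBasis E
  refine aestronglyMeasurable_of_tendsto_ae (atTop : Filter (Finset w))
    (f := fun s a => ∑ i ∈ s, (inner ℂ (b i) (g a) : ℂ) • T (f a) (b i)) (fun s => ?_)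
    (Eventually.of_forall fun a => ?_)
  · refine Finset.aestronglyMeasurable_fun_sum _ fun i _ => ?_
    exact (AEStronglyMeasurable.const_inner hg).smul
      ((aestronglyMeasurable_of_inner fun x => hT x (b i)).comp_quasiMeasurePreserving hf)
  · have h1 := (b.hasSum_repr (g a)).mapL (T (f a))
    simp only [map_smul, b.repr_apply_apply] at h1
    exact h1

end WeakMeasurability

/-! ### Raising the photon number -/

section Shift

variable {F : ℕ → Type*} [∀ n, NormedAddCommGroup (F n)] [∀ n, NormedSpace ℂ (F n)]

/-- The sequence `(0, g₀, g₁, …)`. -/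
def shiftSeq (g : ∀ n, F (n + 1)) : ∀ n, F n
  | 0 => 0
  | n + 1 => g n

theorem memℓp_shiftSeq (g : lp (fun n => F (n + 1)) 2) : Memℓp (shiftSeq g) 2 := by
  have h := lp.memℓp g
  rw [memℓp_gen_iff (by norm_num)] at h ⊢
  exact (summable_nat_add_iff 1).1 h

theorem norm_shift (g : lp (fun n => F (n + 1)) 2) :
    ‖(⟨shiftSeq g, memℓp_shiftSeq g⟩ : lp F 2)‖ ≤ 1 * ‖g‖ := by
  rw [one_mul, lp.norm_eq_tsum_rpow (by norm_num), lp.norm_eq_tsum_rpow (by norm_num)]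
  apply le_of_eq
  congr 1
  have h := lp.memℓp (⟨shiftSeq g, memℓp_shiftSeq g⟩ : lp F 2)
  rw [memℓp_gen_iff (by norm_num)] at h
  rw [h.tsum_eq_zero_add]
  simp [shiftSeq]

variable (F) in
/-- The isometry `(g₀, g₁, …) ↦ (0, g₀, g₁, …)` of Hilbert sums. -/
def lpShift : lp (fun n => F (n + 1)) 2 →L[ℂ] lp F 2 :=
  clmOfBound (fun g => ⟨shiftSeq g, memℓp_shiftSeq g⟩)
    (fun g h => by
      apply lp.ext
      funext n
      rcases n with _ | n
      · exact (add_zero (0 : F 0)).symm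
      · rfl)
    (fun c g => by
      apply lp.ext
      funext n
      rcases n with _ | n
      · exact (smul_zero c).symm
      · rfl) 1 norm_shift

end Shift

/-! ### Creation operators with energy weights -/

section Creation

theorem ae_omega_pos : ∀ᵐ k ∂modeMeasure, 0 < omega k := by
  have h1 : ∀ᵐ x ∂(volume : Measure (EuclideanSpace ℝ (Fin 3))), 0 < ‖x‖ := by
    have : ∀ᵐ x ∂(volume : Measure (EuclideanSpace ℝ (Fin 3))), x ≠ 0 := by
      rw [ae_iff]
      simp
    filter_upwards [this] with x hx
    exact norm_pos_iff.2 hx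
  exact Measure.quasiMeasurePreserving_fst.ae h1

theorem quasi_head (n : ℕ) : Measure.QuasiMeasurePreserving (fun k : Fin (n + 1) → Mode => k 0)
    (configMeasure (n + 1)) modeMeasure :=
  Measure.quasiMeasurePreserving_eval (μ := fun _ : Fin (n + 1) => modeMeasure) 0

theorem measurePreserving_split (n : ℕ) :
    MeasurePreserving (fun k : Fin (n + 1) → Mode => (k 0, fun i : Fin n => k i.succ))
      (configMeasure (n + 1)) (modeMeasure.prod (configMeasure n)) :=
  measurePreserving_piFinSuccAbove (fun _ : Fin (n + 1) => modeMeasure) 0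

theorem quasi_tail (n : ℕ) : Measure.QuasiMeasurePreserving
    (fun (k : Fin (n + 1) → Mode) (i : Fin n) => k i.succ)
    (configMeasure (n + 1)) (configMeasure n) := by
  have : SigmaFinite (configMeasure n) := by unfold configMeasure; infer_instance
  exact Measure.quasiMeasurePreserving_snd.comp (measurePreserving_split n).quasiMeasurePreserving

theorem ae_omega_pos_all (n : ℕ) : ∀ᵐ k ∂configMeasure n, ∀ i, 0 < omega (k i) := by
  rw [ae_all_iff]
  intro i
  exact (Measure.quasiMeasurePreserving_eval (μ := fun _ : Fin n => modeMeasure) i).ae ae_omega_pos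

/-- Each index is the image of `0` under `n!` of the permutations. -/
theorem sum_perm_zero {n : ℕ} (f : Fin (n + 1) → ℝ) :
    ∑ σ : Equiv.Perm (Fin (n + 1)), f (σ 0) = n.factorial * ∑ i, f i := by
  rw [Fintype.sum_equiv Equiv.Perm.decomposeFin (fun σ => f (σ 0)) (fun p => f p.1)]
  · rw [Fintype.sum_prod_type]
    simp [Fintype.card_perm, Finset.mul_sum]
  · intro σ
    obtain ⟨p, rfl⟩ := Equiv.Perm.decomposeFin.symm.surjective σ
    obtain ⟨p, e⟩ := p
    rw [Equiv.Perm.decomposeFin_symm_apply_zero, Equiv.apply_symm_apply]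

/-- The Cauchy–Schwarz inequality behind the bound on creation operators: with weights `ω(k_{σ0})`,
whose sum over all permutations is `n!` times the total energy. -/
theorem norm_symm_sum_sq_le {E : Type*} [NormedAddCommGroup E] [NormedSpace ℂ E] {n : ℕ}
    (k : Fin (n + 1) → Mode) (hk : ∀ i, 0 < omega (k i))
    (v : Equiv.Perm (Fin (n + 1)) → E) (t : Equiv.Perm (Fin (n + 1)) → ℝ)
    (hv : ∀ σ, energy k * ‖v σ‖ ^ 2 ≤ (1 + omega (k (σ 0))) * t σ ^ 2) :
    ‖((Real.sqrt (n + 1) / (n + 1).factorial : ℝ) : ℂ) • ∑ σ, v σ‖ ^ 2 ≤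
      ((n + 1).factorial : ℝ)⁻¹ * ∑ σ, (1 + 1 / omega (k (σ 0))) * t σ ^ 2 := by
  have he : 0 < energy k :=
    Finset.sum_pos (fun i _ => hk i) Finset.univ_nonempty
  have h1 : (∑ σ, ‖v σ‖) ^ 2 ≤ (∑ σ : Equiv.Perm (Fin (n + 1)), omega (k (σ 0))) *
      ∑ σ, ((1 + 1 / omega (k (σ 0))) * t σ ^ 2 / energy k) := by
    refine Finset.sum_sq_le_sum_mul_sum_of_sq_le_mul _ (fun σ _ => (hk _).le)
      (fun σ _ => ?_) (fun σ _ => ?_)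
    · have := hk (σ 0)
      positivity
    · have hω := hk (σ 0)
      have : omega (k (σ 0)) * ((1 + 1 / omega (k (σ 0))) * t σ ^ 2 / energy k) =
          (1 + omega (k (σ 0))) * t σ ^ 2 / energy k := by
        field_simp
        ring
      rw [this, le_div_iff₀ he, mul_comm]
      exact hv σ
  rw [sum_perm_zero fun i => omega (k i), ← Finset.sum_div] at h1
  have h2 : (∑ i, omega (k i)) = energy k := rfl
  rw [h2] at h1
  set S := ∑ σ : Equiv.Perm (Fin (n + 1)), (1 + 1 / omega (k (σ 0))) * t σ ^ 2 with hS
  have h3 : (n.factorial : ℝ) * energy k * (S / energy k) = n.factorial * S := by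
    field_simp
  rw [h3] at h1
  rw [norm_smul, Complex.norm_real, Real.norm_of_nonneg (by positivity), mul_pow, div_pow,
    Real.sq_sqrt (by positivity)]
  have h4 : ‖∑ σ, v σ‖ ^ 2 ≤ n.factorial * S :=
    (pow_le_pow_left₀ (norm_nonneg _) (norm_sum_le _ _) 2).trans h1
  have hf : ((n + 1).factorial : ℝ) = (n + 1) * n.factorial := by
    rw [Nat.factorial_succ]; push_cast; ring
  have hn : (0 : ℝ) < n.factorial := by positivity
  calc ((n : ℝ) + 1) / ((n + 1).factorial : ℝ) ^ 2 * ‖∑ σ, v σ‖ ^ 2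
      ≤ ((n : ℝ) + 1) / ((n + 1).factorial : ℝ) ^ 2 * (n.factorial * S) := by gcongr
    _ = ((n + 1).factorial : ℝ)⁻¹ * S := by
        rw [hf]
        field_simp

variable {E : Type*} [NormedAddCommGroup E] [InnerProductSpace ℂ E] [CompleteSpace E]
  [TopologicalSpace.SeparableSpace E]

/-- The square of the norm of `L²(ℝ³ × {1,2}, (1 + 1/ω) dk; 𝓛(E))`. -/
def weightedNormSq (G : WeakL2 E) : ℝ≥0∞ :=
  ∫⁻ k, ENNReal.ofReal (1 + 1 / omega k) * ‖G k‖ₑ ^ (2 : ℝ) ∂modeMeasure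

/-- Weights `c(a, b)`, depending on the energies after and before the creation of a photon, that
make creation operators bounded. -/
structure EnergyWeight where
  toFun : ℝ → ℝ → ℝ
  measurable : Measurable fun p : ℝ × ℝ => toFun p.1 p.2
  bound : ∀ a b, 0 ≤ b → b ≤ a → a * toFun a b ^ 2 ≤ 1 + (a - b)

/-- The unsymmetrized function `c · G(k₀) ψ(k₁, …, kₙ)`. -/
def creationKernel (c : EnergyWeight) (G : WeakL2 E) {n : ℕ} (ψ : Sector E n)
    (k : Fin (n + 1) → Mode) : E :=
  (c.toFun (energy k) (energy fun i : Fin n => k i.succ) : ℂ) •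
    G (k 0) ((ψ : Lp E 2 (configMeasure n)) fun i => k i.succ)

/-- The symmetrization `√(n+1) S_{n+1}` of the creation kernel. -/
def creationFn (c : EnergyWeight) (G : WeakL2 E) {n : ℕ} (ψ : Sector E n)
    (k : Fin (n + 1) → Mode) : E :=
  ((Real.sqrt (n + 1) / (n + 1).factorial : ℝ) : ℂ) •
    ∑ σ : Equiv.Perm (Fin (n + 1)), creationKernel c G ψ fun i => k (σ i)

theorem aestronglyMeasurable_creationKernel (c : EnergyWeight) (G : WeakL2 E) {n : ℕ}
    (ψ : Sector E n) :
    AEStronglyMeasurable (creationKernel c G ψ) (configMeasure (n + 1)) := by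
  unfold creationKernel
  refine AEStronglyMeasurable.smul ?_ ?_
  · have h1 : Measurable fun k : Fin (n + 1) → Mode =>
        (energy k, energy fun i : Fin n => k i.succ) :=
      measurable_energy.prodMk (measurable_energy.comp (by fun_prop))
    exact (Complex.measurable_ofReal.comp (c.measurable.comp h1)).aestronglyMeasurable
  · exact aestronglyMeasurable_apply G.2.1 (quasi_head n)
      ((Lp.aestronglyMeasurable (ψ : Lp E 2 (configMeasure n))).comp_quasiMeasurePreserving
        (quasi_tail n))

theorem aestronglyMeasurable_creationFn (c : EnergyWeight) (G : WeakL2 E) {n : ℕ}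
    (ψ : Sector E n) : AEStronglyMeasurable (creationFn c G ψ) (configMeasure (n + 1)) := by
  unfold creationFn
  refine AEStronglyMeasurable.const_smul (Finset.aestronglyMeasurable_fun_sum _ fun σ _ => ?_) _
  exact (aestronglyMeasurable_creationKernel c G ψ).comp_quasiMeasurePreserving
    (measurePreserving_perm σ).quasiMeasurePreserving

theorem creationFn_perm (c : EnergyWeight) (G : WeakL2 E) {n : ℕ} (ψ : Sector E n)
    (τ : Equiv.Perm (Fin (n + 1))) (k : Fin (n + 1) → Mode) :
    creationFn c G ψ (fun i => k (τ i)) = creationFn c G ψ k := by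
  unfold creationFn
  congr 1
  exact Fintype.sum_equiv (Equiv.mulLeft τ) _ _ fun σ => rfl

theorem ae_perm_tail {n : ℕ} {p : (Fin n → Mode) → Prop} (h : ∀ᵐ k ∂configMeasure n, p k) :
    ∀ᵐ k ∂configMeasure (n + 1), ∀ σ : Equiv.Perm (Fin (n + 1)), p fun i => k (σ i.succ) := by
  rw [ae_all_iff]
  intro σ
  exact (measurePreserving_perm σ).quasiMeasurePreserving.ae ((quasi_tail n).ae h)

theorem creationFn_add (c : EnergyWeight) (G : WeakL2 E) {n : ℕ} (ψ η : Sector E n) :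
    ∀ᵐ k ∂configMeasure (n + 1),
      creationFn c G (ψ + η) k = creationFn c G ψ k + creationFn c G η k := by
  filter_upwards [ae_perm_tail (sector_add_ae ψ η)] with k hk
  simp only [creationFn, creationKernel, hk, map_add, smul_add, Finset.sum_add_distrib]

theorem creationFn_smul (c : EnergyWeight) (G : WeakL2 E) {n : ℕ} (a : ℂ) (ψ : Sector E n) :
    ∀ᵐ k ∂configMeasure (n + 1), creationFn c G (a • ψ) k = a • creationFn c G ψ k := by
  filter_upwards [ae_perm_tail (sector_smul_ae a ψ)] with k hk
  simp only [creationFn, creationKernel, hk, map_smul, smul_comm _ a, ← Finset.smul_sum]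

/-- Symmetrization preserves integrals. -/
theorem lintegral_symm {n : ℕ} {Q : (Fin n → Mode) → ℝ≥0∞} (hQm : AEMeasurable Q (configMeasure n)) :
    ∫⁻ k, (n.factorial : ℝ≥0∞)⁻¹ * ∑ σ : Equiv.Perm (Fin n), Q (fun i => k (σ i))
      ∂configMeasure n = ∫⁻ k, Q k ∂configMeasure n := by
  have hfac : (n.factorial : ℝ≥0∞) ≠ 0 := by exact_mod_cast (Nat.factorial_pos _).ne'
  have hsum := lintegral_finsetSum' (μ := configMeasure n) Finset.univ
    (f := fun (σ : Equiv.Perm (Fin n)) k => Q fun i => k (σ i))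
    (fun σ _ => hQm.comp_quasiMeasurePreserving (measurePreserving_perm σ).quasiMeasurePreserving)
  rw [lintegral_const_mul' _ _ (ENNReal.inv_ne_top.2 hfac), hsum]
  have hσ : ∀ σ : Equiv.Perm (Fin n),
      ∫⁻ k, Q (fun i => k (σ i)) ∂configMeasure n = ∫⁻ k, Q k ∂configMeasure n := by
    intro σ
    conv_rhs => rw [← (measurePreserving_perm σ).map_eq]
    rw [lintegral_map' _ (measurePreserving_perm σ).measurable.aemeasurable]
    rw [(measurePreserving_perm σ).map_eq]
    exact hQm
  rw [Finset.sum_congr rfl fun σ _ => hσ σ, Finset.sum_const, Finset.card_univ, Fintype.card_perm,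
    Fintype.card_fin, nsmul_eq_mul, ← mul_assoc, ENNReal.inv_mul_cancel hfac
      (ENNReal.natCast_ne_top _), one_mul]

/-- The integrand that dominates `‖√(n+1) S_{n+1}(G ψ)‖²` after symmetrization. -/
def creationBound (G : WeakL2 E) {n : ℕ} (ψ : Sector E n) (k : Fin (n + 1) → Mode) : ℝ≥0∞ :=
  (ENNReal.ofReal (1 + 1 / omega (k 0)) * ‖G (k 0)‖ₑ ^ (2 : ℝ)) *
    ‖(ψ : Lp E 2 (configMeasure n)) fun i => k i.succ‖ₑ ^ (2 : ℝ)

/-- The bound required of the weights supplies the hypothesis of the Cauchy–Schwarz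
inequality. -/
theorem norm_creationKernel_sq_le (c : EnergyWeight) (G : WeakL2 E) {n : ℕ} (ψ : Sector E n)
    (k : Fin (n + 1) → Mode) (hk : ∀ i, 0 < omega (k i)) :
    energy k * ‖creationKernel c G ψ k‖ ^ 2 ≤ (1 + omega (k 0)) *
      (‖G (k 0)‖ * ‖(ψ : Lp E 2 (configMeasure n)) fun i => k i.succ‖) ^ 2 := by
  have he : energy k = omega (k 0) + energy fun i : Fin n => k i.succ := Fin.sum_univ_succ _
  have hc := c.bound (energy k) (energy fun i : Fin n => k i.succ) (energy_nonneg _)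
    (by rw [he]; linarith [hk 0])
  set b := (ψ : Lp E 2 (configMeasure n)) fun i => k i.succ with hb
  have hn : ‖creationKernel c G ψ k‖ ≤
      |c.toFun (energy k) (energy fun i : Fin n => k i.succ)| * (‖G (k 0)‖ * ‖b‖) := by
    rw [creationKernel, norm_smul, Complex.norm_real, Real.norm_eq_abs]
    exact mul_le_mul_of_nonneg_left ((G (k 0)).le_opNorm _) (abs_nonneg _)
  have hE := energy_nonneg k
  calc energy k * ‖creationKernel c G ψ k‖ ^ 2
      ≤ energy k * (|c.toFun (energy k) (energy fun i : Fin n => k i.succ)| *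
        (‖G (k 0)‖ * ‖b‖)) ^ 2 :=
        mul_le_mul_of_nonneg_left (pow_le_pow_left₀ (norm_nonneg _) hn 2) hE
    _ = (energy k * c.toFun (energy k) (energy fun i : Fin n => k i.succ) ^ 2) *
        (‖G (k 0)‖ * ‖b‖) ^ 2 := by
        rw [mul_pow, sq_abs]; ring
    _ ≤ _ := by
        refine mul_le_mul_of_nonneg_right (hc.trans (le_of_eq ?_)) (sq_nonneg _)
        rw [he]; ring

theorem enorm_creationFn_sq_le (c : EnergyWeight) (G : WeakL2 E) {n : ℕ} (ψ : Sector E n)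
    (k : Fin (n + 1) → Mode) (hk : ∀ i, 0 < omega (k i)) :
    ‖creationFn c G ψ k‖ₑ ^ (2 : ℝ) ≤ ((n + 1).factorial : ℝ≥0∞)⁻¹ *
      ∑ σ : Equiv.Perm (Fin (n + 1)), creationBound G ψ fun i => k (σ i) := by
  have h := norm_symm_sum_sq_le k hk (fun σ => creationKernel c G ψ fun i => k (σ i))
    (fun σ => ‖G (k (σ 0))‖ * ‖(ψ : Lp E 2 (configMeasure n)) fun i => k (σ i.succ)‖) (by
      intro σ
      rw [← energy_perm σ k]
      exact norm_creationKernel_sq_le c G ψ (fun i => k (σ i)) fun i => hk (σ i))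
  have h' := ENNReal.ofReal_le_ofReal h
  rw [ENNReal.ofReal_pow (norm_nonneg _), ofReal_norm, ENNReal.ofReal_mul (by positivity),
    ENNReal.ofReal_inv_of_pos (by positivity), ENNReal.ofReal_natCast,
    ENNReal.ofReal_sum_of_nonneg (fun σ _ => by have := hk (σ 0); positivity)] at h'
  rw [ENNReal.rpow_two]
  refine h'.trans (le_of_eq ?_)
  congr 1
  refine Finset.sum_congr rfl fun σ _ => ?_
  have hω := hk (σ 0)
  rw [creationBound, ENNReal.ofReal_mul (by positivity), ENNReal.ofReal_pow (by positivity),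
    ENNReal.ofReal_mul (norm_nonneg _), ofReal_norm, ofReal_norm, mul_pow, ENNReal.rpow_two,
    ENNReal.rpow_two, mul_assoc]

theorem measurable_omega : Measurable omega := by unfold omega; fun_prop

theorem aemeasurable_weighted (G : WeakL2 E) :
    AEMeasurable (fun k => ENNReal.ofReal (1 + 1 / omega k) * ‖G k‖ₑ ^ (2 : ℝ)) modeMeasure := by
  refine AEMeasurable.mul ?_ ((aemeasurable_opNorm E G.2.1).pow_const _)
  have := measurable_omega
  fun_prop

theorem aemeasurable_sector_sq {n : ℕ} (ψ : Sector E n) :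
    AEMeasurable (fun k => ‖(ψ : Lp E 2 (configMeasure n)) k‖ₑ ^ (2 : ℝ)) (configMeasure n) :=
  (Lp.aestronglyMeasurable (ψ : Lp E 2 (configMeasure n))).enorm.pow_const _

theorem aemeasurable_creationBound (G : WeakL2 E) {n : ℕ} (ψ : Sector E n) :
    AEMeasurable (creationBound G ψ) (configMeasure (n + 1)) :=
  ((aemeasurable_weighted G).comp_quasiMeasurePreserving (quasi_head n)).mul
    ((aemeasurable_sector_sq ψ).comp_quasiMeasurePreserving (quasi_tail n))

theorem lintegral_creationBound (G : WeakL2 E) {n : ℕ} (ψ : Sector E n) :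
    ∫⁻ k, creationBound G ψ k ∂configMeasure (n + 1) = weightedNormSq G *
      ∫⁻ k, ‖(ψ : Lp E 2 (configMeasure n)) k‖ₑ ^ (2 : ℝ) ∂configMeasure n := by
  have : SigmaFinite (configMeasure n) := by unfold configMeasure; infer_instance
  have hGm := aemeasurable_weighted G
  have hψm := aemeasurable_sector_sq ψ
  rw [weightedNormSq, ← lintegral_prod_mul hGm hψm,
    ← (measurePreserving_split n).map_eq, lintegral_map' _ (by fun_prop)]
  · rfl
  rw [(measurePreserving_split n).map_eq]
  exact (hGm.comp_quasiMeasurePreserving Measure.quasiMeasurePreserving_fst).mul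
    (hψm.comp_quasiMeasurePreserving Measure.quasiMeasurePreserving_snd)

/-- The bound `‖√(n+1) S_{n+1} c G ψ‖² ≤ ‖G‖² ‖ψ‖²`, with the weighted norm of `G`. -/
theorem lintegral_creationFn_le (c : EnergyWeight) (G : WeakL2 E) {n : ℕ} (ψ : Sector E n) :
    ∫⁻ k, ‖creationFn c G ψ k‖ₑ ^ (2 : ℝ) ∂configMeasure (n + 1) ≤
      weightedNormSq G * ∫⁻ k, ‖(ψ : Lp E 2 (configMeasure n)) k‖ₑ ^ (2 : ℝ) ∂configMeasure n := by
  rw [← lintegral_creationBound G ψ, ← lintegral_symm (aemeasurable_creationBound G ψ)]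
  refine lintegral_mono_ae ?_
  filter_upwards [ae_omega_pos_all (n + 1)] with k hk
  exact enorm_creationFn_sq_le c G ψ k hk

theorem eLpNorm_two_eq {α F : Type*} [MeasurableSpace α] {μ : Measure α} [NormedAddCommGroup F]
    (f : α → F) : eLpNorm f 2 μ = (∫⁻ a, ‖f a‖ₑ ^ (2 : ℝ) ∂μ) ^ (1 / 2 : ℝ) := by
  rw [eLpNorm_eq_lintegral_rpow_enorm_toReal (by norm_num) (by norm_num), ENNReal.toReal_ofNat]

theorem eLpNorm_creationFn_le (c : EnergyWeight) (G : WeakL2 E) (hG : weightedNormSq G ≠ ⊤) {n : ℕ}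
    (ψ : Sector E n) : eLpNorm (creationFn c G ψ) 2 (configMeasure (n + 1)) ≤
      ((weightedNormSq G ^ (1 / 2 : ℝ)).toNNReal : ℝ≥0∞) * ‖ψ‖ₑ := by
  have h1 : ‖ψ‖ₑ = eLpNorm (ψ : Lp E 2 (configMeasure n)) 2 (configMeasure n) :=
    Lp.enorm_def (ψ : Lp E 2 (configMeasure n))
  rw [ENNReal.coe_toNNReal (ENNReal.rpow_ne_top_of_nonneg (by norm_num) hG), h1, eLpNorm_two_eq,
    eLpNorm_two_eq, ← ENNReal.mul_rpow_of_nonneg _ _ (by norm_num)]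
  exact ENNReal.rpow_le_rpow (lintegral_creationFn_le c G ψ) (by norm_num)

/-- The weighted creation operator from the `n`-photon to the `(n+1)`-photon sector. -/
def weightedCreationSector (c : EnergyWeight) (G : WeakL2 E) (hG : weightedNormSq G ≠ ⊤) (n : ℕ) :
    Sector E n →L[ℂ] Sector E (n + 1) :=
  sectorOp (fun ψ => creationFn c G ψ) (fun ψ => aestronglyMeasurable_creationFn c G ψ)
    (fun ψ σ => Eventually.of_forall fun k => creationFn_perm c G ψ σ k)
    (fun ψ η => creationFn_add c G ψ η) (fun a ψ => creationFn_smul c G a ψ) _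
    (fun ψ => eLpNorm_creationFn_le c G hG ψ)

theorem norm_weightedCreationSector_le (c : EnergyWeight) (G : WeakL2 E)
    (hG : weightedNormSq G ≠ ⊤) (n : ℕ) :
    ‖weightedCreationSector c G hG n‖ ≤ (weightedNormSq G ^ (1 / 2 : ℝ)).toReal :=
  norm_sectorOp_le _ _ _ _ _ _ _

open Classical in
/-- The creation operator with coupling function `G` and energy weight `c`, as a bounded operator;
it is `0` unless `∫ (1 + 1/ω) ‖G‖² < ∞`. -/
def weightedCreation (c : EnergyWeight) (G : WeakL2 E) : Fock E →L[ℂ] Fock E :=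
  if hG : weightedNormSq G ≠ ⊤ then
    (lpShift fun n => Sector E n).comp
      (lp.mapCLM 2 (weightedCreationSector c G hG) ENNReal.toReal_nonneg
        (norm_weightedCreationSector_le c G hG))
  else 0

theorem weightedCreation_zero (c : EnergyWeight) (G : WeakL2 E) (f : Fock E) :
    weightedCreation c G f 0 = 0 := by
  unfold weightedCreation
  split_ifs
  · rfl
  · rfl

theorem weightedCreation_succ_ae (c : EnergyWeight) {G : WeakL2 E} (hG : weightedNormSq G ≠ ⊤)
    (f : Fock E) (n : ℕ) : ∀ᵐ k ∂configMeasure (n + 1),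
      (weightedCreation c G f (n + 1) : Lp E 2 (configMeasure (n + 1))) k =
        creationFn c G (f n) k := by
  rw [weightedCreation, dif_pos hG]
  exact sectorOp_ae _ _ _ _ _ _ _ (f n)

theorem norm_weightedCreation_le (c : EnergyWeight) {G : WeakL2 E} (hG : weightedNormSq G ≠ ⊤) :
    ‖weightedCreation c G‖ ≤ (weightedNormSq G ^ (1 / 2 : ℝ)).toReal := by
  rw [weightedCreation, dif_pos hG]
  refine ContinuousLinearMap.opNorm_le_bound _ ENNReal.toReal_nonneg fun f => ?_
  refine (norm_shift (F := fun n => Sector E n) _).trans ?_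
  rw [one_mul]
  refine (ContinuousLinearMap.le_opNorm _ _).trans ?_
  exact mul_le_mul_of_nonneg_right (lp.norm_mapCLM_le _ _ _ _) (norm_nonneg _)

end Creation

/-! ### The creation operator and the resolvent of the field energy -/

section CreationOperator

variable {E : Type*} [NormedAddCommGroup E] [InnerProductSpace ℂ E] [CompleteSpace E]
  [TopologicalSpace.SeparableSpace E]

/-- The weight `1/(1+b)`, which turns `a*(G)` into `a*(G)(1 + H_f)⁻¹`. -/
def weightIn : EnergyWeight where
  toFun _ b := (1 + |b|)⁻¹
  measurable := by fun_prop
  bound a b hb hab := by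
    rw [abs_of_nonneg hb]
    have h1 : (1 + b)⁻¹ ^ 2 ≤ (1 + b)⁻¹ := by
      rw [sq]
      exact mul_le_of_le_one_left (by positivity) (inv_le_one_of_one_le₀ (by linarith))
    calc a * (1 + b)⁻¹ ^ 2 ≤ a * (1 + b)⁻¹ :=
          mul_le_mul_of_nonneg_left h1 (hb.trans hab)
      _ ≤ _ := by
          rw [mul_inv_le_iff₀ (by linarith)]
          nlinarith

/-- The weight `1/(1+a)`, which turns `a*(G)` into `(1 + H_f)⁻¹ a*(G)`. -/
def weightOut : EnergyWeight where
  toFun a _ := (1 + |a|)⁻¹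
  measurable := by fun_prop
  bound a b hb hab := by
    have ha := hb.trans hab
    rw [abs_of_nonneg ha, inv_pow, mul_inv_le_iff₀ (by positivity)]
    nlinarith

/-- The function `t ↦ 1/(1+|t|)`. -/
def resBorel : BddBorel where
  toFun t := ((1 + |t|)⁻¹ : ℝ)
  measurable := by fun_prop
  bound := 1
  norm_le t := by
    rw [Complex.norm_real, Real.norm_eq_abs, abs_of_nonneg (by positivity)]
    exact inv_le_one_of_one_le₀ (by linarith [abs_nonneg t])

variable (E) in
/-- The bounded operator `(1 + H_f)⁻¹`. -/
def resHf : Fock E →L[ℂ] Fock E := fnHf E resBorel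

theorem resHf_ae (f : Fock E) (n : ℕ) : ∀ᵐ k ∂configMeasure n,
    (resHf E f n : Lp E 2 (configMeasure n)) k =
      (((1 + |energy k|)⁻¹ : ℝ) : ℂ) • (f n : Lp E 2 (configMeasure n)) k :=
  fnHf_ae resBorel f n

theorem resHf_injective {f : Fock E} (h : resHf E f = 0) : f = 0 := by
  refine fock_ext_ae fun n => ?_
  filter_upwards [resHf_ae f n, fock_zero_ae (E := E) n] with k h1 h2
  rw [h, h2] at h1
  rw [h2]
  have h3 : (((1 + |energy k|)⁻¹ : ℝ) : ℂ) ≠ 0 := by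
    exact_mod_cast (inv_pos.2 (by positivity : (0 : ℝ) < 1 + |energy k|)).ne'
  exact (smul_eq_zero.1 h1.symm).resolve_left h3

/-- The pairs `(φ ⊗ ψ, √(n+1) S_{n+1}(G φ ⊗ ψ))` whose span is the graph of the creation
operator before closure. -/
def creationPairs (G : WeakL2 E) : Set (Fock E × Fock E) :=
  {p | ∃ (φ : E) (n : ℕ) (ψ : Sector ℂ n) (η : Sector E (n + 1)),
      (∀ᵐ k ∂configMeasure (n + 1), (η : Lp E 2 (configMeasure (n + 1))) k =
        ((Real.sqrt (n + 1) / (n + 1).factorial : ℝ) : ℂ) • ∑ σ : Equiv.Perm (Fin (n + 1)),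
          (ψ : Lp ℂ 2 (configMeasure n)) (fun i => k (σ i.succ)) • G (k (σ 0)) φ) ∧
      p = (tmul φ (lp.single 2 n ψ), lp.single 2 (n + 1) η)}

theorem tmul_single_apply_same (φ : E) (n : ℕ) (ψ : Sector ℂ n) : ∀ᵐ k ∂configMeasure n,
    (tmul φ (lp.single 2 n ψ : Fock ℂ) n : Lp E 2 (configMeasure n)) k =
      (ψ : Lp ℂ 2 (configMeasure n)) k • φ := by
  filter_upwards [tmul_ae φ (lp.single 2 n ψ : Fock ℂ) n] with k hk
  rw [hk, lp.single_apply_self]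

theorem tmul_single_apply_ne (φ : E) {n m : ℕ} (h : m ≠ n) (ψ : Sector ℂ n) :
    tmul φ (lp.single 2 n ψ : Fock ℂ) m = 0 := by
  refine sector_ext_ae ?_
  filter_upwards [tmul_ae φ (lp.single 2 n ψ : Fock ℂ) m, Lp.coeFn_zero ℂ 2 (configMeasure m),
    Lp.coeFn_zero E 2 (configMeasure m)] with k hk h0 h0'
  rw [hk, lp.single_apply_ne _ _ _ h]
  refine Eq.trans ?_ h0'.symm
  refine Eq.trans (congrArg (fun z : ℂ => z • φ) h0) ?_
  simp

/-- `creationFn` at an elementary tensor. -/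
theorem creationFn_tmul (c : EnergyWeight) (G : WeakL2 E) (φ : E) (n : ℕ) (ψ : Sector ℂ n) :
    ∀ᵐ k ∂configMeasure (n + 1),
      creationFn c G (tmul φ (lp.single 2 n ψ : Fock ℂ) n) k =
      ((Real.sqrt (n + 1) / (n + 1).factorial : ℝ) : ℂ) • ∑ σ : Equiv.Perm (Fin (n + 1)),
        (c.toFun (energy k) (energy fun i : Fin n => k (σ i.succ)) : ℂ) •
          (ψ : Lp ℂ 2 (configMeasure n)) (fun i => k (σ i.succ)) • G (k (σ 0)) φ := by
  filter_upwards [ae_perm_tail (tmul_single_apply_same φ n ψ)] with k hk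
  simp only [creationFn, creationKernel, hk, map_smul, energy_perm]

theorem weightedCreation_tmul_single_ne (c : EnergyWeight) {G : WeakL2 E}
    (hG : weightedNormSq G ≠ ⊤) (φ : E) {n m : ℕ} (ψ : Sector ℂ n) (hm : m ≠ n + 1) :
    weightedCreation c G (tmul φ (lp.single 2 n ψ : Fock ℂ)) m = 0 := by
  rcases m with _ | m
  · exact weightedCreation_zero _ _ _
  · have hmn : m ≠ n := fun h => hm (by rw [h])
    refine sector_ext_ae ?_
    have h0 := tmul_single_apply_ne φ hmn ψ
    filter_upwards [weightedCreation_succ_ae c hG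
      (tmul φ (lp.single 2 n ψ : Fock ℂ)) m,
      ae_perm_tail (Lp.coeFn_zero E 2 (configMeasure m)), Lp.coeFn_zero E 2
        (configMeasure (m + 1))] with k h1 h2 h3
    rw [h1, h0]
    refine Eq.trans ?_ h3.symm
    unfold creationFn creationKernel
    rw [Finset.sum_eq_zero, smul_zero]
    · rfl
    intro σ _
    rw [show ((0 : Sector E m) : Lp E 2 (configMeasure m)) (fun i => k (σ i.succ)) = 0 from
      h2 σ, map_zero, smul_zero]

theorem fock_eq_single {f : Fock E} {n : ℕ} (h : ∀ m, m ≠ n → f m = 0) :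
    f = lp.single 2 n (f n) := by
  apply lp.ext
  funext m
  rcases eq_or_ne m n with rfl | hm
  · rw [lp.single_apply_self]
  · rw [h m hm, lp.single_apply_ne _ _ _ hm]

theorem resHf_single_ne {n m : ℕ} (ψ : Sector ℂ n) (hm : m ≠ n) :
    resHf ℂ (lp.single 2 n ψ : Fock ℂ) m = 0 := by
  refine sector_ext_ae ?_
  filter_upwards [resHf_ae (lp.single 2 n ψ : Fock ℂ) m, Lp.coeFn_zero ℂ 2
    (configMeasure m)] with k h1 h2
  rw [h1, lp.single_apply_ne _ _ _ hm]
  have h2' : ((0 : Sector ℂ m) : Lp ℂ 2 (configMeasure m)) k = 0 := h2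
  rw [h2', smul_zero]

/-- `(1 + H_f)⁻¹ a*(G)` is bounded on the elementary tensors. -/
theorem weightedCreation_out {G : WeakL2 E} (hG : weightedNormSq G ≠ ⊤) {p : Fock E × Fock E}
    (hp : p ∈ creationPairs G) : weightedCreation weightOut G p.1 = resHf E p.2 := by
  obtain ⟨φ, n, ψ, η, hη, rfl⟩ := hp
  refine fock_ext_ae fun m => ?_
  rcases eq_or_ne m (n + 1) with rfl | hm
  · filter_upwards [weightedCreation_succ_ae weightOut hG (tmul φ (lp.single 2 n ψ : Fock ℂ)) n,
      creationFn_tmul weightOut G φ n ψ, resHf_ae (lp.single 2 (n + 1) η : Fock E) (n + 1), hη]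
      with k h1 h2 h3 h4
    rw [h1, h2, h3, lp.single_apply_self, h4, smul_comm (((1 + |energy k|)⁻¹ : ℝ) : ℂ)]
    congr 1
    rw [Finset.smul_sum]
    rfl
  · have hz := weightedCreation_tmul_single_ne weightOut hG φ ψ hm
    filter_upwards [resHf_ae (lp.single 2 (n + 1) η : Fock E) m, Lp.coeFn_zero E 2
      (configMeasure m)] with k h1 h2
    rw [hz, h1, lp.single_apply_ne _ _ _ hm]
    have h2' : ((0 : Sector E m) : Lp E 2 (configMeasure m)) k = 0 := h2
    rw [h2', smul_zero]

/-- `(1 + H_f)⁻¹ (φ ⊗ ψ)` and the value of `a*(G)` at this vector. -/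
theorem weightedCreation_in {G : WeakL2 E} (hG : weightedNormSq G ≠ ⊤) (φ : E) (n : ℕ)
    (ψ : Sector ℂ n) :
    (resHf E (tmul φ (lp.single 2 n ψ : Fock ℂ)),
      weightedCreation weightIn G (tmul φ (lp.single 2 n ψ : Fock ℂ))) ∈ creationPairs G := by
  refine ⟨φ, n, resHf ℂ (lp.single 2 n ψ : Fock ℂ) n,
    weightedCreation weightIn G (tmul φ (lp.single 2 n ψ : Fock ℂ)) (n + 1), ?_, ?_⟩
  · have h0 := resHf_ae (lp.single 2 n ψ : Fock ℂ) n
    filter_upwards [weightedCreation_succ_ae weightIn hG (tmul φ (lp.single 2 n ψ : Fock ℂ)) n,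
      creationFn_tmul weightIn G φ n ψ, ae_perm_tail h0] with k h1 h2 h3
    rw [h1, h2]
    congr 1
    refine Finset.sum_congr rfl fun σ _ => ?_
    rw [h3 σ, lp.single_apply_self, smul_smul]
    rfl
  · rw [← fock_eq_single fun m hm => resHf_single_ne ψ hm,
      ← fock_eq_single fun m hm => weightedCreation_tmul_single_ne weightIn hG φ ψ hm]
    exact congrArg (fun x => (x, _)) (fnHf_tmul resBorel φ _)

/-- The graph `{(x, y) | D x = R y}`, closed by continuity, contains the graph of `a*(G)`. -/
theorem creationPairs_span_le {G : WeakL2 E} (hG : weightedNormSq G ≠ ⊤) {p : Fock E × Fock E}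
    (hp : p ∈ Submodule.span ℂ (creationPairs G)) :
    weightedCreation weightOut G p.1 = resHf E p.2 := by
  induction hp using Submodule.span_induction with
  | mem p hp => exact weightedCreation_out hG hp
  | zero => rw [Prod.fst_zero, Prod.snd_zero, map_zero, map_zero]
  | add p q _ _ hp hq => rw [Prod.fst_add, Prod.snd_add, map_add, map_add, hp, hq]
  | smul c p _ hp => rw [Prod.smul_fst, Prod.smul_snd, map_smul, map_smul, hp]

theorem isClosable_of_graph_closure {X : Type*} [NormedAddCommGroup X] [NormedSpace ℂ X]
    {f : X →ₗ.[ℂ] X} (h : ∀ p ∈ f.graph.topologicalClosure, p.1 = 0 → p.2 = 0) :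
    f.IsClosable :=
  ⟨_, (Submodule.toLinearPMap_graph_eq _ h).symm⟩

/-- The creation operator before closure stays in a closed graph, whence it is closable. -/
theorem weightedCreation_closure {G : WeakL2 E} (hG : weightedNormSq G ≠ ⊤) {p : Fock E × Fock E}
    (hp : p ∈ (Submodule.span ℂ (creationPairs G)).topologicalClosure) :
    weightedCreation weightOut G p.1 = resHf E p.2 := by
  have hc : IsClosed {p : Fock E × Fock E | weightedCreation weightOut G p.1 = resHf E p.2} :=
    isClosed_eq ((weightedCreation weightOut G).continuous.comp continuous_fst)
      ((resHf E).continuous.comp continuous_snd)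
  exact closure_minimal (fun q hq => creationPairs_span_le hG hq) hc hp

/-- The graph of the creation operator. -/
theorem graph_creation {G : WeakL2 E} (hG : weightedNormSq G ≠ ⊤) :
    (creation G).graph = (Submodule.span ℂ (creationPairs G)).topologicalClosure := by
  have h0 : ∀ p ∈ Submodule.span ℂ (creationPairs G), p.1 = 0 → p.2 = 0 := fun p hp h => by
    have h1 := creationPairs_span_le hG hp
    rw [h, map_zero] at h1
    exact resHf_injective h1.symm
  have h1 := Submodule.toLinearPMap_graph_eq _ h0
  have h2 : (Submodule.span ℂ (creationPairs G)).toLinearPMap.IsClosable := by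
    refine isClosable_of_graph_closure fun p hp h => ?_
    rw [h1] at hp
    have h2 := weightedCreation_closure hG hp
    rw [h, map_zero] at h2
    exact resHf_injective h2.symm
  rw [← h1, h2.graph_closure_eq_closure_graph]
  rfl

/-- `a*(G) (1 + H_f)⁻¹` is the bounded operator `weightedCreation weightIn G`. -/
theorem creation_resHf_mem {G : WeakL2 E} (hG : weightedNormSq G ≠ ⊤) (u : Fock E) :
    (resHf E u, weightedCreation weightIn G u) ∈ (creation G).graph := by
  rw [graph_creation hG]
  have hc : IsClosed {u : Fock E | (resHf E u, weightedCreation weightIn G u) ∈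
      (Submodule.span ℂ (creationPairs G)).topologicalClosure} :=
    (Submodule.isClosed_topologicalClosure _).preimage
      ((resHf E).continuous.prodMk (weightedCreation weightIn G).continuous)
  refine closure_minimal ?_ hc (dense_span_tmul (E := E) u)
  intro v hv
  apply Submodule.le_topologicalClosure
  induction hv using Submodule.span_induction with
  | mem p hp =>
    obtain ⟨φ, n, ψ, rfl⟩ := hp
    exact Submodule.subset_span (weightedCreation_in hG φ n ψ)
  | zero => rw [map_zero, map_zero]; exact Submodule.zero_mem _
  | add p q _ _ hp hq =>
    rw [map_add, map_add]
    exact Submodule.add_mem _ hp hq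
  | smul c p _ hp =>
    rw [map_smul, map_smul]
    exact Submodule.smul_mem _ c hp

variable (E) in
/-- A bounded continuous scalar function of the photon energy, as an operator-valued one. -/
def scalarEnergyFn (f : ℝ≥0 → ℂ) (hf : Continuous f) (C : ℝ) (hC : ∀ q, ‖f q‖ ≤ C) : EnergyFn E :=
  BoundedContinuousFunction.ofNormedAddCommGroup (fun q => f q • (1 : E →L[ℂ] E))
    (hf.smul continuous_const) (C * ‖(1 : E →L[ℂ] E)‖) (fun q => by
      rw [norm_smul]
      exact mul_le_mul_of_nonneg_right (hC q) (norm_nonneg _))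

theorem scalarEnergyFn_apply (f : ℝ≥0 → ℂ) (hf : Continuous f) (C : ℝ) (hC : ∀ q, ‖f q‖ ≤ C)
    (q : ℝ≥0) : scalarEnergyFn E f hf C hC q = f q • 1 := rfl

theorem continuous_res : Continuous fun q : ℝ≥0 => (((1 + |(q : ℝ)|)⁻¹ : ℝ) : ℂ) := by
  refine Complex.continuous_ofReal.comp (Continuous.inv₀ (by fun_prop) fun q => ?_)
  positivity

variable (E) in
/-- The function `q ↦ 1/(1+q)` of the photon energy. -/
def resEnergyFn : EnergyFn E :=
  scalarEnergyFn E _ continuous_res 1 fun q => resBorel.norm_le q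

theorem resEnergyFn_apply (q : ℝ≥0) :
    resEnergyFn E q = (((1 + |(q : ℝ)|)⁻¹ : ℝ) : ℂ) • 1 := rfl

theorem resHf_eq_opFn : resHf E = opFn (resEnergyFn E) :=
  fnHf_eq_opFn fun _ => rfl

theorem inner_resHf_left (f g : Fock E) : inner ℂ (resHf E f) g = inner ℂ f (resHf E g) := by
  have h : ∀ q : ℝ≥0, resEnergyFn E q = ContinuousLinearMap.adjoint (resEnergyFn E q) :=
    fun q => by
      refine (ContinuousLinearMap.eq_adjoint_iff _ _).2 fun x y => ?_
      change inner ℂ ((((1 + |(q : ℝ)|)⁻¹ : ℝ) : ℂ) • x) y =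
        inner ℂ x ((((1 + |(q : ℝ)|)⁻¹ : ℝ) : ℂ) • y)
      rw [inner_smul_left, inner_smul_right, Complex.conj_ofReal]
  rw [resHf_eq_opFn]
  exact inner_opFn_left (E := E) h f g

theorem dense_range_resHf : Dense (Set.range (resHf E)) := by
  rw [resHf_eq_opFn]
  refine dense_range_opFn (E := E) fun q x => ⟨((1 + |(q : ℝ)| : ℝ) : ℂ) • x, ?_⟩
  change (((1 + |(q : ℝ)|)⁻¹ : ℝ) : ℂ) • ((1 + |(q : ℝ)| : ℝ) : ℂ) • x = x
  rw [smul_smul, ← Complex.ofReal_mul, inv_mul_cancel₀ (by positivity), Complex.ofReal_one,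
    one_smul]

theorem dense_domain_creation {G : WeakL2 E} (hG : weightedNormSq G ≠ ⊤) :
    Dense ((creation G).domain : Set (Fock E)) := by
  refine dense_range_resHf.mono ?_
  rintro _ ⟨u, rfl⟩
  exact LinearPMap.mem_domain_of_mem_graph (creation_resHf_mem hG u)

/-- If `R f` extends to the bounded operator `D` and `R` is symmetric, then `f* R = D*`. -/
theorem adjoint_comp_mem {X : Type*} [NormedAddCommGroup X] [InnerProductSpace ℂ X]
    [CompleteSpace X] {f : X →ₗ.[ℂ] X} (hf : Dense (f.domain : Set X)) {R D : X →L[ℂ] X}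
    (hR : ∀ x y, inner ℂ (R x) y = inner ℂ x (R y)) (h : ∀ p ∈ f.graph, D p.1 = R p.2) (u : X) :
    (R u, ContinuousLinearMap.adjoint D u) ∈ f.adjoint.graph := by
  have key : ∀ x : f.domain, inner ℂ (ContinuousLinearMap.adjoint D u) (x : X) =
      inner ℂ (R u) (f x) := fun x => by
    rw [ContinuousLinearMap.adjoint_inner_left, h _ (f.mem_graph x), hR]
  have hm := LinearPMap.mem_adjoint_domain_of_exists (T := f) (R u) ⟨_, key⟩
  rw [LinearPMap.mem_graph_iff]
  exact ⟨⟨_, hm⟩, rfl, LinearPMap.adjoint_apply_eq hf ⟨_, hm⟩ key⟩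

/-- `a(G) (1 + H_f)⁻¹ = ((1 + H_f)⁻¹ a*(G))*`. -/
theorem annihilation_resHf_mem {G : WeakL2 E} (hG : weightedNormSq G ≠ ⊤) (u : Fock E) :
    (resHf E u, ContinuousLinearMap.adjoint (weightedCreation weightOut G) u) ∈
      (annihilation G).graph := by
  refine adjoint_comp_mem (X := Fock E) (f := creation G) (dense_domain_creation hG)
    (fun x y => inner_resHf_left (E := E) x y) (fun p hp => ?_) u
  rw [graph_creation hG] at hp
  exact weightedCreation_closure hG hp

/-- The bounded operator `W(s) (1 + H_f)⁻¹`. -/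
def boundedInteraction {ν : ℕ} (G : (Fin ν → ℂ) → WeakL2 E) (s : Fin ν → ℂ) :
    Fock E →L[ℂ] Fock E :=
  ContinuousLinearMap.adjoint (weightedCreation weightOut (G (star s))) +
    weightedCreation weightIn (G s)

theorem add_mem_graph_pmap {X : Type*} [NormedAddCommGroup X] [NormedSpace ℂ X]
    {f g : X →ₗ.[ℂ] X} {x y z : X} (hf : (x, y) ∈ f.graph) (hg : (x, z) ∈ g.graph) :
    (x, y + z) ∈ (f + g).graph := by
  rw [LinearPMap.mem_graph_iff] at hf hg ⊢
  obtain ⟨a, ha, rfl⟩ := hf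
  obtain ⟨b, hb, rfl⟩ := hg
  obtain rfl : (a : X) = x := ha
  have hb' : (b : X) = a := hb
  refine ⟨⟨a, ⟨a.2, hb' ▸ b.2⟩⟩, rfl, ?_⟩
  rw [LinearPMap.add_apply]
  congr 1
  exact congrArg g (Subtype.ext hb'.symm)

/-- `W(s) (1 + H_f)⁻¹` is everywhere defined and equals `boundedInteraction G s`. -/
theorem interaction_resHf_mem {ν : ℕ} {G : (Fin ν → ℂ) → WeakL2 E} {s : Fin ν → ℂ}
    (h : weightedNormSq (G s) ≠ ⊤) (h' : weightedNormSq (G (star s)) ≠ ⊤) (u : Fock E) :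
    (resHf E u, boundedInteraction G s u) ∈ (interaction G s).graph :=
  add_mem_graph_pmap (X := Fock E) (annihilation_resHf_mem h' u) (creation_resHf_mem h u)

end CreationOperator

/-! ### Analyticity of the interaction -/

section Analyticity

variable {E : Type*} [NormedAddCommGroup E] [InnerProductSpace ℂ E] [CompleteSpace E]
  [TopologicalSpace.SeparableSpace E]

theorem weightedNormSq_add_ne_top {G G' : WeakL2 E} (hG : weightedNormSq G ≠ ⊤)
    (hG' : weightedNormSq G' ≠ ⊤) : weightedNormSq (G + G') ≠ ⊤ := by
  have hle : weightedNormSq (G + G') ≤ 2 * (weightedNormSq G + weightedNormSq G') := by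
    unfold weightedNormSq
    rw [← lintegral_add_left' (aemeasurable_weighted G), ← lintegral_const_mul' _ _ (by simp)]
    refine lintegral_mono fun k => ?_
    rw [← mul_add, ← mul_assoc, mul_comm (2 : ℝ≥0∞), mul_assoc]
    refine mul_le_mul_right ?_ _
    have h1 : ‖(G + G') k‖ₑ ≤ ‖G k‖ₑ + ‖G' k‖ₑ := enorm_add_le (G k) (G' k)
    refine (ENNReal.rpow_le_rpow h1 zero_le_two).trans ?_
    refine (ENNReal.rpow_add_le_mul_rpow_add_rpow _ _ one_le_two).trans ?_
    norm_num
  exact ne_top_of_le_ne_top (ENNReal.mul_ne_top (by simp) (ENNReal.add_ne_top.2 ⟨hG, hG'⟩)) hle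

theorem weightedNormSq_smul_ne_top {G : WeakL2 E} (c : ℂ) (hG : weightedNormSq G ≠ ⊤) :
    weightedNormSq (c • G) ≠ ⊤ := by
  have hle : weightedNormSq (c • G) = ‖c‖ₑ ^ (2 : ℝ) * weightedNormSq G := by
    unfold weightedNormSq
    rw [← lintegral_const_mul' _ _ (ENNReal.rpow_ne_top_of_nonneg zero_le_two enorm_ne_top)]
    refine lintegral_congr fun k => ?_
    have h1 : ‖(c • G) k‖ₑ = ‖c‖ₑ * ‖G k‖ₑ := enorm_smul c (G k)
    rw [h1, ENNReal.mul_rpow_of_nonneg _ _ zero_le_two, mul_left_comm]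
  rw [hle]
  exact ENNReal.mul_ne_top (ENNReal.rpow_ne_top_of_nonneg zero_le_two enorm_ne_top) hG

theorem creationFn_add_left (c : EnergyWeight) (G G' : WeakL2 E) {n : ℕ} (ψ : Sector E n)
    (k : Fin (n + 1) → Mode) :
    creationFn c (G + G') ψ k = creationFn c G ψ k + creationFn c G' ψ k := by
  have h : ∀ k, (G + G') k = G k + G' k := fun k => rfl
  simp only [creationFn, creationKernel, h, add_apply, smul_add,
    Finset.sum_add_distrib]

theorem creationFn_smul_left (c : EnergyWeight) (a : ℂ) (G : WeakL2 E) {n : ℕ} (ψ : Sector E n)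
    (k : Fin (n + 1) → Mode) : creationFn c (a • G) ψ k = a • creationFn c G ψ k := by
  have h : ∀ k, (a • G) k = a • G k := fun k => rfl
  simp only [creationFn, creationKernel, h, smul_apply, smul_comm _ a, ← Finset.smul_sum]

theorem weightedCreation_add (c : EnergyWeight) {G G' : WeakL2 E} (hG : weightedNormSq G ≠ ⊤)
    (hG' : weightedNormSq G' ≠ ⊤) :
    weightedCreation c (G + G') = weightedCreation c G + weightedCreation c G' := by
  ext1 f
  refine fock_ext_ae fun n => ?_
  rcases n with _ | n
  · filter_upwards [fock_add_ae (weightedCreation c G f) (weightedCreation c G' f) 0,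
      Lp.coeFn_zero E 2 (configMeasure 0)] with k h1 h2
    have h2' : ((0 : Sector E 0) : Lp E 2 (configMeasure 0)) k = 0 := h2
    refine Eq.trans ?_ h1.symm
    rw [weightedCreation_zero, weightedCreation_zero, weightedCreation_zero, h2', add_zero]
  · filter_upwards [fock_add_ae (weightedCreation c G f) (weightedCreation c G' f) (n + 1),
      weightedCreation_succ_ae c hG f n, weightedCreation_succ_ae c hG' f n,
      weightedCreation_succ_ae c (weightedNormSq_add_ne_top hG hG') f n] with k h1 h2 h3 h4
    refine Eq.trans ?_ h1.symm
    rw [h2, h3, h4, creationFn_add_left]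

theorem weightedCreation_smul (c : EnergyWeight) (a : ℂ) {G : WeakL2 E}
    (hG : weightedNormSq G ≠ ⊤) : weightedCreation c (a • G) = a • weightedCreation c G := by
  ext1 f
  refine fock_ext_ae fun n => ?_
  rcases n with _ | n
  · filter_upwards [fock_smul_ae a (weightedCreation c G f) 0,
      Lp.coeFn_zero E 2 (configMeasure 0)] with k h1 h2
    have h2' : ((0 : Sector E 0) : Lp E 2 (configMeasure 0)) k = 0 := h2
    refine Eq.trans ?_ h1.symm
    rw [weightedCreation_zero, weightedCreation_zero, h2', smul_zero]
  · filter_upwards [fock_smul_ae a (weightedCreation c G f) (n + 1),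
      weightedCreation_succ_ae c hG f n,
      weightedCreation_succ_ae c (weightedNormSq_smul_ne_top a hG) f n] with k h1 h2 h4
    refine Eq.trans ?_ h1.symm
    rw [h2, h4, creationFn_smul_left]

/-- The coupling function with an infrared cutoff, `1_{ω ≥ δ} G`. -/
def irCutoff (δ : ℝ) (G : WeakL2 E) : WeakL2 E :=
  ⟨{k | δ ≤ omega k}.indicator G.1, by
    have hm : MeasurableSet {k | δ ≤ omega k} := measurableSet_le measurable_const measurable_omega
    refine ⟨fun x y => ?_, lt_of_le_of_lt (lintegral_mono fun k => ?_) G.2.2⟩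
    · have : (fun k => inner ℂ x ({k | δ ≤ omega k}.indicator G.1 k y)) =
          {k | δ ≤ omega k}.indicator fun k => inner ℂ x (G k y) := by
        funext k
        by_cases h : k ∈ {k | δ ≤ omega k}
        · rw [Set.indicator_of_mem h, Set.indicator_of_mem h]
        · rw [Set.indicator_of_notMem h, Set.indicator_of_notMem h]
          exact inner_zero_right x
      rw [this]
      exact (G.2.1 x y).indicator hm
    · refine ENNReal.rpow_le_rpow ?_ zero_le_two
      by_cases h : k ∈ {k | δ ≤ omega k}
      · rw [Set.indicator_of_mem h]
      · rw [Set.indicator_of_notMem h]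
        exact (enorm_zero (E := E →L[ℂ] E)).le.trans zero_le⟩

theorem irCutoff_add (δ : ℝ) (G G' : WeakL2 E) :
    irCutoff δ (G + G') = irCutoff δ G + irCutoff δ G' :=
  Subtype.ext (Set.indicator_add _ G.1 G'.1)

theorem irCutoff_smul (δ : ℝ) (a : ℂ) (G : WeakL2 E) :
    irCutoff δ (a • G) = a • irCutoff δ G :=
  Subtype.ext (Set.indicator_const_smul _ a G.1)

theorem lintegral_eq_norm_sq (G : WeakL2 E) :
    ∫⁻ k, ‖G k‖ₑ ^ (2 : ℝ) ∂modeMeasure = ENNReal.ofReal (‖G‖ ^ 2) := by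
  have h : ‖G‖ = ((∫⁻ k, ‖G k‖ₑ ^ (2 : ℝ) ∂modeMeasure) ^ (1 / 2 : ℝ)).toReal := rfl
  have hf : (∫⁻ k, ‖G k‖ₑ ^ (2 : ℝ) ∂modeMeasure) ^ (1 / 2 : ℝ) ≠ ⊤ :=
    ENNReal.rpow_ne_top_of_nonneg (by norm_num) G.2.2.ne
  rw [h, ENNReal.ofReal_pow ENNReal.toReal_nonneg, ENNReal.ofReal_toReal hf, ← ENNReal.rpow_two,
    ← ENNReal.rpow_mul]
  norm_num

theorem weightedNormSq_irCutoff_le {δ : ℝ} (hδ : 0 < δ) (G : WeakL2 E) :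
    weightedNormSq (irCutoff δ G) ≤ ENNReal.ofReal ((1 + 1 / δ) * ‖G‖ ^ 2) := by
  rw [ENNReal.ofReal_mul (by positivity), ← lintegral_eq_norm_sq,
    ← lintegral_const_mul' _ _ ENNReal.ofReal_ne_top]
  refine lintegral_mono fun k => ?_
  by_cases h : δ ≤ omega k
  · have h1 : irCutoff δ G k = G k := Set.indicator_of_mem (s := {k | δ ≤ omega k}) h _
    rw [h1]
    gcongr
  · have h1 : irCutoff δ G k = 0 := Set.indicator_of_notMem (s := {k | δ ≤ omega k}) h _
    have h2 : ‖irCutoff δ G k‖ₑ = 0 := by rw [h1]; exact enorm_zero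
    rw [h2, ENNReal.zero_rpow_of_pos zero_lt_two, mul_zero]
    exact zero_le

theorem norm_weightedCreation_le_of (c : EnergyWeight) {G : WeakL2 E} {C : ℝ} (hC : 0 ≤ C)
    (h : weightedNormSq G ≤ ENNReal.ofReal (C ^ 2)) : ‖weightedCreation c G‖ ≤ C := by
  refine (norm_weightedCreation_le c (ne_top_of_le_ne_top ENNReal.ofReal_ne_top h)).trans ?_
  refine ENNReal.toReal_le_of_le_ofReal hC ?_
  refine (ENNReal.rpow_le_rpow h (by norm_num)).trans ?_
  rw [ENNReal.ofReal_rpow_of_nonneg (by positivity) (by norm_num), ← Real.sqrt_eq_rpow,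
    Real.sqrt_sq hC]

theorem weightedNormSq_irCutoff_ne_top {δ : ℝ} (hδ : 0 < δ) (G : WeakL2 E) :
    weightedNormSq (irCutoff δ G) ≠ ⊤ :=
  ne_top_of_le_ne_top ENNReal.ofReal_ne_top (weightedNormSq_irCutoff_le hδ G)

/-- The infrared condition controls the photons of energy below `δ`. -/
theorem weightedNormSq_sub_irCutoff_le {δ μ : ℝ} (hδ : δ ≤ 1) (hμ : 0 < μ) (G : WeakL2 E) :
    weightedNormSq (G - irCutoff δ G) ≤ ENNReal.ofReal (2 * δ) *
      ∫⁻ k, ‖G k‖ₑ ^ (2 : ℝ) / ENNReal.ofReal (omega k ^ (2 + 2 * μ)) ∂modeMeasure := by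
  rw [← lintegral_const_mul' _ _ ENNReal.ofReal_ne_top]
  refine lintegral_mono_ae ?_
  filter_upwards [ae_omega_pos] with k hk
  by_cases h : δ ≤ omega k
  · have h1 : (G - irCutoff δ G) k = 0 := by
      change G k - irCutoff δ G k = 0
      rw [show irCutoff δ G k = G k from Set.indicator_of_mem (s := {k | δ ≤ omega k}) h _,
        sub_self]
    have h2 : ‖(G - irCutoff δ G) k‖ₑ = 0 := by rw [h1]; exact enorm_zero
    rw [h2, ENNReal.zero_rpow_of_pos zero_lt_two, mul_zero]
    exact zero_le
  · have h1 : (G - irCutoff δ G) k = G k := by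
      change G k - irCutoff δ G k = G k
      rw [show irCutoff δ G k = 0 from
        Set.indicator_of_notMem (s := {k | δ ≤ omega k}) h _, sub_zero]
    rw [h1, div_eq_mul_inv (‖G k‖ₑ ^ (2 : ℝ)), ← ENNReal.ofReal_inv_of_pos (by positivity), mul_left_comm,
      mul_comm _ (‖G k‖ₑ ^ (2 : ℝ)), ← ENNReal.ofReal_mul' (by positivity)]
    refine mul_le_mul_right (ENNReal.ofReal_le_ofReal ?_) _
    push Not at h
    have h3 : omega k ^ (2 + 2 * μ) ≤ omega k ^ 2 := by
      rw [← Real.rpow_natCast]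
      exact Real.rpow_le_rpow_of_exponent_ge hk (h.le.trans hδ) (by push_cast; linarith)
    rw [← div_eq_mul_inv, le_div_iff₀ (by positivity)]
    calc (1 + 1 / omega k) * omega k ^ (2 + 2 * μ) ≤ (1 + 1 / omega k) * omega k ^ 2 := by gcongr
      _ = omega k * omega k + omega k := by field_simp
      _ ≤ 2 * δ := by nlinarith

/-- The bounded operator on the separation quotient of a seminormed space induced by an additive,
homogeneous and bounded function. -/
def quotientCLM {A B : Type*} [SeminormedAddCommGroup A] [NormedSpace ℂ A] [NormedAddCommGroup B]
    [NormedSpace ℂ B] (f : A → B) (hadd : ∀ a b, f (a + b) = f a + f b)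
    (hsmul : ∀ (c : ℂ) a, f (c • a) = c • f a) (C : ℝ) (hC : ∀ a, ‖f a‖ ≤ C * ‖a‖) :
    SeparationQuotient A →L[ℂ] B :=
  SeparationQuotient.liftCLM (LinearMap.mkContinuous ⟨⟨f, hadd⟩, hsmul⟩ C hC)
    fun _ _ h => (h.map (LinearMap.mkContinuous _ C hC).continuous).eq

theorem norm_le_add_of_sub {B : Type*} [NormedAddCommGroup B] {x y : B} {a b : ℝ}
    (h1 : ‖x - y‖ ≤ a) (h2 : ‖y‖ ≤ b) : ‖x‖ ≤ a + b := by
  rw [← sub_add_cancel x y]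
  exact (norm_add_le _ _).trans (add_le_add h1 h2)

theorem norm_add_le_of_le' {B : Type*} [NormedAddCommGroup B] {x y : B} {a b : ℝ}
    (h1 : ‖x‖ ≤ a) (h2 : ‖y‖ ≤ b) : ‖x + y‖ ≤ a + b :=
  (norm_add_le _ _).trans (add_le_add h1 h2)

/-- `G ↦` the weighted creation operator with infrared cutoff, as a bounded linear map. -/
def cutoffCreationL (c : EnergyWeight) {δ : ℝ} (hδ : 0 < δ) :
    OpL2 E →L[ℂ] (Fock E →L[ℂ] Fock E) :=
  quotientCLM (A := WeakL2 E) (B := Fock E →L[ℂ] Fock E)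
    (fun G => weightedCreation c (irCutoff δ G))
    (fun G G' => by
      rw [irCutoff_add]
      exact weightedCreation_add c (weightedNormSq_irCutoff_ne_top hδ G)
        (weightedNormSq_irCutoff_ne_top hδ G'))
    (fun a G => by
      rw [irCutoff_smul]
      exact weightedCreation_smul c a (weightedNormSq_irCutoff_ne_top hδ G))
    (Real.sqrt (1 + 1 / δ)) (fun G => by
      refine norm_weightedCreation_le_of c (by positivity) ?_
      rw [mul_pow, Real.sq_sqrt (by positivity)]
      exact weightedNormSq_irCutoff_le hδ G)

theorem clm_comp_analyticAt {M Q B : Type*} [NormedAddCommGroup M] [NormedSpace ℂ M]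
    [NormedAddCommGroup Q] [NormedSpace ℂ Q] [NormedAddCommGroup B] [NormedSpace ℂ B]
    (L : Q →L[ℂ] B) {f : M → Q} {s : M} (hf : AnalyticAt ℂ f s) :
    AnalyticAt ℂ (fun s => L (f s)) s :=
  (L.analyticAt _).comp hf

variable {ν : ℕ} {V : Set (Fin ν → ℂ)} {G : (Fin ν → ℂ) → WeakL2 E}

theorem analyticOnNhd_cutoffCreation (hG : HypG V G) (c : EnergyWeight) {δ : ℝ} (hδ : 0 < δ) :
    AnalyticOnNhd ℂ (fun s => weightedCreation c (irCutoff δ (G s))) V := by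
  intro s hs
  exact clm_comp_analyticAt (Q := OpL2 E) (B := Fock E →L[ℂ] Fock E) (cutoffCreationL c hδ)
    (hG.analytic s hs)

/-- The infrared condition makes the creation operators uniform limits of those with cutoff. -/
theorem HypG.exists_uniform (hG : HypG V G) : ∃ C : ℝ, 0 ≤ C ∧ ∀ s ∈ V,
    weightedNormSq (G s) ≠ ⊤ ∧ ∀ c : EnergyWeight, ‖weightedCreation c (G s)‖ ≤ C ∧
      ∀ δ : ℝ, 0 < δ → δ ≤ 1 →
        ‖weightedCreation c (G s) - weightedCreation c (irCutoff δ (G s))‖ ≤ Real.sqrt δ * C := by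
  obtain ⟨C₁, hC₁⟩ := hG.bounded
  obtain ⟨μ, hμ, C₂, hC₂⟩ := hG.infrared
  refine ⟨Real.sqrt (2 * C₂) + Real.sqrt 2 * |C₁|, by positivity, fun s hs => ?_⟩
  have hd : ∀ δ : ℝ, 0 < δ → δ ≤ 1 → weightedNormSq (G s - irCutoff δ (G s)) ≤
      ENNReal.ofReal ((Real.sqrt δ * Real.sqrt (2 * C₂)) ^ 2) := by
    intro δ hδ hδ1
    refine (weightedNormSq_sub_irCutoff_le hδ1 hμ (G s)).trans ?_
    refine (mul_le_mul_right (hC₂ s hs) _).trans (le_of_eq ?_)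
    rw [mul_pow, Real.sq_sqrt hδ.le, Real.sq_sqrt (by positivity), ← ENNReal.ofReal_coe_nnreal,
      ← ENNReal.ofReal_mul (by positivity)]
    congr 1
    ring
  have hne : ∀ δ : ℝ, 0 < δ → δ ≤ 1 → weightedNormSq (G s - irCutoff δ (G s)) ≠ ⊤ :=
    fun δ h1 h2 => ne_top_of_le_ne_top ENNReal.ofReal_ne_top (hd δ h1 h2)
  have hsplit : ∀ δ : ℝ, G s = (G s - irCutoff δ (G s)) + irCutoff δ (G s) := fun δ =>
    (sub_add_cancel _ _).symm
  have hGs : weightedNormSq (G s) ≠ ⊤ := by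
    rw [hsplit 1]
    exact weightedNormSq_add_ne_top (hne 1 one_pos le_rfl)
      (weightedNormSq_irCutoff_ne_top one_pos _)
  have hdiff : ∀ c : EnergyWeight, ∀ δ : ℝ, 0 < δ → δ ≤ 1 →
      ‖weightedCreation c (G s) - weightedCreation c (irCutoff δ (G s))‖ ≤
        Real.sqrt δ * Real.sqrt (2 * C₂) := by
    intro c δ h1 h2
    have h3 := weightedCreation_add c (hne δ h1 h2) (weightedNormSq_irCutoff_ne_top h1 (G s))
    rw [← hsplit] at h3
    rw [h3, add_sub_cancel_right]
    exact norm_weightedCreation_le_of c (by positivity) (hd δ h1 h2)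
  refine ⟨hGs, fun c => ⟨?_, fun δ h1 h2 => (hdiff c δ h1 h2).trans ?_⟩⟩
  · have h1 := hdiff c 1 one_pos le_rfl
    rw [Real.sqrt_one, one_mul] at h1
    have h2 : ‖weightedCreation c (irCutoff 1 (G s))‖ ≤ Real.sqrt 2 * |C₁| := by
      refine norm_weightedCreation_le_of c (by positivity) ?_
      refine (weightedNormSq_irCutoff_le one_pos (G s)).trans (ENNReal.ofReal_le_ofReal ?_)
      rw [mul_pow, Real.sq_sqrt (by positivity), sq_abs]
      have h3 := hC₁ s hs
      have h4 : 0 ≤ ‖G s‖ := norm_nonneg _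
      nlinarith
    exact norm_le_add_of_sub (B := Fock E →L[ℂ] Fock E) h1 h2
  · exact mul_le_mul_of_nonneg_left (le_add_of_nonneg_right (by positivity)) (Real.sqrt_nonneg _)

/-- The weighted creation operators are uniform limits, as `δ → 0`, of those with infrared cutoff,
which are bounded linear functions of `G`. -/
theorem lineHolomorphicOn_weightedCreation (hV : IsOpen V) (hG : HypG V G) (c : EnergyWeight) :
    LineHolomorphicOn (fun s => weightedCreation c (G s)) V := by
  obtain ⟨C, hC, h⟩ := hG.exists_uniform
  refine LineHolomorphicOn.of_tendstoUniformlyOn hV (φ := 𝓝[>] (0 : ℝ))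
    (F := fun δ s => weightedCreation c (irCutoff δ (G s))) ?_ ?_
  · rw [Metric.tendstoUniformlyOn_iff]
    intro ε hε
    have ht : Tendsto (fun δ : ℝ => Real.sqrt δ * C) (𝓝[>] 0) (𝓝 0) := by
      have : Tendsto (fun δ : ℝ => Real.sqrt δ * C) (𝓝 0) (𝓝 (Real.sqrt 0 * C)) :=
        (Real.continuous_sqrt.mul continuous_const).tendsto 0
      rw [Real.sqrt_zero, zero_mul] at this
      exact this.mono_left nhdsWithin_le_nhds
    filter_upwards [ht.eventually (gt_mem_nhds hε), Ioc_mem_nhdsGT (zero_lt_one' ℝ)]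
      with δ h1 h2 s hs
    rw [dist_eq_norm]
    exact ((h s hs).2 c |>.2 δ h2.1 h2.2).trans_lt h1
  · filter_upwards [self_mem_nhdsWithin] with δ hδ
    exact lineHolomorphicOn_of_analyticOnNhd (analyticOnNhd_cutoffCreation hG c hδ)

/-- `s ↦ f(s̄)*` is holomorphic along lines if `f` is. -/
theorem LineHolomorphicOn.adjoint_star {X : Type*} [NormedAddCommGroup X] [InnerProductSpace ℂ X]
    [CompleteSpace X] {f : (Fin ν → ℂ) → (X →L[ℂ] X)}
    (hV : ∀ s ∈ V, star s ∈ V) (hf : LineHolomorphicOn f V) :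
    LineHolomorphicOn (fun s => ContinuousLinearMap.adjoint (f (star s))) V := by
  intro s hs v
  have h1 := hf (star s) (hV s hs) (star v)
  have h2 : DifferentiableAt ℂ (fun t : ℂ => f (star s + t • star v)) ((starRingEnd ℂ) 0) := by
    rwa [map_zero]
  have h3 := h2.star_conj
  rw [map_zero, map_zero] at h3
  refine h3.congr_of_eventuallyEq (Eventually.of_forall fun t => ?_)
  change ContinuousLinearMap.adjoint (f (star (s + t • v))) =
    ContinuousLinearMap.adjoint (f (star s + (starRingEnd ℂ) t • star v))
  rw [star_add, star_smul]
  rfl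

/-- `W(s) (1 + H_f)⁻¹` is bounded and analytic on `V`. -/
theorem analyticOnNhd_boundedInteraction (hV : IsOpen V) (hV' : ∀ s ∈ V, star s ∈ V)
    (hG : HypG V G) : AnalyticOnNhd ℂ (boundedInteraction G) V ∧
      ∃ C : ℝ, 0 ≤ C ∧ ∀ s ∈ V, ‖boundedInteraction G s‖ ≤ C := by
  obtain ⟨C, hC, h⟩ := hG.exists_uniform
  have hb : ∀ s ∈ V, ‖boundedInteraction G s‖ ≤ C + C := fun s hs =>
    norm_add_le_of_le' (B := Fock E →L[ℂ] Fock E)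
      ((LinearIsometryEquiv.norm_map _ _).le.trans ((h _ (hV' s hs)).2 _).1) ((h s hs).2 _).1
  refine ⟨?_, C + C, by positivity, hb⟩
  refine osgoodSpace_fin ν (Fock E →L[ℂ] Fock E) _ V (C + C) hV hb ?_
  intro s hs v
  exact ((lineHolomorphicOn_weightedCreation hV hG weightOut).adjoint_star (X := Fock E) hV' s hs v).add
    (lineHolomorphicOn_weightedCreation hV hG weightIn s hs v)

end Analyticity

/-! ### Resolvents -/

section Resolvent

variable {E : Type*} [NormedAddCommGroup E] [InnerProductSpace ℂ E]

theorem IsResolventAt.unique {A : E →ₗ.[ℂ] E} {z : ℂ} {R R' : E →L[ℂ] E} (h : IsResolventAt A z R)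
    (h' : IsResolventAt A z R') : R = R' := by
  ext y
  obtain ⟨hy, e⟩ := h'.1 y
  have h1 : R (z • R' y - A ⟨R' y, hy⟩) = R' y := h.2 ⟨R' y, hy⟩
  rwa [e] at h1

theorem isResolventAt_res {A : E →ₗ.[ℂ] E} {z : ℂ} (h : z ∈ resSet A) :
    IsResolventAt A z (res A z) := by
  have h' : ∃ R, IsResolventAt A z R := h
  rw [res, dif_pos h']
  exact h'.choose_spec

theorem IsResolventAt.res_eq {A : E →ₗ.[ℂ] E} {z : ℂ} {R : E →L[ℂ] E} (h : IsResolventAt A z R) :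
    res A z = R :=
  (isResolventAt_res ⟨R, h⟩).unique h

theorem IsResolventAt.mem {A : E →ₗ.[ℂ] E} {z : ℂ} {R : E →L[ℂ] E} (h : IsResolventAt A z R)
    (y : E) : R y ∈ A.domain := (h.1 y).1

theorem IsResolventAt.apply {A : E →ₗ.[ℂ] E} {z : ℂ} {R : E →L[ℂ] E} (h : IsResolventAt A z R)
    (y : E) (hy : R y ∈ A.domain) : A ⟨R y, hy⟩ = z • R y - y := by
  obtain ⟨_, e⟩ := h.1 y
  exact (sub_eq_of_eq_add (sub_eq_iff_eq_add'.1 e)).symm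

/-- `(z - A)⁻¹ = S (1 - (l - z) S)⁻¹` with `S = (l - A)⁻¹`. -/
theorem IsResolventAt.of_inverse {A : E →ₗ.[ℂ] E} {l z : ℂ} {S U : E →L[ℂ] E}
    (h : IsResolventAt A l S) (h1 : (1 - (l - z) • S) * U = 1) (h2 : U * (1 - (l - z) • S) = 1) :
    IsResolventAt A z (S * U) := by
  have hc : S * U = U * S := by
    have h3 : S * (1 - (l - z) • S) = (1 - (l - z) • S) * S := by
      rw [mul_sub, sub_mul, mul_one, one_mul, mul_smul_comm, smul_mul_assoc]
    calc S * U = U * (1 - (l - z) • S) * S * U := by rw [h2, one_mul]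
      _ = U * ((1 - (l - z) • S) * S) * U := by rw [mul_assoc U]
      _ = U * (S * (1 - (l - z) • S)) * U := by rw [h3]
      _ = U * S * ((1 - (l - z) • S) * U) := by simp only [mul_assoc]
      _ = U * S := by rw [h1, mul_one]
  refine ⟨fun y => ⟨h.mem (U y), ?_⟩, fun x => ?_⟩
  · have e := h.apply (U y) (h.mem (U y))
    have e1 := DFunLike.congr_fun h1 y
    simp only [mul_apply_eq_comp, sub_apply, one_apply_eq_self, smul_apply] at e1
    change z • S (U y) - A ⟨S (U y), h.mem (U y)⟩ = y
    rw [e]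
    conv_rhs => rw [← e1]
    rw [sub_smul]
    abel
  · rw [hc]
    have e1 := DFunLike.congr_fun h2 (x : E)
    change U (S (z • (x : E) - A x)) = x
    have e2 : z • (x : E) - A x = (l • (x : E) - A x) - (l - z) • (x : E) := by
      rw [sub_smul]; abel
    rw [e2, map_sub, map_smul, h.2 x]
    exact e1

theorem IsResolventAt.resolvent_identity {A : E →ₗ.[ℂ] E} {l z : ℂ} {S R : E →L[ℂ] E}
    (h : IsResolventAt A l S) (h' : IsResolventAt A z R) : R - S = (l - z) • (S * R) := by
  ext y
  have e := h'.apply y (h'.mem y)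
  have e2 := h.2 ⟨R y, h'.mem y⟩
  rw [e] at e2
  have e3 : l • R y - (z • R y - y) = (l - z) • R y + y := by rw [sub_smul]; abel
  change S (l • R y - (z • R y - y)) = R y at e2
  rw [e3, map_add, map_smul] at e2
  change R y - S y = (l - z) • S (R y)
  exact sub_eq_of_eq_add e2.symm

theorem IsResolventAt.commute {A : E →ₗ.[ℂ] E} {l z : ℂ} {S R : E →L[ℂ] E}
    (h : IsResolventAt A l S) (h' : IsResolventAt A z R) : S * R = R * S := by
  rcases eq_or_ne l z with rfl | hne
  · rw [h.unique h']
  · have h1 := h.resolvent_identity h'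
    have h2 := h'.resolvent_identity h
    have h3 : (l - z) • (S * R) = (l - z) • (R * S) := by
      rw [← h1, ← neg_sub S R, h2, ← neg_smul, neg_sub]
    exact smul_right_injective _ (sub_ne_zero.2 hne) h3

/-- With `S = (l - A)⁻¹`, the operator `z - A` is invertible if and only if `1 - (l - z) S` is. This
reduces the resolvent of an unbounded operator to inversion in a Banach algebra. -/
theorem mem_resSet_iff {A : E →ₗ.[ℂ] E} {l z : ℂ} {S : E →L[ℂ] E} (h : IsResolventAt A l S) :
    z ∈ resSet A ↔ IsUnit (1 - (l - z) • S) := by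
  constructor
  · rintro ⟨R, h'⟩
    have h1 := h.resolvent_identity h'
    have h2 := h.commute h'
    have key : R - S - (l - z) • (S * R) = 0 := by rw [h1, sub_self]
    refine ⟨⟨1 - (l - z) • S, 1 + (l - z) • R, ?_, ?_⟩, rfl⟩
    · calc (1 - (l - z) • S) * (1 + (l - z) • R)
          = 1 + (l - z) • (R - S - (l - z) • (S * R)) := by
            simp only [sub_mul, mul_add, one_mul, mul_one, smul_mul_assoc, mul_smul_comm, smul_sub]
            abel
        _ = 1 := by rw [key, smul_zero, add_zero]
    · calc (1 + (l - z) • R) * (1 - (l - z) • S)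
          = 1 + (l - z) • (R - S - (l - z) • (S * R)) := by
            simp only [mul_sub, add_mul, one_mul, mul_one, smul_mul_assoc, mul_smul_comm, smul_sub,
              h2, smul_add]
            abel
        _ = 1 := by rw [key, smul_zero, add_zero]
  · intro hu
    exact ⟨_, h.of_inverse (Ring.mul_inverse_cancel _ hu) (Ring.inverse_mul_cancel _ hu)⟩

theorem res_eq_inverse {A : E →ₗ.[ℂ] E} {l : ℂ} {S : E →L[ℂ] E} (h : IsResolventAt A l S) (z : ℂ) :
    res A z = S * Ring.inverse (1 - (l - z) • S) := by
  by_cases hu : IsUnit (1 - (l - z) • S)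
  · exact (h.of_inverse (Ring.mul_inverse_cancel _ hu) (Ring.inverse_mul_cancel _ hu)).res_eq
  · have hz : ¬∃ R, IsResolventAt A z R := fun hR => hu ((mem_resSet_iff h).1 hR)
    rw [Ring.inverse_non_unit _ hu, mul_zero, res, dif_neg hz]

/-- If the resolvent is analytic in the parameter at one fixed spectral point `l`, it is jointly
analytic in the parameter and the spectral point. -/
theorem analyticAt_res_of {M : Type*} [NormedAddCommGroup M] [NormedSpace ℂ M] [CompleteSpace E]
    {T : M → (E →ₗ.[ℂ] E)} {l : ℂ} {s₁ : M} (hl : ∀ᶠ s in 𝓝 s₁, l ∈ resSet (T s))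
    (ha : AnalyticAt ℂ (fun s => res (T s) l) s₁) {z₁ : ℂ} (hz : z₁ ∈ resSet (T s₁)) :
    (∀ᶠ p in 𝓝 (s₁, z₁), p.2 ∈ resSet (T p.1)) ∧
      AnalyticAt ℂ (fun p : M × ℂ => res (T p.1) p.2) (s₁, z₁) := by
  have h1 : AnalyticAt ℂ (fun p : M × ℂ => res (T p.1) l) (s₁, z₁) :=
    AnalyticAt.comp (f := Prod.fst) (g := fun s => res (T s) l) ha analyticAt_fst
  have h2 : AnalyticAt ℂ (fun p : M × ℂ => 1 - (l - p.2) • res (T p.1) l) (s₁, z₁) :=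
    analyticAt_const.sub ((analyticAt_const.sub analyticAt_snd).smul h1)
  have hu : IsUnit (1 - (l - z₁) • res (T s₁) l) :=
    (mem_resSet_iff (isResolventAt_res hl.self_of_nhds)).1 hz
  have hev : ∀ᶠ p : M × ℂ in 𝓝 (s₁, z₁), l ∈ resSet (T p.1) :=
    continuous_fst.continuousAt.eventually (p := fun s => l ∈ resSet (T s)) hl
  constructor
  · have h3 := h2.continuousAt.preimage_mem_nhds (Units.isOpen.mem_nhds hu)
    filter_upwards [hev, h3] with p hp1 hp2
    exact (mem_resSet_iff (isResolventAt_res hp1)).2 hp2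
  · have h4 : AnalyticAt ℂ Ring.inverse (1 - (l - z₁) • res (T s₁) l) := by
      obtain ⟨u, hu⟩ := hu
      rw [← hu]
      exact analyticAt_inverse u
    have h5 := AnalyticAt.comp (f := fun p : M × ℂ => 1 - (l - p.2) • res (T p.1) l) h4 h2
    refine (h1.mul h5).congr ?_
    filter_upwards [hev] with p hp
    exact (res_eq_inverse (isResolventAt_res hp) p.2).symm

theorem analyticAt_res [CompleteSpace E] {A : E →ₗ.[ℂ] E} {z : ℂ} (hz : z ∈ resSet A) :
    AnalyticAt ℂ (res A) z := by
  have h := (analyticAt_res_of (M := ℂ) (T := fun _ => A) (l := z) (s₁ := 0) (z₁ := z)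
    (Eventually.of_forall fun _ => hz) analyticAt_const hz).2
  exact AnalyticAt.comp (f := fun w : ℂ => ((0 : ℂ), w)) (g := fun p : ℂ × ℂ => res A p.2) h
    (AnalyticAt.prod analyticAt_const analyticAt_id)

end Resolvent

/-! ### Riesz projections -/

section Riesz

theorem clm_circleIntegral {X Y : Type*} [NormedAddCommGroup X] [NormedSpace ℂ X] [CompleteSpace X]
    [NormedAddCommGroup Y] [NormedSpace ℂ Y] [CompleteSpace Y] (L : X →L[ℂ] Y) {f : ℂ → X} {c : ℂ}
    {R : ℝ} (hf : CircleIntegrable f c R) : ∮ z in C(c, R), L (f z) = L (∮ z in C(c, R), f z) := by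
  unfold circleIntegral
  rw [← L.intervalIntegral_comp_comm hf.out]
  simp only [map_smul]

variable {E : Type*} [NormedAddCommGroup E] [InnerProductSpace ℂ E] [CompleteSpace E]
  {A : E →ₗ.[ℂ] E} {e : ℂ} {ρ : ℝ}

theorem continuousOn_res (A : E →ₗ.[ℂ] E) : ContinuousOn (res A) (resSet A) :=
  fun _ hz => (analyticAt_res hz).continuousAt.continuousWithinAt

theorem sphere_subset_resSet (hs : ∀ z ∈ Metric.ball e ρ, z ≠ e → z ∈ resSet A) {ε : ℝ} (hε : 0 < ε)
    (hερ : ε < ρ) : Metric.sphere e ε ⊆ resSet A := fun z hz => by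
  refine hs z ?_ ?_
  · rw [Metric.mem_ball, Metric.mem_sphere.1 hz]; exact hερ
  · rintro rfl
    rw [Metric.mem_sphere, dist_self] at hz
    exact hε.ne hz

theorem circleIntegral_res_eq (hs : ∀ z ∈ Metric.ball e ρ, z ≠ e → z ∈ resSet A) {ε ε' : ℝ}
    (hε : 0 < ε) (hle : ε ≤ ε') (hερ : ε' < ρ) :
    ∮ z in C(e, ε'), res A z = ∮ z in C(e, ε), res A z := by
  have hsub : ∀ z ∈ Metric.closedBall e ε' \ Metric.ball e ε, z ∈ resSet A := by
    rintro z ⟨h1, h2⟩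
    refine hs z (lt_of_le_of_lt (Metric.mem_closedBall.1 h1) hερ) ?_
    rintro rfl
    exact h2 (Metric.mem_ball_self hε)
  refine Complex.circleIntegral_eq_of_differentiable_on_annulus_off_countable hε hle
    Set.countable_empty ((continuousOn_res A).mono hsub) fun z hz => ?_
  exact (analyticAt_res (hsub z ⟨Metric.ball_subset_closedBall hz.1.1,
    fun h => hz.1.2 (Metric.ball_subset_closedBall h)⟩)).differentiableAt

theorem rieszProj_eq (hs : ∀ z ∈ Metric.ball e ρ, z ≠ e → z ∈ resSet A) {ε : ℝ} (hε : 0 < ε)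
    (hερ : ε < ρ) :
    rieszProj A e = (2 * Real.pi * Complex.I : ℂ)⁻¹ • ∮ z in C(e, ε), res A z := by
  unfold rieszProj
  refine Tendsto.limUnder_eq (tendsto_const_nhds.congr' ?_)
  filter_upwards [Ioc_mem_nhdsGT hε] with ε' h'
  rw [circleIntegral_res_eq hs h'.1 h'.2 hερ]

theorem circleIntegrable_res (hs : ∀ z ∈ Metric.ball e ρ, z ≠ e → z ∈ resSet A) {ε : ℝ}
    (hε : 0 < ε) (hερ : ε < ρ) : CircleIntegrable (res A) e ε :=
  ContinuousOn.circleIntegrable hε.le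
    ((continuousOn_res A).mono (sphere_subset_resSet hs hε hερ))

/-- Bounded linear maps commute with the contour integral that defines the Riesz projection. -/
theorem clm_rieszProj {Y : Type*} [NormedAddCommGroup Y] [NormedSpace ℂ Y] [CompleteSpace Y]
    (hs : ∀ z ∈ Metric.ball e ρ, z ≠ e → z ∈ resSet A) {ε : ℝ} (hε : 0 < ε) (hερ : ε < ρ)
    (L : (E →L[ℂ] E) →L[ℂ] Y) : L (rieszProj A e) =
      (2 * Real.pi * Complex.I : ℂ)⁻¹ • ∮ z in C(e, ε), L (res A z) := by
  rw [rieszProj_eq hs hε hερ, map_smul, clm_circleIntegral L (circleIntegrable_res hs hε hερ)]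

theorem res_mul_rieszProj (hρ : 0 < ρ) (hs : ∀ z ∈ Metric.ball e ρ, z ≠ e → z ∈ resSet A) {w : ℂ}
    (hw : w ∈ resSet A) : res A w * rieszProj A e = rieszProj A e * res A w := by
  have h1 := clm_rieszProj hs (half_pos hρ) (half_lt_self hρ)
    (ContinuousLinearMap.mul ℂ (E →L[ℂ] E) (res A w))
  have h2 := clm_rieszProj hs (half_pos hρ) (half_lt_self hρ)
    ((ContinuousLinearMap.mul ℂ (E →L[ℂ] E)).flip (res A w))
  simp only [ContinuousLinearMap.mul_apply', ContinuousLinearMap.flip_apply] at h1 h2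
  rw [h1, h2]
  congr 1
  refine circleIntegral.integral_congr (half_pos hρ).le fun z hz => ?_
  exact (isResolventAt_res hw).commute
    (isResolventAt_res (sphere_subset_resSet hs (half_pos hρ) (half_lt_self hρ) hz))

/-- The Cauchy integral of the resolvent over a circle around an isolated point of the spectrum. -/
def resCauchy (A : E →ₗ.[ℂ] E) (e : ℂ) (ε : ℝ) (w : ℂ) : E →L[ℂ] E :=
  (2 * Real.pi * Complex.I : ℂ)⁻¹ • ∮ z in C(e, ε), (z - w)⁻¹ • res A z

theorem differentiableAt_resCauchy (hs : ∀ z ∈ Metric.ball e ρ, z ≠ e → z ∈ resSet A) {ε : ℝ}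
    (hε : 0 < ε) (hερ : ε < ρ) {w : ℂ} (hw : w ∈ Metric.ball e ε) :
    DifferentiableAt ℂ (resCauchy A e ε) w := by
  lift ε to ℝ≥0 using hε.le
  have h := hasFPowerSeriesOn_cauchy_integral (circleIntegrable_res hs hε hερ)
    (NNReal.coe_pos.1 hε)
  have hw' : w ∈ Metric.eball e (ε : ℝ≥0∞) := by
    rw [Metric.mem_eball, edist_dist, ← ENNReal.ofReal_coe_nnreal]
    exact (ENNReal.ofReal_lt_ofReal_iff hε).2 hw
  exact (h.differentiableOn w hw').differentiableAt (Metric.isOpen_eball.mem_nhds hw')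

/-- On the range of `1 - P` the resolvent has no singularity: `(w - A)⁻¹(1 - P)` is a Cauchy
integral. -/
theorem res_mul_one_sub_rieszProj (hs : ∀ z ∈ Metric.ball e ρ, z ≠ e → z ∈ resSet A) {ε : ℝ}
    (hε : 0 < ε) (hερ : ε < ρ) {w : ℂ} (hw : w ∈ Metric.ball e ε) (hwe : w ≠ e) :
    res A w * (1 - rieszProj A e) = resCauchy A e ε w := by
  have hwr : w ∈ resSet A := hs w (Metric.ball_subset_ball hερ.le hw) hwe
  have hsp := sphere_subset_resSet hs hε hερ
  have hzw : ∀ z ∈ Metric.sphere e ε, z - w ≠ 0 := fun z hz h => by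
    rw [sub_eq_zero.1 h, Metric.mem_sphere] at hz
    exact (Metric.mem_ball.1 hw).ne hz
  have hinv : ContinuousOn (fun z => (z - w)⁻¹) (Metric.sphere e ε) :=
    ContinuousOn.inv₀ (by fun_prop) hzw
  have h1 := clm_rieszProj hs hε hερ (ContinuousLinearMap.mul ℂ (E →L[ℂ] E) (res A w))
  simp only [ContinuousLinearMap.mul_apply'] at h1
  have h2 : ∮ z in C(e, ε), res A w * res A z =
      ∮ z in C(e, ε), ((z - w)⁻¹ • res A w - (z - w)⁻¹ • res A z) := by
    refine circleIntegral.integral_congr hε.le fun z hz => ?_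
    have h3 := (isResolventAt_res (hsp hz)).resolvent_identity (isResolventAt_res hwr)
    have h4 := (isResolventAt_res (hsp hz)).commute (isResolventAt_res hwr)
    change res A w * res A z = (z - w)⁻¹ • res A w - (z - w)⁻¹ • res A z
    rw [← smul_sub, h3, smul_smul, inv_mul_cancel₀ (hzw z hz), one_smul, h4]
  rw [circleIntegral.integral_sub (f := fun z => (z - w)⁻¹ • res A w)
    (g := fun z => (z - w)⁻¹ • res A z) ((hinv.smul continuousOn_const).circleIntegrable hε.le)
    ((hinv.smul ((continuousOn_res A).mono hsp)).circleIntegrable hε.le),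
    circleIntegral.integral_smul_const, circleIntegral.integral_sub_inv_of_mem_ball hw] at h2
  rw [mul_sub, mul_one, h1, h2, smul_sub, smul_smul, inv_mul_cancel₀ Complex.two_pi_I_ne_zero,
    one_smul, resCauchy, sub_sub_cancel]

/-- The Riesz projection is idempotent: `(z - A)⁻¹ (1 - P)` extends holomorphically to `e`, so its
contour integral vanishes. -/
theorem rieszProj_mul_self (hρ : 0 < ρ) (hs : ∀ z ∈ Metric.ball e ρ, z ≠ e → z ∈ resSet A) :
    rieszProj A e * rieszProj A e = rieszProj A e := by
  have h1 := clm_rieszProj hs (ε := ρ / 4) (by linarith) (by linarith)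
    ((ContinuousLinearMap.mul ℂ (E →L[ℂ] E)).flip (1 - rieszProj A e))
  simp only [ContinuousLinearMap.mul_apply', ContinuousLinearMap.flip_apply] at h1
  have h2 : ∮ z in C(e, ρ / 4), res A z * (1 - rieszProj A e) =
      ∮ z in C(e, ρ / 4), resCauchy A e (ρ / 2) z := by
    refine circleIntegral.integral_congr (by linarith) fun z hz => ?_
    refine res_mul_one_sub_rieszProj hs (half_pos hρ) (half_lt_self hρ) ?_ ?_
    · rw [Metric.mem_ball, Metric.mem_sphere.1 hz]; linarith
    · rintro rfl
      rw [Metric.mem_sphere, dist_self] at hz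
      linarith
  have hd : ∀ z ∈ Metric.closedBall e (ρ / 4), DifferentiableAt ℂ (resCauchy A e (ρ / 2)) z :=
    fun z hz => differentiableAt_resCauchy hs (half_pos hρ) (half_lt_self hρ)
      (lt_of_le_of_lt (Metric.mem_closedBall.1 hz) (by linarith))
  have h3 : ∮ z in C(e, ρ / 4), resCauchy A e (ρ / 2) z = 0 :=
    Complex.circleIntegral_eq_zero_of_differentiable_on_off_countable (by linarith)
      Set.countable_empty (fun z hz => (hd z hz).continuousAt.continuousWithinAt)
      (fun z hz => hd z (Metric.ball_subset_closedBall hz.1))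
  rw [h2, h3, smul_zero, mul_sub, mul_one, sub_eq_zero] at h1
  exact h1.symm

end Riesz

section RankOne

variable {E : Type*} [NormedAddCommGroup E] [InnerProductSpace ℂ E] [CompleteSpace E]
  {A : E →ₗ.[ℂ] E} {e : ℂ} {ρ : ℝ}

/-- `e` is an isolated point of the spectrum of `A` (or no point of it) whose Riesz projection has
rank one; `ρ` is the radius of a disc without other points of the spectrum. -/
structure IsSimpleAt (A : E →ₗ.[ℂ] E) (e : ℂ) (ρ : ℝ) : Prop where
  pos : 0 < ρ
  isolated : ∀ z ∈ Metric.ball e ρ, z ≠ e → z ∈ resSet A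
  rank : Module.finrank ℂ (LinearMap.range (rieszProj A e).toLinearMap) = 1

theorem res_injective {w : ℂ} (hw : w ∈ resSet A) {x : E} (h : res A w x = 0) : x = 0 := by
  obtain ⟨hx, e⟩ := (isResolventAt_res hw).1 x
  have h0 : (⟨res A w x, hx⟩ : A.domain) = 0 := Subtype.ext h
  rw [h0, LinearPMap.map_zero, sub_zero] at e
  rw [← e, h, smul_zero]

theorem IsSimpleAt.exists_vector (h : IsSimpleAt A e ρ) : ∃ x : E, x ≠ 0 ∧ rieszProj A e x = x ∧
    ∀ y, ∃ c : ℂ, rieszProj A e y = c • x := by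
  obtain ⟨⟨x, hx⟩, hx0, hx1⟩ := finrank_eq_one_iff'.1 h.rank
  refine ⟨x, fun h0 => hx0 (Subtype.ext h0), ?_, fun y => ?_⟩
  · obtain ⟨y, rfl⟩ := hx
    exact DFunLike.congr_fun (rieszProj_mul_self h.pos h.isolated) y
  · obtain ⟨c, hc⟩ := hx1 ⟨rieszProj A e y, y, rfl⟩
    exact ⟨c, (congrArg Subtype.val hc).symm⟩

theorem circleIntegral_sub_inv_eq_zero {c w : ℂ} {ε : ℝ} (hε : 0 ≤ ε)
    (hw : w ∉ Metric.closedBall c ε) : ∮ z in C(c, ε), (z - w)⁻¹ = 0 := by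
  have hd : ∀ z ∈ Metric.closedBall c ε, DifferentiableAt ℂ (fun z => (z - w)⁻¹) z :=
    fun z hz => DifferentiableAt.inv (by fun_prop)
      (sub_ne_zero.2 fun h => hw (h ▸ hz))
  exact Complex.circleIntegral_eq_zero_of_differentiable_on_off_countable hε
    Set.countable_empty (fun z hz => (hd z hz).continuousAt.continuousWithinAt)
    (fun z hz => hd z (Metric.ball_subset_closedBall hz.1))

/-- The resolvent acts on the range of a Riesz projection of rank one as multiplication by
`1/(w - e)`. -/
theorem IsSimpleAt.res_mul (h : IsSimpleAt A e ρ) {w : ℂ} (hw : w ∈ resSet A) :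
    w ≠ e ∧ res A w * rieszProj A e = (w - e)⁻¹ • rieszProj A e := by
  obtain ⟨x, hx0, hPx, hP⟩ := h.exists_vector
  have hc : ∀ w ∈ resSet A, ∃ c : ℂ, c ≠ 0 ∧ res A w x = c • x := by
    intro w hw
    have h1 : res A w x = rieszProj A e (res A w x) := by
      have := DFunLike.congr_fun (res_mul_rieszProj h.pos h.isolated hw) x
      change res A w (rieszProj A e x) = rieszProj A e (res A w x) at this
      rwa [hPx] at this
    obtain ⟨c, hc⟩ := hP (res A w x)
    refine ⟨c, ?_, h1.trans hc⟩
    rintro rfl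
    rw [zero_smul] at hc
    exact hx0 (res_injective hw (h1.trans hc))
  choose! c hc0 hcx using hc
  -- By the resolvent identity `w - 1/c(w)` does not depend on `w`.
  have hlam : ∀ w ∈ resSet A, ∀ l ∈ resSet A, w - (c w)⁻¹ = l - (c l)⁻¹ := by
    intro w hw l hl
    have h1 := DFunLike.congr_fun
      ((isResolventAt_res hl).resolvent_identity (isResolventAt_res hw)) x
    change res A w x - res A l x = (l - w) • res A l (res A w x) at h1
    rw [hcx w hw, map_smul, hcx l hl, smul_smul, smul_smul, ← sub_smul] at h1
    have h2 := smul_left_injective ℂ hx0 h1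
    have hw0 := hc0 w hw
    have hl0 := hc0 l hl
    field_simp
    linear_combination h2
  set lam := w - (c w)⁻¹ with hlamdef
  have hcw : ∀ z ∈ resSet A, z ≠ lam ∧ c z = (z - lam)⁻¹ := by
    intro z hz
    have h1 := hlam w hw z hz
    rw [← hlamdef] at h1
    have h2 : (c z)⁻¹ = z - lam := by rw [h1]; ring
    refine ⟨fun h3 => hc0 z hz ?_, ?_⟩
    · rw [h3, sub_self, inv_eq_zero] at h2
      rw [h3]
      exact h2
    · rw [← h2, inv_inv]
  have hlame : lam = e := by
    by_contra hne
    have hd : 0 < dist lam e := dist_pos.2 hne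
    obtain ⟨ε, hε, hεm⟩ := exists_between (lt_min h.pos hd)
    have hερ : ε < ρ := hεm.trans_le (min_le_left _ _)
    have h1 := clm_rieszProj h.isolated hε hερ (ContinuousLinearMap.apply ℂ E x)
    simp only [ContinuousLinearMap.apply_apply] at h1
    have h2 : ∮ z in C(e, ε), res A z x = ∮ z in C(e, ε), (z - lam)⁻¹ • x := by
      refine circleIntegral.integral_congr hε.le fun z hz => ?_
      have hz' := sphere_subset_resSet h.isolated hε hερ hz
      change res A z x = (z - lam)⁻¹ • x
      rw [hcx z hz', (hcw z hz').2]
    have hnot : lam ∉ Metric.closedBall e ε := fun h3 =>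
      absurd (Metric.mem_closedBall.1 h3) (not_le.2 (hεm.trans_le (min_le_right _ _)))
    rw [h2, circleIntegral.integral_smul_const, circleIntegral_sub_inv_eq_zero hε.le hnot,
      zero_smul, smul_zero, hPx] at h1
    exact hx0 h1
  rw [hlame] at hcw
  refine ⟨(hcw w hw).1, ?_⟩
  ext y
  obtain ⟨a, ha⟩ := hP y
  change res A w (rieszProj A e y) = (w - e)⁻¹ • rieszProj A e y
  rw [ha, map_smul, hcx w hw, (hcw w hw).2, smul_comm]

theorem IsSimpleAt.exists_mem_resSet (h : IsSimpleAt A e ρ) : ∃ w, w ∈ resSet A := by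
  refine ⟨e + (ρ / 2 : ℝ), h.isolated _ ?_ ?_⟩
  · rw [Metric.mem_ball, dist_eq_norm, add_sub_cancel_left, Complex.norm_real, Real.norm_eq_abs,
      abs_of_pos (half_pos h.pos)]
    exact half_lt_self h.pos
  · intro h1
    have h2 := h.pos
    have h3 : ((ρ / 2 : ℝ) : ℂ) = 0 := by simpa using h1
    rw [Complex.ofReal_eq_zero] at h3
    linarith

/-- The range of the Riesz projection consists of eigenvectors. -/
theorem IsSimpleAt.apply_rieszProj (h : IsSimpleAt A e ρ) (y : E) :
    ∃ hy : rieszProj A e y ∈ A.domain, A ⟨rieszProj A e y, hy⟩ = e • rieszProj A e y := by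
  obtain ⟨w, hw⟩ := h.exists_mem_resSet
  obtain ⟨hwe, h1⟩ := h.res_mul hw
  have hR := isResolventAt_res hw
  have h2 : rieszProj A e y = res A w ((w - e) • rieszProj A e y) := by
    have h3 := DFunLike.congr_fun h1 y
    change res A w (rieszProj A e y) = (w - e)⁻¹ • rieszProj A e y at h3
    rw [map_smul, h3, smul_smul, mul_inv_cancel₀ (sub_ne_zero.2 hwe), one_smul]
  have h3 := hR.mem ((w - e) • rieszProj A e y)
  have h4 := hR.apply _ h3
  refine ⟨h2 ▸ h3, ?_⟩
  have h5 : (⟨rieszProj A e y, h2 ▸ h3⟩ : A.domain) =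
      ⟨res A w ((w - e) • rieszProj A e y), h3⟩ := Subtype.ext h2
  rw [h5, h4, ← h2, sub_smul]
  abel

theorem IsSimpleAt.rieszProj_apply (h : IsSimpleAt A e ρ) (x : A.domain) :
    rieszProj A e (A x) = e • rieszProj A e x := by
  obtain ⟨w, hw⟩ := h.exists_mem_resSet
  obtain ⟨hwe, h1⟩ := h.res_mul hw
  have h2 := (isResolventAt_res hw).2 x
  have h3 := DFunLike.congr_fun (res_mul_rieszProj h.pos h.isolated hw)
    (w • (x : E) - A x)
  change res A w (rieszProj A e (w • (x : E) - A x)) =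
    rieszProj A e (res A w (w • (x : E) - A x)) at h3
  have h4 := DFunLike.congr_fun h1 (w • (x : E) - A x)
  change res A w (rieszProj A e (w • (x : E) - A x)) =
    (w - e)⁻¹ • rieszProj A e (w • (x : E) - A x) at h4
  rw [h2, h4, inv_smul_eq_iff₀ (sub_ne_zero.2 hwe), map_sub, map_smul, sub_smul] at h3
  exact sub_right_injective h3

theorem IsSimpleAt.rieszProj_ne_zero (h : IsSimpleAt A e ρ) : rieszProj A e ≠ 0 := by
  obtain ⟨x, hx0, hPx, -⟩ := h.exists_vector
  intro h0
  rw [h0] at hPx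
  exact hx0 hPx.symm

/-- The Riesz projection as an integral over a circle that surrounds `e`, not necessarily centred
at `e`. -/
theorem IsSimpleAt.rieszProj_eq_circleIntegral (h : IsSimpleAt A e ρ) {c : ℂ} {ε : ℝ}
    (he : e ∈ Metric.ball c ε) (hc : ∀ z ∈ Metric.closedBall c ε, z ≠ e → z ∈ resSet A) :
    rieszProj A e = (2 * Real.pi * Complex.I : ℂ)⁻¹ • ∮ z in C(c, ε), res A z := by
  have hε : 0 < ε := dist_nonneg.trans_lt he
  -- The regular part of the resolvent.
  set f : ℂ → (E →L[ℂ] E) := Function.update (fun w => res A w * (1 - rieszProj A e)) e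
    (resCauchy A e (ρ / 2) e) with hf
  have hf1 : ∀ z, z ≠ e → f z = res A z * (1 - rieszProj A e) := fun z hz =>
    Function.update_of_ne hz _ _
  have hd : ∀ z ∈ Metric.closedBall c ε, DifferentiableAt ℂ f z := by
    intro z hz
    rcases eq_or_ne z e with rfl | hze
    · refine (differentiableAt_resCauchy h.isolated (half_pos h.pos) (half_lt_self h.pos)
        (Metric.mem_ball_self (half_pos h.pos))).congr_of_eventuallyEq ?_
      filter_upwards [Metric.ball_mem_nhds z (half_pos h.pos)] with w hw
      rcases eq_or_ne w z with rfl | hwz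
      · exact Function.update_self _ _ _
      · rw [hf1 w hwz]
        exact res_mul_one_sub_rieszProj h.isolated (half_pos h.pos) (half_lt_self h.pos) hw hwz
    · have h1 : DifferentiableAt ℂ (fun w => res A w * (1 - rieszProj A e)) z :=
        (analyticAt_res (hc z hz hze)).differentiableAt.mul (differentiableAt_const _)
      refine h1.congr_of_eventuallyEq ?_
      filter_upwards [isOpen_ne.mem_nhds hze] with w hw
      exact hf1 w hw
  have h0 : ∮ z in C(c, ε), f z = 0 :=
    Complex.circleIntegral_eq_zero_of_differentiable_on_off_countable hε.le
      Set.countable_empty (fun z hz => (hd z hz).continuousAt.continuousWithinAt)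
      (fun z hz => hd z (Metric.ball_subset_closedBall hz.1))
  have hne : ∀ z ∈ Metric.sphere c ε, z ≠ e := fun z hz h1 => by
    rw [h1, Metric.mem_sphere] at hz
    exact (Metric.mem_ball.1 he).ne hz
  have h2 : ∮ z in C(c, ε), res A z = ∮ z in C(c, ε), (f z + (z - e)⁻¹ • rieszProj A e) := by
    refine circleIntegral.integral_congr hε.le fun z hz => ?_
    have hzr := hc z (Metric.sphere_subset_closedBall hz) (hne z hz)
    change res A z = f z + (z - e)⁻¹ • rieszProj A e
    rw [hf1 z (hne z hz), ← (h.res_mul hzr).2, mul_sub, mul_one, sub_add_cancel]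
  have hinv : ContinuousOn (fun z => (z - e)⁻¹) (Metric.sphere c ε) :=
    ContinuousOn.inv₀ (by fun_prop) fun z hz => sub_ne_zero.2 (hne z hz)
  rw [circleIntegral.integral_add (f := f) (g := fun z => (z - e)⁻¹ • rieszProj A e)
    (ContinuousOn.circleIntegrable hε.le fun z hz =>
      (hd z (Metric.sphere_subset_closedBall hz)).continuousAt.continuousWithinAt)
    ((hinv.smul continuousOn_const).circleIntegrable hε.le), h0, zero_add,
    circleIntegral.integral_smul_const, circleIntegral.integral_sub_inv_of_mem_ball he] at h2
  rw [h2, smul_smul, inv_mul_cancel₀ Complex.two_pi_I_ne_zero, one_smul]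

end RankOne

/-! ### Analytic dependence of the eigenvalue and of the eigenprojection -/

section RieszAnalytic

variable {E : Type*} [NormedAddCommGroup E] [InnerProductSpace ℂ E] [CompleteSpace E]
  {ν : ℕ} {T : (Fin ν → ℂ) → (E →ₗ.[ℂ] E)} {s₁ : Fin ν → ℂ}

open Classical in
/-- The resolvent of `A` as a continuous function on a circle in the resolvent set. -/
def resOnCircle (A : E →ₗ.[ℂ] E) (c : ℂ) (ε : ℝ) :
    BoundedContinuousFunction (Metric.sphere c ε) (E →L[ℂ] E) :=
  if h : Metric.sphere c ε ⊆ resSet A then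
    BoundedContinuousFunction.mkOfCompact ⟨fun z => res A z,
      continuousOn_iff_continuous_restrict.1 ((continuousOn_res A).mono h)⟩
  else 0

theorem resOnCircle_apply {A : E →ₗ.[ℂ] E} {c : ℂ} {ε : ℝ} (h : Metric.sphere c ε ⊆ resSet A)
    (z : Metric.sphere c ε) : resOnCircle A c ε z = res A z := by
  rw [resOnCircle, dif_pos h]
  rfl

/-- Contour integrals of the resolvent depend analytically on the operator. -/
theorem analyticAt_circleIntegral_res {l : ℂ} (hl : ∀ᶠ s in 𝓝 s₁, l ∈ resSet (T s))
    (ha : AnalyticAt ℂ (fun s => res (T s) l) s₁) {c : ℂ} {ε : ℝ} (hε : 0 ≤ ε)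
    (hc : Metric.sphere c ε ⊆ resSet (T s₁)) :
    (∀ᶠ s in 𝓝 s₁, Metric.sphere c ε ⊆ resSet (T s)) ∧
    AnalyticAt ℂ (fun s => (2 * Real.pi * Complex.I : ℂ)⁻¹ • ∮ z in C(c, ε), res (T s) z) s₁ := by
  have hcpt : IsCompact (Metric.sphere c ε) := isCompact_sphere c ε
  obtain ⟨C, hC⟩ := hcpt.exists_bound_of_continuousOn ((continuousOn_res (T s₁)).mono hc)
  have hev : ∀ᶠ s in 𝓝 s₁, ∀ z ∈ Metric.sphere c ε, z ∈ resSet (T s) ∧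
      AnalyticAt ℂ (fun p : (Fin ν → ℂ) × ℂ => res (T p.1) p.2) (s, z) ∧
      ‖res (T s) z‖ < C + 1 := by
    refine hcpt.eventually_forall_of_forall_eventually fun z hz => ?_
    obtain ⟨h1, h2⟩ := analyticAt_res_of hl ha (hc hz)
    have h3 : ∀ᶠ p : (Fin ν → ℂ) × ℂ in 𝓝 (s₁, z), ‖res (T p.1) p.2‖ < C + 1 :=
      h2.continuousAt.norm.eventually (gt_mem_nhds (lt_of_le_of_lt (hC z hz) (lt_add_one C)))
    filter_upwards [h1, h2.eventually_analyticAt, h3] with p h1 h2 h3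
    exact ⟨h1, h2, h3⟩
  obtain ⟨W, hW, hWo, hsW⟩ := eventually_nhds_iff.1 hev
  refine ⟨hev.mono fun s hs z hz => (hs z hz).1, ?_⟩
  have hsub : ∀ s ∈ W, Metric.sphere c ε ⊆ resSet (T s) := fun s hs z hz => (hW s hs z hz).1
  have hC0 : 0 ≤ |C| + 1 := by positivity
  have hF : AnalyticOnNhd ℂ (fun s => resOnCircle (T s) c ε) W := by
    have hb : ∀ s ∈ W, ‖resOnCircle (T s) c ε‖ ≤ |C| + 1 := fun s hs => by
      refine (BoundedContinuousFunction.norm_le hC0).2 fun z => ?_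
      rw [resOnCircle_apply (hsub s hs)]
      exact (hW s hs z z.2).2.2.le.trans (by linarith [le_abs_self C])
    refine osgoodSpace_fin ν _ _ W _ hWo hb ?_
    refine LineHolomorphicOn.of_norming hWo hb
      (fun z : Metric.sphere c ε => BoundedContinuousFunction.evalCLM ℂ z)
      (fun z g => g.norm_coe_le_norm z)
      (fun g a ha h => (BoundedContinuousFunction.norm_le ha).2 h) fun z => ?_
    have h1 : AnalyticOnNhd ℂ (fun s => res (T s) z) W := fun s hs =>
      AnalyticAt.comp (f := fun s => (s, (z : ℂ)))
        (g := fun p : (Fin ν → ℂ) × ℂ => res (T p.1) p.2) (hW s hs z z.2).2.1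
        (AnalyticAt.prod analyticAt_id analyticAt_const)
    refine lineHolomorphicOn_of_analyticOnNhd fun s hs => (h1 s hs).congr ?_
    filter_upwards [hWo.mem_nhds hs] with s' hs'
    exact (resOnCircle_apply (hsub s' hs') z).symm
  have hK := clm_comp_analyticAt (circleOperator (E →L[ℂ] E) (c := c) hε (fun _ => 1)
    continuousOn_const (C := 1) (fun z _ => by simp)) (hF s₁ hsW)
  refine hK.congr ?_
  filter_upwards [hWo.mem_nhds hsW] with s hs
  rw [circleOperator_apply hε _ _ _ _ (res (T s))
    (resOnCircle_apply (hsub s hs))]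
  simp only [one_smul]

variable {E₀ : ℂ} {r : ℝ} {e : (Fin ν → ℂ) → ℂ}

theorem isSimpleAt_of_spec {A : E →ₗ.[ℂ] E} {e : ℂ} (h : spec A ∩ Metric.ball E₀ r = {e})
    (hr : Module.finrank ℂ (LinearMap.range (rieszProj A e).toLinearMap) = 1) :
    IsSimpleAt A e (r - dist e E₀) := by
  have he : e ∈ spec A ∩ Metric.ball E₀ r := h ▸ rfl
  refine ⟨sub_pos.2 he.2, fun z hz hze => ?_, hr⟩
  by_contra hn
  have h1 : z ∈ spec A ∩ Metric.ball E₀ r := by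
    refine ⟨hn, ?_⟩
    have := dist_triangle z e E₀
    rw [Metric.mem_ball] at hz ⊢
    linarith
  rw [h] at h1
  exact hze h1

/-- The eigenvalue and its Riesz projection depend analytically on the parameter. -/
theorem analyticAt_rieszProj {l : ℂ} (hl : ∀ᶠ s in 𝓝 s₁, l ∈ resSet (T s))
    (ha : AnalyticAt ℂ (fun s => res (T s) l) s₁)
    (hD : ∀ᶠ s in 𝓝 s₁, spec (T s) ∩ Metric.ball E₀ r = {e s} ∧
      Module.finrank ℂ (LinearMap.range (rieszProj (T s) (e s)).toLinearMap) = 1) :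
    AnalyticAt ℂ (fun s => rieszProj (T s) (e s)) s₁ ∧ AnalyticAt ℂ e s₁ := by
  obtain ⟨h1, h1r⟩ := hD.self_of_nhds
  have hsimp := isSimpleAt_of_spec h1 h1r
  set ρ := r - dist (e s₁) E₀ with hρ
  have hε : 0 < ρ / 2 := half_pos hsimp.pos
  have hερ : ρ / 2 < ρ := half_lt_self hsimp.pos
  have hsp := sphere_subset_resSet hsimp.isolated hε hερ
  obtain ⟨hev, han⟩ := analyticAt_circleIntegral_res hl ha hε.le hsp
  set P₁ := fun s => (2 * Real.pi * Complex.I : ℂ)⁻¹ • ∮ z in C(e s₁, ρ / 2), res (T s) z with hP₁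
  have hP₁s : P₁ s₁ = rieszProj (T s₁) (e s₁) := (rieszProj_eq hsimp.isolated hε hερ).symm
  have hne : ∀ᶠ s in 𝓝 s₁, P₁ s ≠ 0 :=
    han.continuousAt.eventually_ne (by rw [hP₁s]; exact hsimp.rieszProj_ne_zero)
  have hball : ∀ z ∈ Metric.closedBall (e s₁) (ρ / 2), z ∈ Metric.ball E₀ r := fun z hz => by
    have := dist_triangle z (e s₁) E₀
    rw [Metric.mem_closedBall] at hz
    rw [Metric.mem_ball]
    linarith
  have heq : ∀ᶠ s in 𝓝 s₁, P₁ s = rieszProj (T s) (e s) := by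
    filter_upwards [hev, hne, hD] with s h2 h3 h4
    have hres : ∀ z ∈ Metric.closedBall (e s₁) (ρ / 2), z ≠ e s → z ∈ resSet (T s) := by
      intro z hz hze
      by_contra hn
      have h5 : z ∈ spec (T s) ∩ Metric.ball E₀ r := ⟨hn, hball z hz⟩
      rw [h4.1] at h5
      exact hze h5
    by_cases hin : e s ∈ Metric.ball (e s₁) (ρ / 2)
    · exact ((isSimpleAt_of_spec h4.1 h4.2).rieszProj_eq_circleIntegral hin hres).symm
    · -- Otherwise the disc contains no point of the spectrum and the integral vanishes.
      exfalso
      have hes : e s ∈ spec (T s) :=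
        (show e s ∈ spec (T s) ∩ Metric.ball E₀ r from h4.1 ▸ rfl).1
      have hnc : e s ∉ Metric.closedBall (e s₁) (ρ / 2) := fun h5 => by
        rcases (Metric.mem_closedBall.1 h5).lt_or_eq with h6 | h6
        · exact hin h6
        · exact hes (h2 h6)
      have hd : ∀ z ∈ Metric.closedBall (e s₁) (ρ / 2), DifferentiableAt ℂ (res (T s)) z :=
        fun z hz => (analyticAt_res (hres z hz fun h => hnc (h ▸ hz))).differentiableAt
      apply h3
      rw [hP₁]
      simp only
      rw [Complex.circleIntegral_eq_zero_of_differentiable_on_off_countable hε.le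
        Set.countable_empty (fun z hz => (hd z hz).continuousAt.continuousWithinAt)
        (fun z hz => hd z (Metric.ball_subset_closedBall hz.1)), smul_zero]
  refine ⟨han.congr heq, ?_⟩
  obtain ⟨x, hx0, hPx, -⟩ := hsimp.exists_vector
  -- `⟨x, (l - T(s))⁻¹ P(s) x⟩ = ⟨x, P(s) x⟩ / (l - e(s))`.
  have hP : AnalyticAt ℂ (fun s => rieszProj (T s) (e s)) s₁ := han.congr heq
  let L : (E →L[ℂ] E) →L[ℂ] ℂ := (innerSL ℂ x).comp (ContinuousLinearMap.apply ℂ E x)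
  have hL1 : AnalyticAt ℂ (fun s => L (rieszProj (T s) (e s))) s₁ := (L.analyticAt _).comp hP
  have hL2 : AnalyticAt ℂ (fun s => L (res (T s) l * rieszProj (T s) (e s))) s₁ :=
    (L.analyticAt _).comp (ha.mul hP)
  have hL0 : L (rieszProj (T s₁) (e s₁)) ≠ 0 := by
    change inner ℂ x (rieszProj (T s₁) (e s₁) x) ≠ 0
    rw [hPx]
    exact inner_self_ne_zero.2 hx0
  have hform : ∀ᶠ s in 𝓝 s₁, L (res (T s) l * rieszProj (T s) (e s)) =
      (l - e s)⁻¹ * L (rieszProj (T s) (e s)) ∧ l - e s ≠ 0 := by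
    filter_upwards [hl, hD] with s h2 h4
    obtain ⟨h5, h6⟩ := (isSimpleAt_of_spec h4.1 h4.2).res_mul h2
    rw [h6, map_smul, smul_eq_mul]
    exact ⟨rfl, sub_ne_zero.2 h5⟩
  have hL20 : L (res (T s₁) l * rieszProj (T s₁) (e s₁)) ≠ 0 := by
    obtain ⟨h5, h6⟩ := hform.self_of_nhds
    rw [h5]
    exact mul_ne_zero (inv_ne_zero h6) hL0
  refine (analyticAt_const.sub (hL1.div hL2 hL20) :
    AnalyticAt ℂ (fun s => l - L (rieszProj (T s) (e s)) /
      L (res (T s) l * rieszProj (T s) (e s))) s₁).congr ?_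
  filter_upwards [hform, hL1.continuousAt.eventually_ne hL0] with s h5 h6
  change l - L (rieszProj (T s) (e s)) / L (res (T s) l * rieszProj (T s) (e s)) = e s
  rw [h5.1]
  have h7 := h5.2
  field_simp
  ring

end RieszAnalytic

/-! ### The reduced resolvent -/

section InverseIn

variable {E : Type*} [NormedAddCommGroup E] [InnerProductSpace ℂ E]

theorem ker_domRestrict_of_injOn {A : E →ₗ.[ℂ] E} {Y : Submodule ℂ E}
    (h : ∀ x : A.domain, (x : E) ∈ Y → A x = 0 → (x : E) = 0) :
    LinearMap.ker (A.domRestrict Y).toFun = ⊥ := by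
  rw [LinearMap.ker_eq_bot']
  intro x hx
  have hxd : (x : E) ∈ A.domain := x.2.2
  have h1 : A.domRestrict Y x = A ⟨x, hxd⟩ := LinearPMap.domRestrict_apply rfl
  refine Subtype.ext (h ⟨x, hxd⟩ x.2.1 ?_)
  rw [← h1]
  exact hx

theorem injOn_of_bddInvertibleIn {A : E →ₗ.[ℂ] E} {Y : Submodule ℂ E} (h : BddInvertibleIn A Y)
    (x : A.domain) (hx : (x : E) ∈ Y) (h0 : A x = 0) : (x : E) = 0 := by
  obtain ⟨C, hC⟩ := h.2.2
  have := hC x hx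
  rw [h0, norm_zero, mul_zero] at this
  exact norm_le_zero_iff.1 this

/-- The values of the inverse in a subspace. -/
theorem inverseIn_mem_graph {A : E →ₗ.[ℂ] E} {Y : Submodule ℂ E}
    (h : ∀ x : A.domain, (x : E) ∈ Y → A x = 0 → (x : E) = 0) (x : A.domain) (hx : (x : E) ∈ Y) :
    (A x, (x : E)) ∈ (inverseIn A Y).graph := by
  have hk := ker_domRestrict_of_injOn h
  have h1 : A.domRestrict Y ⟨x, hx, x.2⟩ = A x := LinearPMap.domRestrict_apply rfl
  have hd : A x ∈ (inverseIn A Y).domain := by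
    rw [inverseIn, LinearPMap.inverse_domain]
    exact ⟨⟨x, hx, x.2⟩, h1⟩
  rw [LinearPMap.mem_graph_iff]
  refine ⟨⟨A x, hd⟩, rfl, ?_⟩
  exact LinearPMap.inverse_apply_eq (f := A.domRestrict Y) hk
    (x := ⟨x, hx, x.2⟩) h1

end InverseIn

section ReducedResolvent

variable {E : Type*} [NormedAddCommGroup E] [InnerProductSpace ℂ E] {A : E →ₗ.[ℂ] E}
  {P : E →L[ℂ] E} {w l : ℂ} {S R : E →L[ℂ] E}

/-- `R` is the reduced resolvent `(A - w)⁻¹ (1 - P)`, extended by zero to the range of `P`. -/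
structure IsReducedResolvent (A : E →ₗ.[ℂ] E) (P : E →L[ℂ] E) (w : ℂ) (R : E →L[ℂ] E) : Prop where
  graph : ∀ x, (R x, w • R x + (x - P x)) ∈ A.graph
  proj_mul : ∀ x, P (R x) = 0
  mul_proj : ∀ x, R (P x) = 0
  left : ∀ x : A.domain, R (A x - w • (x : E)) = x - P x

theorem apply_eq_of_mem_graph {A : E →ₗ.[ℂ] E} {x y : E} (h : (x, y) ∈ A.graph) (hx : x ∈ A.domain) :
    A ⟨x, hx⟩ = y := by
  obtain ⟨x', h1, h2⟩ := (LinearPMap.mem_graph_iff A).1 h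
  have h1' : (x' : E) = x := h1
  have h3 : x' = ⟨x, hx⟩ := Subtype.ext h1'
  rw [← h3]
  exact h2

theorem IsReducedResolvent.unique {R' : E →L[ℂ] E} (h : IsReducedResolvent A P w R)
    (h' : IsReducedResolvent A P w R') : R = R' := by
  ext x
  have hg := h'.graph x
  have hd := LinearPMap.mem_domain_of_mem_graph hg
  have h1 := h.left ⟨R' x, hd⟩
  rw [apply_eq_of_mem_graph hg hd] at h1
  change R (w • R' x + (x - P x) - w • R' x) = R' x - P (R' x) at h1
  rwa [add_sub_cancel_left, h'.proj_mul, sub_zero, map_sub, h.mul_proj, sub_zero] at h1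

/-- A bounded inverse of `A - w` in the range of `1 - P` gives a reduced resolvent. -/
theorem exists_reducedResolvent (hP : ∀ x, P (P x) = P x)
    (hPA : ∀ x : A.domain, ∃ c : ℂ, P (A x) = c • P x ∧ (P x, c • P x) ∈ A.graph)
    {c : ℝ} (h : BddInvertibleIn (subScalar A w) (LinearMap.range (1 - P).toLinearMap))
    (hc : ∀ x, ∃ hx : (1 - P) x ∈
        (inverseIn (subScalar A w) (LinearMap.range (1 - P).toLinearMap)).domain,
        ‖inverseIn (subScalar A w) (LinearMap.range (1 - P).toLinearMap) ⟨(1 - P) x, hx⟩‖ ≤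
          c * ‖x‖) : ∃ R, IsReducedResolvent A P w R ∧ ∀ x, ‖R x‖ ≤ c * ‖x‖ := by
  set Y := LinearMap.range (1 - P).toLinearMap with hY
  have hYm : ∀ x, x ∈ Y ↔ P x = 0 := by
    intro x
    constructor
    · rintro ⟨y, rfl⟩
      change P (y - P y) = 0
      rw [map_sub, hP, sub_self]
    · intro h0
      refine ⟨x, ?_⟩
      change x - P x = x
      rw [h0, sub_zero]
  have hinj := injOn_of_bddInvertibleIn h
  have hu : ∀ y, P y = 0 → ∃! x : A.domain, P (x : E) = 0 ∧ A x - w • (x : E) = y := fun y hy => by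
    obtain ⟨x, ⟨hx1, hx2⟩, hx3⟩ := h.2.1 y ((hYm y).2 hy)
    exact ⟨x, ⟨(hYm _).1 hx1, hx2⟩, fun x' hx' => hx3 x' ⟨(hYm _).2 hx'.1, hx'.2⟩⟩
  have hP1 : ∀ x, P (x - P x) = 0 := fun x => by rw [map_sub, hP, sub_self]
  choose f hf hf' using fun x => hu (x - P x) (hP1 x)
  have hb : ∀ x, ‖(f x : E)‖ ≤ c * ‖x‖ := fun x => by
    obtain ⟨hx, hle⟩ := hc x
    have h1 := inverseIn_mem_graph hinj (f x) ((hYm _).2 (hf x).1)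
    have h2 : subScalar A w (f x) = (1 - P) x := (hf x).2
    rw [h2] at h1
    rw [apply_eq_of_mem_graph h1 hx] at hle
    exact hle
  let R : E →L[ℂ] E := clmOfBound (fun x => (f x : E))
    (fun a b => by
      have h1 : f a + f b = f (a + b) := by
        refine hf' (a + b) _ ⟨?_, ?_⟩
        · change P ((f a : E) + f b) = 0
          rw [map_add, (hf a).1, (hf b).1, add_zero]
        · change A (f a + f b) - w • ((f a : E) + f b) = _
          have ha := (hf a).2
          have hb := (hf b).2
          rw [LinearPMap.map_add, smul_add, add_sub_add_comm, ha, hb, map_add]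
          abel
      exact congrArg Subtype.val h1.symm)
    (fun t a => by
      have h1 : t • f a = f (t • a) := by
        refine hf' (t • a) _ ⟨?_, ?_⟩
        · change P (t • (f a : E)) = 0
          rw [map_smul, (hf a).1, smul_zero]
        · change A (t • f a) - w • (t • (f a : E)) = _
          have ha := (hf a).2
          rw [LinearPMap.map_smul, smul_comm w, ← smul_sub, ha, map_smul, smul_sub]
      exact congrArg Subtype.val h1.symm) c hb
  have hR : ∀ x, R x = f x := fun _ => rfl
  refine ⟨R, ⟨fun x => ?_, fun x => ?_, fun x => ?_, fun x => ?_⟩, hb⟩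
  · rw [LinearPMap.mem_graph_iff]
    refine ⟨f x, rfl, ?_⟩
    have h1 := (hf x).2
    change A (f x) = w • R x + (x - P x)
    rw [hR, ← h1, add_sub_cancel]
  · rw [hR]; exact (hf x).1
  · rw [hR]
    have h1 := hf' (P x) 0 ⟨map_zero P, by
      rw [LinearPMap.map_zero, hP, sub_self]; simp⟩
    rw [← h1]
    rfl
  · rw [hR]
    obtain ⟨c, hc1, hc2⟩ := hPA x
    have hd := LinearPMap.mem_domain_of_mem_graph hc2
    have h1 := hf' (A x - w • (x : E)) (x - ⟨P x, hd⟩) ⟨hP1 x, ?_⟩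
    · rw [← h1]; rfl
    · rw [LinearPMap.map_sub, apply_eq_of_mem_graph hc2 hd]
      change A x - c • P x - w • ((x : E) - P x) = _
      rw [map_sub, hc1, map_smul, smul_sub]
      abel

/-- The resolvent identity for the reduced resolvent. -/
theorem IsReducedResolvent.key (hR : IsReducedResolvent A P w R) (hS : IsResolventAt A l S)
    (x : E) : R x = (l - w) • S (R x) - S (x - P x) := by
  have hg := hR.graph x
  have hd := LinearPMap.mem_domain_of_mem_graph hg
  have h1 := hS.2 ⟨R x, hd⟩
  rw [apply_eq_of_mem_graph hg hd] at h1
  change S (l • R x - (w • R x + (x - P x))) = R x at h1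
  rw [← sub_sub, ← sub_smul, map_sub, map_smul] at h1
  exact h1.symm

theorem IsReducedResolvent.commute (hR : IsReducedResolvent A P w R) (hS : IsResolventAt A l S)
    (hSP : ∀ x, S (P x) = P (S x)) (x : E) : S (R x) = R (S x) := by
  have hd := hS.mem (R x)
  have h1 := hR.left ⟨S (R x), hd⟩
  rw [hS.apply (R x) hd] at h1
  change R (l • S (R x) - R x - w • S (R x)) = S (R x) - P (S (R x)) at h1
  rw [← hSP, hR.proj_mul, map_zero, sub_zero, sub_right_comm, ← sub_smul] at h1
  have h2 : (l - w) • S (R x) - R x = S (x - P x) := by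
    conv_lhs => rw [hR.key hS x]
    have h3 := hR.key hS x
    rw [← h3]
    rw [sub_eq_iff_eq_add, ← sub_eq_iff_eq_add']
    exact h3.symm
  rw [h2, map_sub, hSP, map_sub, hR.mul_proj, sub_zero] at h1
  exact h1.symm

/-- `1 - (l - w) S (1 - P)` is invertible, with inverse `1 - (l - w) R`, and determines `R`. -/
theorem IsReducedResolvent.isUnit (hR : IsReducedResolvent A P w R) (hS : IsResolventAt A l S)
    (hSP : ∀ x, S (P x) = P (S x)) : IsUnit (1 - (l - w) • (S * (1 - P))) ∧
      R = -(Ring.inverse (1 - (l - w) • (S * (1 - P))) * (S * (1 - P))) := by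
  have hk : R = (l - w) • (S * R) - S * (1 - P) := by
    ext x
    exact hR.key hS x
  have hc : S * R = R * S := by
    ext x
    exact hR.commute hS hSP x
  have hPR : P * R = 0 := by ext x; exact hR.proj_mul x
  have hRP : R * P = 0 := by ext x; exact hR.mul_proj x
  have hSR : S * (1 - P) * R = S * R := by rw [mul_assoc, sub_mul, one_mul, hPR, sub_zero]
  have hRS : R * (S * (1 - P)) = S * R := by
    rw [← mul_assoc, ← hc, mul_assoc, mul_sub, mul_one, hRP, sub_zero]
  set B := S * (1 - P) with hB
  have h1 : (1 - (l - w) • B) * (1 - (l - w) • R) = 1 := by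
    calc (1 - (l - w) • B) * (1 - (l - w) • R)
        = 1 + (l - w) • ((l - w) • (B * R) - B - R) := by
          simp only [mul_sub, sub_mul, one_mul, mul_one, smul_mul_assoc, mul_smul_comm, smul_sub]
          abel
      _ = 1 := by rw [hSR, ← hk, sub_self, smul_zero, add_zero]
  have h2 : (1 - (l - w) • R) * (1 - (l - w) • B) = 1 := by
    calc (1 - (l - w) • R) * (1 - (l - w) • B)
        = 1 + (l - w) • ((l - w) • (R * B) - B - R) := by
          simp only [mul_sub, sub_mul, one_mul, mul_one, smul_mul_assoc, mul_smul_comm, smul_sub]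
          abel
      _ = 1 := by rw [hRS, ← hk, sub_self, smul_zero, add_zero]
  refine ⟨⟨⟨_, _, h1, h2⟩, rfl⟩, ?_⟩
  have h3 : Ring.inverse (1 - (l - w) • B) = 1 - (l - w) • R :=
    Ring.inverse_unit ⟨_, _, h1, h2⟩
  rw [h3, sub_mul, one_mul, smul_mul_assoc, hRS, neg_sub]
  exact hk

end ReducedResolvent

/-! ### The atomic operator at a point of the parameter domain -/

section AtomicPoint

variable {E : Type*} [NormedAddCommGroup E] [InnerProductSpace ℂ E] [CompleteSpace E]
  {A : E →ₗ.[ℂ] E} {P : E →L[ℂ] E} {e z : ℂ} {C : ℝ}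

open Classical in
/-- The reduced resolvent `(A - w)⁻¹ (1 - P)` if it exists, and `0` otherwise. -/
def redRes (A : E →ₗ.[ℂ] E) (P : E →L[ℂ] E) (w : ℂ) : E →L[ℂ] E :=
  if h : ∃ R, IsReducedResolvent A P w R then h.choose else 0

/-- What the construction uses of the atomic operator `A`, its eigenprojection `P` and its
eigenvalue `e` at a point with spectral parameter `z`. -/
structure IsAtomicPoint (A : E →ₗ.[ℂ] E) (P : E →L[ℂ] E) (e z : ℂ) (C : ℝ) : Prop where
  dense : Dense (A.domain : Set E)
  proj : ∀ x, P (P x) = P x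
  ne_zero : P ≠ 0
  rankOne : ∃ x, ∀ y, ∃ c : ℂ, P y = c • x
  graph : ∀ x, (P x, e • P x) ∈ A.graph
  commute : ∀ x : A.domain, P (A x) = e • P x
  close : ‖e - z‖ < 1 / 2
  resolvent : ∃ l, l ∈ resSet A
  nonneg : 0 ≤ C
  reduced : ∀ q : ℝ≥0, ∃ R, IsReducedResolvent A P (z - (q : ℝ)) R ∧
    ∀ x, ‖R x‖ ≤ C / (q + 1) * ‖x‖

theorem IsAtomicPoint.res_commute (h : IsAtomicPoint A P e z C) {l : ℂ} (hl : l ∈ resSet A) (x : E) :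
    res A l (P x) = P (res A l x) := by
  have hS := isResolventAt_res hl
  have h1 : ∀ x, (l - e) • res A l (P x) = P x := fun x => by
    have hd := LinearPMap.mem_domain_of_mem_graph (h.graph x)
    have h2 := hS.2 ⟨P x, hd⟩
    rw [apply_eq_of_mem_graph (h.graph x) hd] at h2
    change res A l (l • P x - e • P x) = P x at h2
    rwa [← sub_smul, map_smul] at h2
  have h2 : (l - e) • P (res A l x) = P x := by
    have hd := hS.mem x
    have h3 := h.commute ⟨res A l x, hd⟩
    rw [hS.apply x hd] at h3
    change P (l • res A l x - x) = e • P (res A l x) at h3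
    rw [map_sub, map_smul] at h3
    rw [sub_smul, ← h3]
    abel
  have hne : l - e ≠ 0 := fun h0 => h.ne_zero (by
    ext x
    rw [← h1 x, h0, zero_smul]
    rfl)
  exact smul_right_injective E hne ((h1 x).trans h2.symm)

theorem IsAtomicPoint.redRes_spec (h : IsAtomicPoint A P e z C) (q : ℝ≥0) :
    IsReducedResolvent A P (z - (q : ℝ)) (redRes A P (z - (q : ℝ))) ∧
      ‖redRes A P (z - (q : ℝ))‖ ≤ C / (q + 1) := by
  obtain ⟨R, hR, hb⟩ := h.reduced q
  have h1 : ∃ R, IsReducedResolvent A P (z - (q : ℝ)) R := ⟨R, hR⟩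
  have h2 : IsReducedResolvent A P (z - (q : ℝ)) (redRes A P (z - (q : ℝ))) := by
    rw [redRes, dif_pos h1]
    exact h1.choose_spec
  refine ⟨h2, ?_⟩
  rw [h2.unique hR]
  exact ContinuousLinearMap.opNorm_le_bound _ (div_nonneg h.nonneg (by positivity)) hb

/-- The reduced resolvent in terms of a resolvent of `A`, which exhibits its continuity in `q` and
its analyticity in the parameters. -/
theorem IsAtomicPoint.redRes_eq (h : IsAtomicPoint A P e z C) {l : ℂ} (hl : l ∈ resSet A) (q : ℝ≥0) :
    IsUnit (1 - (l - (z - (q : ℝ))) • (res A l * (1 - P))) ∧ redRes A P (z - (q : ℝ)) =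
      -(Ring.inverse (1 - (l - (z - (q : ℝ))) • (res A l * (1 - P))) * (res A l * (1 - P))) :=
  (h.redRes_spec q).1.isUnit (isResolventAt_res hl) (h.res_commute hl)

theorem IsAtomicPoint.continuous_redRes (h : IsAtomicPoint A P e z C) :
    Continuous fun q : ℝ≥0 => redRes A P (z - (q : ℝ)) := by
  obtain ⟨l, hl⟩ := h.resolvent
  rw [continuous_iff_continuousAt]
  intro q
  have h1 : (fun q : ℝ≥0 => redRes A P (z - (q : ℝ))) = fun q : ℝ≥0 =>
      -(Ring.inverse (1 - (l - (z - (q : ℝ))) • (res A l * (1 - P))) * (res A l * (1 - P))) :=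
    funext fun q => (h.redRes_eq hl q).2
  rw [h1]
  obtain ⟨u, hu⟩ := (h.redRes_eq hl q).1
  have h2 : ContinuousAt (fun q : ℝ≥0 =>
      1 - (l - (z - (q : ℝ))) • (res A l * (1 - P))) q := by
    have h0 : Continuous fun q : ℝ≥0 => l - (z - (q : ℝ)) := continuous_const.sub
      (continuous_const.sub (Complex.continuous_ofReal.comp NNReal.continuous_coe))
    exact (continuous_const.sub (h0.smul continuous_const)).continuousAt
  have h3 : ContinuousAt Ring.inverse (1 - (l - (z - (q : ℝ))) • (res A l * (1 - P))) := by
    rw [← hu]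
    exact NormedRing.inverse_continuousAt u
  exact ((ContinuousAt.comp (f := fun q : ℝ≥0 =>
    1 - (l - (z - (q : ℝ))) • (res A l * (1 - P))) h3 h2).mul continuousAt_const).neg

/-- The bound on `(q + 1)(A - z + q)⁻¹(1 - P)` bounds `1 - P`, its strong limit as `q → ∞`. -/
theorem IsAtomicPoint.norm_one_sub_le (h : IsAtomicPoint A P e z C) : ‖1 - P‖ ≤ C := by
  refine ContinuousLinearMap.opNorm_le_bound _ h.nonneg fun x => ?_
  have hc : IsClosed {x : E | ‖(1 - P) x‖ ≤ C * ‖x‖} :=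
    isClosed_le (by fun_prop) (by fun_prop)
  refine closure_minimal (s := (A.domain : Set E)) ?_ hc (h.dense x)
  intro x hx
  set y := A ⟨x, hx⟩ - z • x with hy
  -- `(1 - P) x = R(q) (A - z) x + q R(q) x`.
  have h1 : ∀ n : ℕ, ‖(1 - P) x‖ ≤ C / (n + 1) * ‖y‖ + C * ‖x‖ := by
    intro n
    obtain ⟨hR, hb⟩ := h.redRes_spec n
    set R := redRes A P (z - (((n : ℝ≥0) : ℝ) : ℂ)) with hRdef
    have h2 := hR.left ⟨x, hx⟩
    have h3 : A ⟨x, hx⟩ - (z - (((n : ℝ≥0) : ℝ) : ℂ)) • x = y + ((n : ℝ) : ℂ) • x := by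
      rw [hy, sub_smul]
      push_cast
      abel
    change R (A ⟨x, hx⟩ - (z - (((n : ℝ≥0) : ℝ) : ℂ)) • x) = x - P x at h2
    rw [h3, map_add, map_smul] at h2
    have hn : (((n : ℝ≥0) : ℝ)) = (n : ℝ) := by simp
    rw [hn] at hb
    have hn0 : (0 : ℝ) ≤ n := Nat.cast_nonneg n
    change ‖x - P x‖ ≤ _
    rw [← h2]
    refine (norm_add_le _ _).trans (add_le_add ?_ ?_)
    · exact (R.le_opNorm y).trans (mul_le_mul_of_nonneg_right hb (norm_nonneg _))
    · rw [norm_smul, Complex.norm_real, Real.norm_of_nonneg hn0]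
      calc (n : ℝ) * ‖R x‖ ≤ n * (C / (n + 1) * ‖x‖) := by
            refine mul_le_mul_of_nonneg_left ?_ hn0
            exact (R.le_opNorm x).trans (mul_le_mul_of_nonneg_right hb (norm_nonneg _))
        _ = (n / (n + 1)) * (C * ‖x‖) := by ring
        _ ≤ 1 * (C * ‖x‖) := by
            refine mul_le_mul_of_nonneg_right ?_ (mul_nonneg h.nonneg (norm_nonneg _))
            rw [div_le_one (by positivity)]
            linarith
        _ = C * ‖x‖ := one_mul _
  have hlim : Tendsto (fun n : ℕ => C / ((n : ℝ) + 1) * ‖y‖ + C * ‖x‖) atTop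
      (𝓝 (C * 0 * ‖y‖ + C * ‖x‖)) := by
    refine Tendsto.add_const _ (Tendsto.mul_const _ ?_)
    refine (tendsto_one_div_add_atTop_nhds_zero_nat (𝕜 := ℝ)).const_mul C |>.congr fun n => ?_
    ring
  rw [mul_zero, zero_mul, zero_add] at hlim
  exact ge_of_tendsto' hlim h1

theorem IsAtomicPoint.norm_proj_le (h : IsAtomicPoint A P e z C) : ‖P‖ ≤ 1 + C := by
  have h1 : ‖(1 : E →L[ℂ] E) - (1 - P)‖ ≤ 1 + C :=
    (norm_sub_le _ _).trans (add_le_add ContinuousLinearMap.norm_id_le h.norm_one_sub_le)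
  rwa [sub_sub_cancel] at h1

/-- The function `max(q, 3/4)`, which replaces the photon energy `q` on the range of `P` where the
cutoff `χ'` vanishes. -/
def theta (q : ℝ≥0) : ℝ := max (q : ℝ) (3 / 4)

theorem continuous_theta : Continuous theta := NNReal.continuous_coe.max continuous_const

theorem theta_ge (q : ℝ≥0) : 3 / 4 ≤ theta q := le_max_right _ _

theorem le_theta (q : ℝ≥0) : (q : ℝ) ≤ theta q := le_max_left _ _

/-- Since `|e - z| < 1/2` and `θ(q) ≥ 3/4`, the number `e - z + θ(q)` stays away from zero. -/
theorem norm_theta_le (h : ‖e - z‖ < 1 / 2) (q : ℝ≥0) :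
    e - z + theta q ≠ 0 ∧ (q + 1) * ‖(e - z + (theta q : ℂ))⁻¹‖ ≤ 7 := by
  have h1 : theta q - 1 / 2 ≤ ‖e - z + (theta q : ℂ)‖ := by
    have h2 := norm_sub_norm_le ((theta q : ℝ) : ℂ) (-(e - z))
    rw [norm_neg, sub_neg_eq_add, add_comm, Complex.norm_real, Real.norm_eq_abs,
      abs_of_pos (by linarith [theta_ge q])] at h2
    linarith
  have h3 := theta_ge q
  have h4 := le_theta q
  have h5 : 0 < ‖e - z + (theta q : ℂ)‖ := by linarith
  refine ⟨norm_pos_iff.1 h5, ?_⟩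
  rw [norm_inv, ← div_eq_mul_inv, div_le_iff₀ h5]
  linarith

/-- The function `q ↦ (q + 1) ((A - z + q)⁻¹ (1 - P) + (e - z + θ(q))⁻¹ P)`. -/
def regResFn (A : E →ₗ.[ℂ] E) (P : E →L[ℂ] E) (e z : ℂ) (q : ℝ≥0) : E →L[ℂ] E :=
  (((q : ℝ) + 1 : ℝ) : ℂ) • (redRes A P (z - (q : ℝ)) + (e - z + (theta q : ℂ))⁻¹ • P)

theorem IsAtomicPoint.norm_regResFn_le (h : IsAtomicPoint A P e z C) (q : ℝ≥0) :
    ‖regResFn A P e z q‖ ≤ C + 7 * (1 + C) := by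
  obtain ⟨-, hb⟩ := h.redRes_spec q
  obtain ⟨-, ht⟩ := norm_theta_le h.close q
  have hq : (0 : ℝ) < (q : ℝ) + 1 := by positivity
  have hC := h.nonneg
  rw [regResFn, smul_add]
  refine (norm_add_le _ _).trans (add_le_add ?_ ?_)
  · rw [norm_smul, Complex.norm_real, Real.norm_of_nonneg hq.le]
    rwa [le_div_iff₀ hq, mul_comm] at hb
  · rw [norm_smul, norm_smul, Complex.norm_real, Real.norm_of_nonneg hq.le, ← mul_assoc]
    exact mul_le_mul ht h.norm_proj_le (norm_nonneg _) (by norm_num)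

theorem IsAtomicPoint.continuous_regResFn (h : IsAtomicPoint A P e z C) :
    Continuous (regResFn A P e z) := by
  unfold regResFn
  refine Continuous.smul (Complex.continuous_ofReal.comp
    (NNReal.continuous_coe.add continuous_const)) (h.continuous_redRes.add ?_)
  refine Continuous.smul (Continuous.inv₀ ?_ fun q => (norm_theta_le h.close q).1)
    continuous_const
  exact continuous_const.add (Complex.continuous_ofReal.comp continuous_theta)

open Classical in
/-- A bounded continuous function as an element of `EnergyFn E`; `0` for other functions. -/
def mkEnergyFn (f : ℝ≥0 → (E →L[ℂ] E)) : EnergyFn E :=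
  if h : Continuous f ∧ ∃ C : ℝ, ∀ q, ‖f q‖ ≤ C then
    BoundedContinuousFunction.ofNormedAddCommGroup f h.1 h.2.choose h.2.choose_spec
  else 0

theorem mkEnergyFn_apply {f : ℝ≥0 → (E →L[ℂ] E)} (hf : Continuous f) {C : ℝ}
    (hC : ∀ q, ‖f q‖ ≤ C) (q : ℝ≥0) : mkEnergyFn f q = f q := by
  rw [mkEnergyFn, dif_pos ⟨hf, C, hC⟩]
  rfl

/-- The bounded function of the photon energy whose operator is
`(1 + H_f)(H_0 - z + P ⊗ (θ(H_f) - H_f))⁻¹`. -/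
def regRes (A : E →ₗ.[ℂ] E) (P : E →L[ℂ] E) (e z : ℂ) : EnergyFn E :=
  mkEnergyFn (regResFn A P e z)

theorem IsAtomicPoint.regRes_apply (h : IsAtomicPoint A P e z C) (q : ℝ≥0) :
    regRes A P e z q = regResFn A P e z q :=
  mkEnergyFn_apply h.continuous_regResFn h.norm_regResFn_le q

theorem IsAtomicPoint.norm_regRes_le (h : IsAtomicPoint A P e z C) :
    ‖regRes A P e z‖ ≤ C + 7 * (1 + C) := by
  refine (BoundedContinuousFunction.norm_le (by have := h.nonneg; linarith)).2 fun q => ?_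
  rw [h.regRes_apply]
  exact h.norm_regResFn_le q

end AtomicPoint

section AtomicFamily

variable {E : Type*} [NormedAddCommGroup E] [InnerProductSpace ℂ E] [CompleteSpace E]
  [TopologicalSpace.SeparableSpace E] {ν : ℕ}
  {V : Set (Fin ν → ℂ)} {T : (Fin ν → ℂ) → (E →ₗ.[ℂ] E)} {s₀ : Fin ν → ℂ} {E₀ r : ℝ}
  {𝒰 : Set ((Fin ν → ℂ) × ℂ)}

theorem eat_spec {s : Fin ν → ℂ} (h : s ∈ branchDomain T E₀ r) :
    spec (T s) ∩ Metric.ball (E₀ : ℂ) r = {Eat T E₀ r s} ∧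
      Module.finrank ℂ (LinearMap.range (rieszProj (T s) (Eat T E₀ r s)).toLinearMap) = 1 := by
  obtain ⟨e, he, hr⟩ := h
  have h1 : spec (T s) ∩ Metric.ball (E₀ : ℂ) r = {Eat T E₀ r s} :=
    Classical.epsilon_spec (p := fun e => spec (T s) ∩ Metric.ball (E₀ : ℂ) r = {e}) ⟨e, he⟩
  refine ⟨h1, ?_⟩
  rw [he] at h1
  rw [← Set.singleton_injective h1]
  exact hr

/-- The hypotheses hold at every point of `𝒰` with the same constant. -/
theorem HypR.isAtomicPoint (hT : HypH V T s₀ E₀) (hR : HypR V T s₀ E₀ r 𝒰) : ∃ C : ℝ, 0 ≤ C ∧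
    ∀ p ∈ 𝒰, IsAtomicPoint (T p.1) (Pat T E₀ r p.1) (Eat T E₀ r p.1) p.2 C := by
  obtain ⟨C, hC⟩ := hR.bound
  refine ⟨|C|, abs_nonneg C, fun p hp => ?_⟩
  obtain ⟨hpV, hpD⟩ := hR.subset p hp
  have hsimp := isSimpleAt_of_spec (eat_spec hpD).1 (eat_spec hpD).2
  have hproj : ∀ x, Pat T E₀ r p.1 (Pat T E₀ r p.1 x) = Pat T E₀ r p.1 x := fun x =>
    DFunLike.congr_fun (rieszProj_mul_self hsimp.pos hsimp.isolated) x
  have hgraph : ∀ x, (Pat T E₀ r p.1 x, Eat T E₀ r p.1 • Pat T E₀ r p.1 x) ∈ (T p.1).graph :=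
    fun x => by
      obtain ⟨hx, h1⟩ := hsimp.apply_rieszProj x
      exact (LinearPMap.mem_graph_iff _).2 ⟨⟨_, hx⟩, rfl, h1⟩
  refine ⟨hT.dense _ hpV, hproj, hsimp.rieszProj_ne_zero, ?_, hgraph,
    hsimp.rieszProj_apply, hR.close p hp, (hT.kato.1 _ hpV).2, abs_nonneg C, fun q => ?_⟩
  · obtain ⟨x, -, -, h1⟩ := hsimp.exists_vector
    exact ⟨x, h1⟩
  · obtain ⟨h1, h2⟩ := hC p hp q q.2
    refine exists_reducedResolvent hproj (fun x => ⟨_, hsimp.rieszProj_apply x, hgraph _⟩) h1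
      fun x => ?_
    obtain ⟨hx, h3⟩ := h2 x
    refine ⟨hx, ?_⟩
    have hq : (0 : ℝ) < (q : ℝ) + 1 := by positivity
    rw [div_mul_eq_mul_div, le_div_iff₀ hq, mul_comm]
    exact h3.trans (mul_le_mul_of_nonneg_right (le_abs_self C) (norm_nonneg _))

/-- The eigenprojection and the eigenvalue are analytic at the points of `𝒰`. -/
theorem HypR.analyticAt_proj (hT : HypH V T s₀ E₀) (hR : HypR V T s₀ E₀ r 𝒰)
    {p : (Fin ν → ℂ) × ℂ} (hp : p ∈ 𝒰) :
    AnalyticAt ℂ (Pat T E₀ r) p.1 ∧ AnalyticAt ℂ (Eat T E₀ r) p.1 := by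
  obtain ⟨l, hl, ha⟩ := hT.kato.2 p.1 (hR.subset p hp).1
  refine analyticAt_rieszProj (E₀ := (E₀ : ℂ)) (r := r) hl ha ?_
  have hc : Tendsto (fun s : Fin ν → ℂ => (s, p.2)) (𝓝 p.1) (𝓝 (p.1, p.2)) :=
    (Continuous.prodMk_left p.2).tendsto p.1
  filter_upwards [hc.eventually (hR.isOpen.mem_nhds hp)] with s hs
  exact eat_spec (hR.subset _ hs).2

/-- `(s, z) ↦ (1 + H_f)(H_0(s) - z + P(s) ⊗ (θ(H_f) - H_f))⁻¹` is analytic. -/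
theorem HypR.analyticOnNhd_regRes (hT : HypH V T s₀ E₀) (hR : HypR V T s₀ E₀ r 𝒰) :
    AnalyticOnNhd ℂ (fun p : (Fin ν → ℂ) × ℂ =>
      regRes (T p.1) (Pat T E₀ r p.1) (Eat T E₀ r p.1) p.2) 𝒰 := by
  obtain ⟨C, hC, hpt⟩ := HypR.isAtomicPoint hT hR
  have hb := fun p hp => (hpt p hp).norm_regRes_le
  refine osgoodSpace_fin_prod ν _ _ 𝒰 _ hR.isOpen hb ?_
  refine LineHolomorphicOn.of_norming hR.isOpen hb
    (fun q : ℝ≥0 => BoundedContinuousFunction.evalCLM ℂ q)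
    (fun z g => g.norm_coe_le_norm z)
    (fun g a ha h => (BoundedContinuousFunction.norm_le ha).2 h) fun q => ?_
  refine lineHolomorphicOn_of_analyticOnNhd fun p hp => ?_
  obtain ⟨l, hl, ha⟩ := hT.kato.2 p.1 (hR.subset p hp).1
  obtain ⟨hP, hE⟩ := HypR.analyticAt_proj hT hR hp
  have hP' : AnalyticAt ℂ (fun p : (Fin ν → ℂ) × ℂ => Pat T E₀ r p.1) p :=
    AnalyticAt.comp (f := Prod.fst) (g := Pat T E₀ r) hP analyticAt_fst
  have hE' : AnalyticAt ℂ (fun p : (Fin ν → ℂ) × ℂ => Eat T E₀ r p.1) p :=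
    AnalyticAt.comp (f := Prod.fst) (g := Eat T E₀ r) hE analyticAt_fst
  have ha' : AnalyticAt ℂ (fun p : (Fin ν → ℂ) × ℂ => res (T p.1) l) p :=
    AnalyticAt.comp (f := Prod.fst) (g := fun s => res (T s) l) ha analyticAt_fst
  have hz : AnalyticAt ℂ (fun p : (Fin ν → ℂ) × ℂ => p.2) p := analyticAt_snd
  have hB : AnalyticAt ℂ (fun p : (Fin ν → ℂ) × ℂ => res (T p.1) l * (1 - Pat T E₀ r p.1)) p :=
    ha'.mul (analyticAt_const.sub hP')
  have hI : AnalyticAt ℂ (fun p : (Fin ν → ℂ) × ℂ => 1 - (l - (p.2 - (q : ℝ))) •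
      (res (T p.1) l * (1 - Pat T E₀ r p.1))) p :=
    analyticAt_const.sub ((analyticAt_const.sub (hz.sub analyticAt_const)).smul hB)
  have hinv : AnalyticAt ℂ Ring.inverse (1 - (l - (p.2 - (q : ℝ))) •
      (res (T p.1) l * (1 - Pat T E₀ r p.1))) := by
    obtain ⟨u, hu⟩ := ((hpt p hp).redRes_eq hl.self_of_nhds q).1
    rw [← hu]
    exact analyticAt_inverse u
  have h1 := ((AnalyticAt.comp (f := fun p : (Fin ν → ℂ) × ℂ => 1 - (l - (p.2 - (q : ℝ))) •
      (res (T p.1) l * (1 - Pat T E₀ r p.1))) hinv hI).mul hB).neg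
  have h2 : AnalyticAt ℂ (fun p : (Fin ν → ℂ) × ℂ =>
      (Eat T E₀ r p.1 - p.2 + (theta q : ℂ))⁻¹ • Pat T E₀ r p.1) p :=
    (((hE'.sub hz).add analyticAt_const).inv (norm_theta_le (hpt p hp).close q).1).smul hP'
  have h3 := (analyticAt_const (𝕜 := ℂ) (E := (Fin ν → ℂ) × ℂ) (x := p)
    (v := (((q : ℝ) + 1 : ℝ) : ℂ))).smul (h1.add h2)
  refine h3.congr ?_
  have hl' : ∀ᶠ p' : (Fin ν → ℂ) × ℂ in 𝓝 p, l ∈ resSet (T p'.1) :=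
    continuous_fst.continuousAt.eventually (p := fun s => l ∈ resSet (T s)) hl
  filter_upwards [hR.isOpen.mem_nhds hp, hl'] with p' hp' hlp'
  rw [BoundedContinuousFunction.evalCLM_apply, (hpt p' hp').regRes_apply, regResFn,
    ((hpt p' hp').redRes_eq hlp' q).2]
  rfl

end AtomicFamily

/-! ### Graphs of partial operators -/

section Graph

local infixr:80 " ∘ₚ " => pcomp

variable {X : Type*} [NormedAddCommGroup X] [InnerProductSpace ℂ X] {f g : X →ₗ.[ℂ] X}

theorem mem_graph_ofBdd (A : X →L[ℂ] X) (x : X) : (x, A x) ∈ (ofBdd A).graph :=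
  (LinearPMap.mem_graph_iff _).2 ⟨⟨x, trivial⟩, rfl, rfl⟩

theorem mem_graph_pcomp {x y w : X} (hf : (x, y) ∈ f.graph) (hg : (y, w) ∈ g.graph) :
    (x, w) ∈ (g ∘ₚ f).graph := by
  have hx := LinearPMap.mem_domain_of_mem_graph hf
  have hy := LinearPMap.mem_domain_of_mem_graph hg
  have h1 := apply_eq_of_mem_graph hf hx
  have hx' : f ⟨x, hx⟩ ∈ g.domain := by rw [h1]; exact hy
  refine (LinearPMap.mem_graph_iff _).2 ⟨⟨x, hx, hx'⟩, rfl, ?_⟩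
  change g ⟨f ⟨x, hx⟩, hx'⟩ = w
  have h2 : (⟨f ⟨x, hx⟩, hx'⟩ : g.domain) = ⟨y, hy⟩ := Subtype.ext h1
  rw [h2]
  exact apply_eq_of_mem_graph hg hy

theorem mem_graph_add {x y w : X} (hf : (x, y) ∈ f.graph) (hg : (x, w) ∈ g.graph) :
    (x, y + w) ∈ (f + g).graph := add_mem_graph_pmap hf hg

theorem mem_graph_sub {x y w : X} (hf : (x, y) ∈ f.graph) (hg : (x, w) ∈ g.graph) :
    (x, y - w) ∈ (f - g).graph := by
  have hx := LinearPMap.mem_domain_of_mem_graph hf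
  have hx' := LinearPMap.mem_domain_of_mem_graph hg
  refine (LinearPMap.mem_graph_iff _).2 ⟨⟨x, hx, hx'⟩, rfl, ?_⟩
  rw [LinearPMap.sub_apply]
  congr 1
  · exact apply_eq_of_mem_graph hf hx
  · exact apply_eq_of_mem_graph hg hx'

theorem mem_graph_subScalar {z : ℂ} {x y : X} :
    (x, y) ∈ (subScalar f z).graph ↔ (x, y + z • x) ∈ f.graph := by
  rw [LinearPMap.mem_graph_iff, LinearPMap.mem_graph_iff]
  constructor
  · rintro ⟨a, h1, h2⟩
    have h1' : (a : X) = x := h1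
    refine ⟨a, h1, ?_⟩
    change f a - z • (a : X) = y at h2
    rw [← h2, ← h1', sub_add_cancel]
  · rintro ⟨a, h1, h2⟩
    have h1' : (a : X) = x := h1
    refine ⟨a, h1, ?_⟩
    change f a = y + z • x at h2
    change f a - z • (a : X) = y
    rw [h2, h1', add_sub_cancel_right]

theorem exists_mem_graph {x : X} (hx : x ∈ f.domain) : ∃ y, (x, y) ∈ f.graph :=
  ⟨f ⟨x, hx⟩, f.mem_graph ⟨x, hx⟩⟩

theorem graph_unique {x y y' : X} (h : (x, y) ∈ f.graph) (h' : (x, y') ∈ f.graph) : y = y' := by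
  have hx := LinearPMap.mem_domain_of_mem_graph h
  rw [← apply_eq_of_mem_graph h hx, ← apply_eq_of_mem_graph h' hx]

end Graph

/-! ### The Feshbach pair -/

section Feshbach

local infixr:80 " ∘ₚ " => pcomp

variable {X : Type*} [NormedAddCommGroup X] [InnerProductSpace ℂ X] [CompleteSpace X]
  {H T : X →ₗ.[ℂ] X} {χ χ' R K W J J' : X →L[ℂ] X}

/-- An operator `T = R⁻¹ - K` and its perturbation `H = T + W R⁻¹`, described by bounded operators
`R`, `K`, `W`, together with cutoff operators `χ`, `χ'` that commute with `R` and `K`. The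
operators `1 - χ' = R J` and `χ = J' R` factor through `R`, that is, `T` is bounded on their
ranges; `K` lives where `χ'` vanishes. -/
structure FeshbachData (H T : X →ₗ.[ℂ] X) (χ χ' R K W J J' : X →L[ℂ] X) : Prop where
  graph_T : ∀ p, p ∈ T.graph ↔ ∃ u, p = (R u, u - K (R u))
  graph_H : ∀ p, p ∈ H.graph ↔ ∃ u, p = (R u, u - K (R u) + W u)
  closed_T : T.IsClosed
  closed_H : H.IsClosed
  comm : ∀ x, χ (χ' x) = χ' (χ x)
  sq_add_sq : ∀ x, χ (χ x) + χ' (χ' x) = x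
  ne_zero : χ ≠ 0
  ne_zero' : χ' ≠ 0
  R_chi : ∀ x, R (χ x) = χ (R x)
  R_chi' : ∀ x, R (χ' x) = χ' (R x)
  K_chi : ∀ x, K (χ x) = χ (K x)
  K_chi' : ∀ x, K (χ' x) = 0
  chi'_K : ∀ x, χ' (K x) = 0
  J_R : ∀ x, J (R x) = x - χ' x
  J_chi' : ∀ x, J (χ' x) = χ' (J x)
  J'_R : ∀ x, J' (R x) = χ x
  small : ‖χ' * W * χ'‖ < 1

theorem FeshbachData.mem_T (D : FeshbachData H T χ χ' R K W J J') (u : X) :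
    (R u, u - K (R u)) ∈ T.graph := (D.graph_T _).2 ⟨u, rfl⟩

theorem FeshbachData.mem_H (D : FeshbachData H T χ χ' R K W J J') (u : X) :
    (R u, u - K (R u) + W u) ∈ H.graph := (D.graph_H _).2 ⟨u, rfl⟩

theorem FeshbachData.exists_of_mem_T (D : FeshbachData H T χ χ' R K W J J') {x : X}
    (hx : x ∈ T.domain) : ∃ u, x = R u := by
  obtain ⟨y, hy⟩ := exists_mem_graph hx
  obtain ⟨u, hu⟩ := (D.graph_T _).1 hy
  exact ⟨u, congrArg Prod.fst hu⟩

theorem FeshbachData.exists_of_mem_H (D : FeshbachData H T χ χ' R K W J J') {x : X}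
    (hx : x ∈ H.domain) : ∃ u, x = R u := by
  obtain ⟨y, hy⟩ := exists_mem_graph hx
  obtain ⟨u, hu⟩ := (D.graph_H _).1 hy
  exact ⟨u, congrArg Prod.fst hu⟩

theorem FeshbachData.mem_W (D : FeshbachData H T χ χ' R K W J J') (u : X) :
    (R u, W u) ∈ (H - T).graph := by
  have h := mem_graph_sub (D.mem_H u) (D.mem_T u)
  rwa [add_sub_cancel_left] at h

theorem FeshbachData.mem_dressed (D : FeshbachData H T χ χ' R K W J J') (u : X) :
    (R u, u - K (R u) + χ' (W (χ' u))) ∈ (dressed H T χ').graph := by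
  have h1 : (χ' (R u), W (χ' u)) ∈ (H - T).graph := by
    rw [← D.R_chi']
    exact D.mem_W _
  exact mem_graph_add (D.mem_T u)
    (mem_graph_pcomp (mem_graph_pcomp (mem_graph_ofBdd χ' (R u)) h1) (mem_graph_ofBdd χ' _))

theorem FeshbachData.domain_dressed (D : FeshbachData H T χ χ' R K W J J') {x : X}
    (hx : x ∈ (dressed H T χ').domain) : ∃ u, x = R u :=
  D.exists_of_mem_T hx.1

/-- The domain condition and the range condition are compatible: `R⁻¹` preserves `Ran χ'`. -/
theorem FeshbachData.mem_range_of (D : FeshbachData H T χ χ' R K W J J') {u : X}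
    (h : R u ∈ LinearMap.range χ'.toLinearMap) : ∃ v, u = χ' v := by
  obtain ⟨y, hy⟩ := h
  have hy' : χ' y = R u := hy
  refine ⟨u + J y, ?_⟩
  rw [map_add, ← D.J_chi', hy', D.J_R, add_sub_cancel]

theorem FeshbachData.mem_range (D : FeshbachData H T χ χ' R K W J J') (v : X) :
    R (χ' v) ∈ LinearMap.range χ'.toLinearMap := ⟨R v, (D.R_chi' v).symm⟩

theorem FeshbachData.K_R_chi' (D : FeshbachData H T χ χ' R K W J J') (v : X) :
    K (R (χ' v)) = 0 := by
  rw [D.R_chi', D.K_chi']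

/-- A partial operator that acts on `Ran χ'` as `N R⁻¹`, with `N` invertible and preserving
`Ran χ'`, is bounded invertible there. -/
theorem FeshbachData.bddInvertibleIn (D : FeshbachData H T χ χ' R K W J J') {A : X →ₗ.[ℂ] X}
    {N N' M : X →L[ℂ] X} (hA : ∀ x ∈ A.domain, ∃ u, x = R u)
    (hA' : ∀ v, (R (χ' v), N (χ' v)) ∈ A.graph) (h1 : ∀ x, N (N' x) = x) (h2 : ∀ x, N' (N x) = x)
    (hM : ∀ x, N x = x + χ' (M x)) :
    BddInvertibleIn A (LinearMap.range χ'.toLinearMap) ∧ ∀ y ∈ LinearMap.range χ'.toLinearMap,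
      (y, R (N' y)) ∈ (inverseIn A (LinearMap.range χ'.toLinearMap)).graph := by
  have hgraph : ∀ x : A.domain, (x : X) ∈ LinearMap.range χ'.toLinearMap →
      ∃ v, (x : X) = R (χ' v) ∧ A x = N (χ' v) := by
    intro x hx
    obtain ⟨u, hu⟩ := hA x x.2
    rw [hu] at hx
    obtain ⟨v, rfl⟩ := D.mem_range_of hx
    refine ⟨v, hu, ?_⟩
    have hd : R (χ' v) ∈ A.domain := hu ▸ x.2
    have h3 : x = ⟨R (χ' v), hd⟩ := Subtype.ext hu
    rw [h3]
    exact apply_eq_of_mem_graph (hA' v) hd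
  have hN' : ∀ y ∈ LinearMap.range χ'.toLinearMap, ∃ v, N' y = χ' v := by
    rintro _ ⟨w, rfl⟩
    refine ⟨w - M (N' (χ' w)), ?_⟩
    have h3 := hM (N' (χ' w))
    rw [h1] at h3
    change N' (χ' w) = _
    rw [map_sub, eq_sub_iff_add_eq]
    exact h3.symm
  have hmem : ∀ y ∈ LinearMap.range χ'.toLinearMap, (R (N' y), y) ∈ A.graph ∧
      R (N' y) ∈ LinearMap.range χ'.toLinearMap := by
    intro y hy
    obtain ⟨v, hv⟩ := hN' y hy
    have h3 := hA' v
    rw [← hv, h1] at h3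
    refine ⟨h3, ?_⟩
    rw [hv]
    exact D.mem_range v
  have hinv : BddInvertibleIn A (LinearMap.range χ'.toLinearMap) := by
    refine ⟨fun x hx => ?_, fun y hy => ?_, ‖R‖ * ‖N'‖, fun x hx => ?_⟩
    · obtain ⟨v, -, hv⟩ := hgraph x hx
      rw [hv, hM]
      exact ⟨v + M (χ' v), map_add _ _ _⟩
    · obtain ⟨h3, h4⟩ := hmem y hy
      have hd := LinearPMap.mem_domain_of_mem_graph h3
      refine ⟨⟨R (N' y), hd⟩, ⟨h4, apply_eq_of_mem_graph h3 hd⟩, ?_⟩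
      rintro x ⟨hx1, hx2⟩
      obtain ⟨v, hv1, hv2⟩ := hgraph x hx1
      refine Subtype.ext ?_
      change (x : X) = R (N' y)
      rw [← hx2, hv2, h2, hv1]
    · obtain ⟨v, hv1, hv2⟩ := hgraph x hx
      rw [hv1, hv2]
      calc ‖R (χ' v)‖ = ‖R (N' (N (χ' v)))‖ := by rw [h2]
        _ ≤ ‖R‖ * (‖N'‖ * ‖N (χ' v)‖) :=
          (R.le_opNorm _).trans (mul_le_mul_of_nonneg_left (N'.le_opNorm _) (norm_nonneg _))
        _ = _ := by ring
  refine ⟨hinv, fun y hy => ?_⟩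
  obtain ⟨h3, h4⟩ := hmem y hy
  have hd := LinearPMap.mem_domain_of_mem_graph h3
  have h5 := inverseIn_mem_graph (injOn_of_bddInvertibleIn hinv) ⟨R (N' y), hd⟩ h4
  rwa [apply_eq_of_mem_graph h3 hd] at h5

theorem FeshbachData.isUnit (D : FeshbachData H T χ χ' R K W J J') :
    IsUnit (1 + χ' * W * χ') := by
  have h := isUnit_one_sub_of_norm_lt_one (x := -(χ' * W * χ')) (by rw [norm_neg]; exact D.small)
  rwa [sub_neg_eq_add] at h

/-- On `Ran χ'` the dressed operator has the inverse `R (1 + χ' W χ')⁻¹`. -/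
theorem FeshbachData.bddInvertibleIn_dressed (D : FeshbachData H T χ χ' R K W J J') :
    BddInvertibleIn (dressed H T χ') (LinearMap.range χ'.toLinearMap) ∧
      ∀ y, (χ' y, R (Ring.inverse (1 + χ' * W * χ') (χ' y))) ∈
        (inverseIn (dressed H T χ') (LinearMap.range χ'.toLinearMap)).graph := by
  have h1 := DFunLike.congr_fun (Ring.mul_inverse_cancel _ D.isUnit)
  have h2 := DFunLike.congr_fun (Ring.inverse_mul_cancel _ D.isUnit)
  obtain ⟨h3, h4⟩ := D.bddInvertibleIn (A := dressed H T χ') (N := 1 + χ' * W * χ')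
    (N' := Ring.inverse (1 + χ' * W * χ')) (M := W * χ') (fun x hx => D.domain_dressed hx)
    (fun v => by
      have h := D.mem_dressed (χ' v)
      rw [D.K_R_chi', sub_zero] at h
      exact h) h1 h2 (fun x => rfl)
  exact ⟨h3, fun y => h4 _ ⟨y, rfl⟩⟩

theorem FeshbachData.isFeshbachPair (D : FeshbachData H T χ χ' R K W J J') :
    IsFeshbachPair H T χ χ' where
  commute := ContinuousLinearMap.ext D.comm
  ne_zero := D.ne_zero
  ne_zero' := D.ne_zero'
  sq_add_sq := by
    ext x
    rw [sq, sq]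
    exact D.sq_add_sq x
  closed_H := D.closed_H
  closed_T := D.closed_T
  domain_eq := by
    ext x
    constructor
    · intro hx
      obtain ⟨u, rfl⟩ := D.exists_of_mem_H hx
      exact LinearPMap.mem_domain_of_mem_graph (D.mem_T u)
    · intro hx
      obtain ⟨u, rfl⟩ := D.exists_of_mem_T hx
      exact LinearPMap.mem_domain_of_mem_graph (D.mem_H u)
  comm := by
    refine LinearPMap.le_of_le_graph ?_
    rintro ⟨x, y⟩ hxy
    have hx : x ∈ T.domain := (LinearPMap.mem_domain_of_mem_graph hxy).1
    obtain ⟨u, rfl⟩ := D.exists_of_mem_T hx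
    have h1 := mem_graph_pcomp (D.mem_T u) (mem_graph_ofBdd χ _)
    rw [graph_unique hxy h1, map_sub, ← D.K_chi, ← D.R_chi]
    refine mem_graph_pcomp (mem_graph_ofBdd χ _) ?_
    rw [← D.R_chi]
    exact D.mem_T _
  comm' := by
    refine LinearPMap.le_of_le_graph ?_
    rintro ⟨x, y⟩ hxy
    have hx : x ∈ T.domain := (LinearPMap.mem_domain_of_mem_graph hxy).1
    obtain ⟨u, rfl⟩ := D.exists_of_mem_T hx
    have h1 := mem_graph_pcomp (D.mem_T u) (mem_graph_ofBdd χ' _)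
    rw [graph_unique hxy h1, map_sub, D.chi'_K, ← D.K_R_chi' u]
    refine mem_graph_pcomp (mem_graph_ofBdd χ' _) ?_
    rw [← D.R_chi']
    exact D.mem_T _
  inv_T := (D.bddInvertibleIn (A := T) (N := 1) (N' := 1) (M := 0)
    (fun x hx => D.exists_of_mem_T hx) (fun v => by
      have h := D.mem_T (χ' v)
      rw [D.K_R_chi', sub_zero] at h
      exact h) (fun _ => rfl) (fun _ => rfl) (fun x => by simp)).1
  inv_H := D.bddInvertibleIn_dressed.1
  bounded := by
    set Z : X →L[ℂ] X := χ' * R * Ring.inverse (1 + χ' * W * χ') * χ' * W with hZ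
    refine ⟨‖Z * J'‖, fun x hx => ?_⟩
    obtain ⟨u, rfl⟩ := D.exists_of_mem_T hx
    have h0 : (χ (R u), W (χ u)) ∈ (H - T).graph := by
      rw [← D.R_chi]
      exact D.mem_W _
    have h1 : (R u, Z (J' (R u))) ∈ (ofBdd χ' ∘ₚ inverseIn (dressed H T χ')
        (LinearMap.range χ'.toLinearMap) ∘ₚ ofBdd χ' ∘ₚ (H - T) ∘ₚ ofBdd χ).graph := by
      rw [D.J'_R]
      exact mem_graph_pcomp (mem_graph_pcomp (mem_graph_pcomp (mem_graph_pcomp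
        (mem_graph_ofBdd χ (R u)) h0) (mem_graph_ofBdd χ' _))
        (D.bddInvertibleIn_dressed.2 _)) (mem_graph_ofBdd χ' _)
    have hd := LinearPMap.mem_domain_of_mem_graph h1
    refine ⟨hd, ?_⟩
    rw [apply_eq_of_mem_graph h1 hd]
    exact (Z * J').le_opNorm _

end Feshbach

/-! ### The graph of a closed perturbed operator -/

section Closure

variable {X : Type*} [NormedAddCommGroup X] [InnerProductSpace ℂ X] [CompleteSpace X]

/-- Let `F` be an operator with `R (F - z + K) = 1` on its domain, such that `F - z + K` has dense
range, and let `W` satisfy `W R = B` with `‖B‖ < 1`. Then `F + W` is closable and the graph of its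
closure is `{(R u, u - K R u + z R u + B u)}`. -/
theorem graph_closure_perturbed {F W : X →ₗ.[ℂ] X} {R K B : X →L[ℂ] X} {z : ℂ}
    (hF : ∀ p ∈ F.graph, p.1 = R (p.2 - z • p.1 + K p.1)) (hR : ∀ u, R u = 0 → u = 0)
    (hd : Dense {u : X | ∃ p ∈ F.graph, u = p.2 - z • p.1 + K p.1})
    (hW : ∀ u, (R u, B u) ∈ W.graph) (hB : ‖B‖ < 1) :
    ((F + W).closure.IsClosed) ∧ ∀ p, p ∈ (F + W).closure.graph ↔
      ∃ u, p = (R u, u - K (R u) + z • R u + B u) := by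
  set Φ : X →L[ℂ] X × X := R.prod (1 - K * R + z • R + B) with hΦ
  have hΦ' : ∀ u, Φ u = (R u, u - K (R u) + z • R u + B u) := fun u => rfl
  have hu : IsUnit (1 + B) := by
    have h := isUnit_one_sub_of_norm_lt_one (x := -B) (by rwa [norm_neg])
    rwa [sub_neg_eq_add] at h
  set N := Ring.inverse (1 + B) with hN
  have h1 : ∀ x, N (x + B x) = x := DFunLike.congr_fun (Ring.inverse_mul_cancel _ hu)
  have h2 : ∀ x, N x + B (N x) = x := DFunLike.congr_fun (Ring.mul_inverse_cancel _ hu)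
  -- The range of `Φ` is closed, being described by an equation between continuous functions.
  have hrange : (LinearMap.range Φ.toLinearMap : Set (X × X)) =
      {p | p.1 = R (N (p.2 - z • p.1 + K p.1))} := by
    ext ⟨x, y⟩
    constructor
    · rintro ⟨u, hu⟩
      have hu' : Φ u = (x, y) := hu
      rw [hΦ'] at hu'
      obtain ⟨rfl, rfl⟩ := Prod.mk.inj hu'
      change R u = R (N (u - K (R u) + z • R u + B u - z • R u + K (R u)))
      have h3 : u - K (R u) + z • R u + B u - z • R u + K (R u) = u + B u := by abel
      rw [h3, h1]
    · intro h
      change x = R (N (y - z • x + K x)) at h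
      refine ⟨N (y - z • x + K x), ?_⟩
      change Φ (N (y - z • x + K x)) = (x, y)
      rw [hΦ', ← h]
      refine Prod.ext rfl ?_
      have h3 := h2 (y - z • x + K x)
      calc N (y - z • x + K x) - K x + z • x + B (N (y - z • x + K x))
          = (N (y - z • x + K x) + B (N (y - z • x + K x))) - K x + z • x := by abel
        _ = y := by rw [h3]; abel
  have hclosed : IsClosed (LinearMap.range Φ.toLinearMap : Set (X × X)) := by
    rw [hrange]
    exact isClosed_eq continuous_fst (by fun_prop)
  have hinj : ∀ p ∈ LinearMap.range Φ.toLinearMap, p.1 = 0 → p.2 = 0 := by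
    rintro _ ⟨u, rfl⟩ h0
    have h3 : u = 0 := hR u h0
    change (Φ u).2 = 0
    rw [h3, map_zero]
    rfl
  have hgraph : (F + W).graph.topologicalClosure = LinearMap.range Φ.toLinearMap := by
    apply le_antisymm
    · refine Submodule.topologicalClosure_minimal _ ?_ hclosed
      rintro ⟨x, y⟩ hp
      obtain ⟨w, hw⟩ := exists_mem_graph (LinearPMap.mem_domain_of_mem_graph hp).1
      set u := w - z • x + K x with hu
      have hx : x = R u := hF _ hw
      have h3 := hW u
      rw [← hx] at h3
      refine ⟨u, ?_⟩
      rw [graph_unique hp (mem_graph_add hw h3)]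
      change Φ u = _
      rw [hΦ', ← hx]
      refine Prod.ext rfl ?_
      change u - K x + z • x + B u = w + B u
      rw [hu]
      abel
    · rintro _ ⟨u, rfl⟩
      refine closure_mono (s := Φ '' {u : X | ∃ p ∈ F.graph, u = p.2 - z • p.1 + K p.1}) ?_
        (image_closure_subset_closure_image Φ.continuous ⟨u, hd u, rfl⟩)
      rintro _ ⟨_, ⟨⟨x, w⟩, hw, rfl⟩, rfl⟩
      have hx : x = R (w - z • x + K x) := hF _ hw
      have h3 := hW (w - z • x + K x)
      change Φ (w - z • x + K x) ∈ (F + W).graph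
      rw [hΦ', ← hx]
      rw [← hx] at h3
      have h4 := mem_graph_add hw h3
      have h5 : w - z • x + K x - K x + z • x + B (w - z • x + K x) =
          w + B (w - z • x + K x) := by abel
      rw [h5]
      exact h4
  have hclos : (F + W).IsClosable := isClosable_of_graph_closure fun p hp => by
    rw [hgraph] at hp
    exact hinj p hp
  have hfin := hclos.graph_closure_eq_closure_graph
  rw [hgraph] at hfin
  refine ⟨?_, fun p => ?_⟩
  · exact hclos.closure_isClosed
  · rw [← hfin]
    constructor
    · rintro ⟨u, rfl⟩
      exact ⟨u, rfl⟩
    · rintro ⟨u, rfl⟩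
      exact ⟨u, rfl⟩

theorem mem_graph_smul {W : X →ₗ.[ℂ] X} {x y : X} (c : ℂ) (h : (x, y) ∈ W.graph) :
    (x, c • y) ∈ (c • W).graph := by
  have hx := LinearPMap.mem_domain_of_mem_graph h
  refine (LinearPMap.mem_graph_iff _).2 ⟨⟨x, hx⟩, rfl, ?_⟩
  change c • W ⟨x, hx⟩ = c • y
  rw [apply_eq_of_mem_graph h hx]

theorem isClosed_subScalar {F : X →ₗ.[ℂ] X} (h : F.IsClosed) (z : ℂ) : (subScalar F z).IsClosed := by
  have h1 : ((subScalar F z).graph : Set (X × X)) =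
      (fun p : X × X => (p.1, p.2 + z • p.1)) ⁻¹' F.graph := by
    ext p
    exact mem_graph_subScalar
  change IsClosed ((subScalar F z).graph : Set (X × X))
  rw [h1]
  exact IsClosed.preimage (by fun_prop) h

end Closure

/-! ### The resolvent of the free Hamiltonian -/

section FreeResolvent

variable {E : Type*} [NormedAddCommGroup E] [InnerProductSpace ℂ E] [CompleteSpace E]
  [TopologicalSpace.SeparableSpace E] {A : E →ₗ.[ℂ] E} {P : E →L[ℂ] E} {e z : ℂ} {C : ℝ}

theorem norm_kappa_le (q : ℝ≥0) : ‖((theta q - q : ℝ) : ℂ)‖ ≤ 1 := by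
  have h1 := le_theta q
  have h2 : theta q ≤ q + 1 := max_le (by linarith) (by linarith [q.2])
  rw [Complex.norm_real, Real.norm_eq_abs, abs_of_nonneg (by linarith)]
  linarith

/-- The function `q ↦ (θ(q) - q) P` of the photon energy, which vanishes for `q ≥ 3/4`. -/
def kappaFn (P : E →L[ℂ] E) : EnergyFn E :=
  scalarEnergyFn E (fun q => ((theta q - q : ℝ) : ℂ)) (Complex.continuous_ofReal.comp
    (continuous_theta.sub NNReal.continuous_coe)) 1 norm_kappa_le *
      BoundedContinuousFunction.const ℝ≥0 P

theorem kappaFn_apply (P : E →L[ℂ] E) (q : ℝ≥0) (x : E) :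
    kappaFn P q x = ((theta q - q : ℝ) : ℂ) • P x := by
  rw [kappaFn, BoundedContinuousFunction.mul_apply, scalarEnergyFn_apply]
  rfl

/-- The function of the photon energy whose operator is the inverse of
`H_0 - z + P ⊗ (θ(H_f) - H_f)`. -/
def freeRes (A : E →ₗ.[ℂ] E) (P : E →L[ℂ] E) (e z : ℂ) : EnergyFn E :=
  resEnergyFn E * regRes A P e z

theorem one_add_ne_zero (q : ℝ≥0) : (1 : ℂ) + (q : ℝ) ≠ 0 := by
  have h : (0 : ℝ) < 1 + q := by positivity
  exact_mod_cast h.ne'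

theorem resEnergyFn_apply' (q : ℝ≥0) (x : E) : resEnergyFn E q x = (1 + ((q : ℝ) : ℂ))⁻¹ • x := by
  rw [resEnergyFn_apply, abs_of_nonneg (NNReal.coe_nonneg q)]
  push_cast
  rfl

theorem IsAtomicPoint.freeRes_apply (h : IsAtomicPoint A P e z C) (q : ℝ≥0) (x : E) :
    freeRes A P e z q x =
      redRes A P (z - (q : ℝ)) x + (e - z + (theta q : ℂ))⁻¹ • P x := by
  rw [freeRes, BoundedContinuousFunction.mul_apply]
  change resEnergyFn E q (regRes A P e z q x) = _
  rw [resEnergyFn_apply', h.regRes_apply, regResFn]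
  change _ • (((q : ℝ) + 1 : ℝ) : ℂ) • (redRes A P (z - (q : ℝ)) x + (e - z + (theta q : ℂ))⁻¹ • P x) = _
  rw [smul_smul]
  have h1 : (1 + ((q : ℝ) : ℂ))⁻¹ * (((q : ℝ) + 1 : ℝ) : ℂ) = 1 := by
    push_cast
    rw [add_comm]
    exact inv_mul_cancel₀ (by rw [add_comm]; exact one_add_ne_zero q)
  rw [h1, one_smul]

/-- `freeRes` is a left inverse of `A - z + q + (θ(q) - q) P`. -/
theorem IsAtomicPoint.freeRes_left (h : IsAtomicPoint A P e z C) (q : ℝ≥0) (x : A.domain) :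
    freeRes A P e z q (A x + ((q : ℝ) : ℂ) • (x : E) - z • (x : E) + kappaFn P q x) = x := by
  obtain ⟨hR, -⟩ := h.redRes_spec q
  obtain ⟨hne, -⟩ := norm_theta_le h.close q
  have h1 := hR.left x
  have h2 : A x + ((q : ℝ) : ℂ) • (x : E) - z • (x : E) + kappaFn P q x =
      (A x - (z - (q : ℝ)) • (x : E)) + ((theta q - q : ℝ) : ℂ) • P x := by
    rw [kappaFn_apply, sub_smul]; abel
  rw [h2, h.freeRes_apply, map_add, h1, map_smul, hR.mul_proj, smul_zero, add_zero, map_add,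
    map_sub, h.commute, map_smul, map_smul, h.proj, ← sub_smul, ← add_smul, smul_smul]
  have h3 : (e - z + (theta q : ℂ))⁻¹ * (e - (z - ((q : ℝ) : ℂ)) + ((theta q - q : ℝ) : ℂ)) = 1 := by
    rw [← inv_mul_cancel₀ hne]
    push_cast
    ring
  rw [h3, one_smul, sub_add_cancel]

/-- `freeRes` is a right inverse of `A - z + q + (θ(q) - q) P`. -/
theorem IsAtomicPoint.freeRes_graph (h : IsAtomicPoint A P e z C) (q : ℝ≥0) (y : E) :
    (freeRes A P e z q y, y + (z - (q : ℝ)) • freeRes A P e z q y -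
      kappaFn P q (freeRes A P e z q y)) ∈ A.graph := by
  obtain ⟨hR, -⟩ := h.redRes_spec q
  obtain ⟨hne, -⟩ := norm_theta_le h.close q
  have h1 := A.graph.add_mem (hR.graph y)
    (A.graph.smul_mem (e - z + (theta q : ℂ))⁻¹ (h.graph y))
  rw [kappaFn_apply, h.freeRes_apply]
  convert h1 using 1
  refine Prod.ext rfl ?_
  change _ = (z - (q : ℝ)) • redRes A P (z - (q : ℝ)) y + (y - P y) +
    (e - z + (theta q : ℂ))⁻¹ • e • P y
  rw [map_add, hR.proj_mul, map_smul, h.proj, zero_add]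
  have h3 : P y = ((e - z + (theta q : ℂ))⁻¹ * (e - z + (theta q : ℂ))) • P y := by
    rw [inv_mul_cancel₀ hne, one_smul]
  generalize redRes A P (z - (q : ℝ)) y = w
  rw [show y - P y = y - ((e - z + (theta q : ℂ))⁻¹ * (e - z + (theta q : ℂ))) • P y by rw [← h3]]
  push_cast
  module

theorem IsAtomicPoint.freeRes_injective (h : IsAtomicPoint A P e z C) (q : ℝ≥0) (y : E)
    (hy : freeRes A P e z q y = 0) : y = 0 := by
  have h1 := h.freeRes_graph q y
  rw [hy, smul_zero, map_zero, add_zero, sub_zero] at h1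
  exact A.graph_fst_eq_zero_snd h1 rfl

/-- The function of the photon energy with
`Z(q) = (1 + q)⁻¹ (A - z + q + (θ(q) - q) P) (l - A)⁻¹`. -/
def coreFn (A : E →ₗ.[ℂ] E) (P : E →L[ℂ] E) (z l : ℂ) : EnergyFn E :=
  resEnergyFn E * (BoundedContinuousFunction.const ℝ≥0 ((l - z - 1) • res A l - 1) +
    kappaFn P * BoundedContinuousFunction.const ℝ≥0 (res A l)) +
    BoundedContinuousFunction.const ℝ≥0 (res A l)

theorem coreFn_apply {l : ℂ} (hl : l ∈ resSet A) (P : E →L[ℂ] E) (z : ℂ) (q : ℝ≥0) (v : E)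
    (hd : res A l v ∈ A.domain) :
    coreFn A P z l q v = (1 + ((q : ℝ) : ℂ))⁻¹ • (A ⟨res A l v, hd⟩ + ((q : ℝ) : ℂ) • res A l v -
      z • res A l v + kappaFn P q (res A l v)) := by
  rw [(isResolventAt_res hl).apply v hd]
  change resEnergyFn E q (((l - z - 1) • res A l v - v) + kappaFn P q (res A l v)) + res A l v = _
  rw [resEnergyFn_apply']
  generalize res A l v = w
  generalize kappaFn P q w = w'
  have h3 : w = (1 + ((q : ℝ) : ℂ))⁻¹ • (1 + ((q : ℝ) : ℂ)) • w := by
    rw [smul_smul, inv_mul_cancel₀ (one_add_ne_zero q), one_smul]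
  nth_rw 2 [h3]
  rw [← smul_add]
  congr 1
  module

/-- Every value of `coreFn` is a composition of surjections, `A - z + q + (θ(q) - q) P` being
invertible. -/
theorem IsAtomicPoint.coreFn_surjective (h : IsAtomicPoint A P e z C) {l : ℂ} (hl : l ∈ resSet A)
    (q : ℝ≥0) : Function.Surjective (coreFn A P z l q) := by
  intro y
  have hg := h.freeRes_graph q ((1 + ((q : ℝ) : ℂ)) • y)
  set x := freeRes A P e z q ((1 + ((q : ℝ) : ℂ)) • y) with hx
  have hd := LinearPMap.mem_domain_of_mem_graph hg
  have hA := apply_eq_of_mem_graph hg hd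
  have hS := (isResolventAt_res hl).2 ⟨x, hd⟩
  refine ⟨l • x - A ⟨x, hd⟩, ?_⟩
  have hd' : res A l (l • x - A ⟨x, hd⟩) ∈ A.domain := by rw [hS]; exact hd
  rw [coreFn_apply hl P z q _ hd']
  have h4 : (⟨res A l (l • x - A ⟨x, hd⟩), hd'⟩ : A.domain) = ⟨x, hd⟩ := Subtype.ext hS
  rw [h4, hS, hA]
  have h5 : (1 + ((q : ℝ) : ℂ)) • y + (z - ((q : ℝ) : ℂ)) • x - kappaFn P q x +
      ((q : ℝ) : ℂ) • x - z • x + kappaFn P q x = (1 + ((q : ℝ) : ℂ)) • y := by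
    rw [sub_smul]; abel
  rw [h5, smul_smul, inv_mul_cancel₀ (one_add_ne_zero q), one_smul]

end FreeResolvent

/-! ### The graph of the Hamiltonian -/

section HamiltonianGraph

theorem fock_sub_ae {F : Type*} [NormedAddCommGroup F] [InnerProductSpace ℂ F] (f g : Fock F) (n : ℕ) :
    ∀ᵐ k ∂configMeasure n, ((f - g) n : Lp F 2 (configMeasure n)) k =
      (f n : Lp F 2 (configMeasure n)) k - (g n : Lp F 2 (configMeasure n)) k :=
  Lp.coeFn_sub (f n : Lp F 2 (configMeasure n)) (g n : Lp F 2 (configMeasure n))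

theorem mem_graph_Hf {p : Fock ℂ × Fock ℂ} : p ∈ Hf.graph ↔ ∀ n, ∀ᵐ k ∂configMeasure n,
    (p.2 n : Lp ℂ 2 (configMeasure n)) k =
      (energy k : ℂ) * (p.1 n : Lp ℂ 2 (configMeasure n)) k := by
  unfold Hf
  rw [Submodule.toLinearPMap_graph_eq]
  · rfl
  · intro p hp h0
    refine fock_ext_ae fun n => ?_
    filter_upwards [hp n, fock_zero_ae (E := ℂ) n] with k h1 h2
    rw [h1, h0, h2, mul_zero]

theorem resHf_mem_graph_Hf (ψ : Fock ℂ) : (resHf ℂ ψ, ψ - resHf ℂ ψ) ∈ Hf.graph := by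
  refine mem_graph_Hf.2 fun n => ?_
  filter_upwards [resHf_ae ψ n, fock_sub_ae ψ (resHf ℂ ψ) n] with k h1 h2
  change ((ψ - resHf ℂ ψ : Fock ℂ) n : Lp ℂ 2 (configMeasure n)) k =
    (energy k : ℂ) * (resHf ℂ ψ n : Lp ℂ 2 (configMeasure n)) k
  rw [h2, h1, abs_of_nonneg (energy_nonneg k)]
  have h3 : (1 : ℂ) + (energy k : ℂ) ≠ 0 := by
    have h : (0 : ℝ) < 1 + energy k := by linarith [energy_nonneg k]
    exact_mod_cast h.ne'
  push_cast
  rw [smul_eq_mul]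
  field_simp
  ring

variable {E : Type*} [NormedAddCommGroup E] [InnerProductSpace ℂ E] [CompleteSpace E]
  [TopologicalSpace.SeparableSpace E] {A : E →ₗ.[ℂ] E} {P : E →L[ℂ] E} {e z : ℂ} {C : ℝ}

/-- The spanning set of the graph of `A ⊗ 1 + 1 ⊗ H_f` on the algebraic tensor product. -/
def corePairs (A : E →ₗ.[ℂ] E) : Set (Fock E × Fock E) :=
  {p | ∃ (φ : A.domain) (ψ : Hf.domain), p = (tmul (φ : E) (ψ : Fock ℂ),
      tmul (A φ) (ψ : Fock ℂ) + tmul (φ : E) (Hf ψ))}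

variable (A P z) in
/-- `(x, y) ↦ y - z x + P ⊗ (θ(H_f) - H_f) x`. -/
def coreMap : Fock E × Fock E →L[ℂ] Fock E :=
  ContinuousLinearMap.snd ℂ (Fock E) (Fock E) - z • ContinuousLinearMap.fst ℂ (Fock E) (Fock E) +
    (opFn (kappaFn P)).comp (ContinuousLinearMap.fst ℂ (Fock E) (Fock E))

/-- On elementary tensors `coreMap` acts at photon energy `q` as `A - z + q + (θ(q) - q) P`. -/
theorem coreMap_ae (φ : A.domain) (ψ : Hf.domain) (n : ℕ) : ∀ᵐ k ∂configMeasure n,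
    (coreMap P z (tmul (φ : E) (ψ : Fock ℂ), tmul (A φ) (ψ : Fock ℂ) + tmul (φ : E) (Hf ψ)) n :
      Lp E 2 (configMeasure n)) k = ((ψ : Fock ℂ) n : Lp ℂ 2 (configMeasure n)) k •
        (A φ + ((nnEnergy k : ℝ) : ℂ) • (φ : E) - z • (φ : E) + kappaFn P (nnEnergy k) φ) := by
  set a := tmul (φ : E) (ψ : Fock ℂ) with ha
  set b := tmul (A φ) (ψ : Fock ℂ) with hb
  set d := tmul (φ : E) (Hf ψ) with hd
  have hg : ((ψ : Fock ℂ), Hf ψ) ∈ Hf.graph := Hf.mem_graph ψ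
  filter_upwards [tmul_ae (φ : E) (ψ : Fock ℂ) n, tmul_ae (A φ) (ψ : Fock ℂ) n,
    tmul_ae (φ : E) (Hf ψ) n, opFn_ae (kappaFn P) a n, fock_add_ae b d n,
    fock_smul_ae z a n, fock_sub_ae (b + d) (z • a) n,
    fock_add_ae (b + d - z • a) (opFn (kappaFn P) a) n, mem_graph_Hf.1 hg n]
    with k h1 h2 h3 h4 h5 h6 h7 h8 h9
  change ((b + d - z • a + opFn (kappaFn P) a : Fock E) n : Lp E 2 (configMeasure n)) k = _
  rw [h8, h7, h6, h5, h4, h1, h2, h3, h9, coe_nnEnergy, map_smul]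
  generalize ((ψ : Fock ℂ) n : Lp ℂ 2 (configMeasure n)) k = c
  generalize kappaFn P (nnEnergy k) φ = w
  module

/-- On the algebraic core, `R (H_0 - z + K) = 1` with `R = freeRes(H_f)` and `K = kappaFn(H_f)`. -/
theorem IsAtomicPoint.opFn_freeRes_coreMap (h : IsAtomicPoint A P e z C) {p : Fock E × Fock E}
    (hp : p ∈ Submodule.span ℂ (corePairs A)) :
    p.1 = opFn (freeRes A P e z) (coreMap P z p) := by
  have h1 : Submodule.span ℂ (corePairs A) ≤ LinearMap.ker
      (ContinuousLinearMap.fst ℂ (Fock E) (Fock E) -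
        (opFn (freeRes A P e z)).comp (coreMap P z)).toLinearMap := by
    rw [Submodule.span_le]
    rintro _ ⟨φ, ψ, rfl⟩
    refine sub_eq_zero.2 ?_
    refine fock_ext_ae fun n => ?_
    filter_upwards [coreMap_ae (P := P) (z := z) φ ψ n, tmul_ae (φ : E) (ψ : Fock ℂ) n,
      opFn_ae (freeRes A P e z) (coreMap P z (tmul (φ : E) (ψ : Fock ℂ),
        tmul (A φ) (ψ : Fock ℂ) + tmul (φ : E) (Hf ψ))) n] with k h1 h2 h3
    refine h2.trans (Eq.trans ?_ h3.symm)
    rw [h1, map_smul, h.freeRes_left]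
  exact sub_eq_zero.1 (h1 hp)

theorem IsAtomicPoint.opFn_freeRes_injective (h : IsAtomicPoint A P e z C) (u : Fock E)
    (hu : opFn (freeRes A P e z) u = 0) : u = 0 :=
  opFn_injective_of h.freeRes_injective hu

/-- `H_at ⊗ 1 + 1 ⊗ H_f` is a well-defined operator on the algebraic tensor product of the domains.
-/
theorem IsAtomicPoint.graph_freeCore (h : IsAtomicPoint A P e z C) :
    (freeCore A).graph = Submodule.span ℂ (corePairs A) := by
  refine Submodule.toLinearPMap_graph_eq _ fun p hp h0 => ?_
  have h1 := h.opFn_freeRes_coreMap hp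
  rw [h0] at h1
  have h2 := h.opFn_freeRes_injective _ h1.symm
  change p.2 - z • p.1 + opFn (kappaFn P) p.1 = 0 at h2
  rwa [h0, smul_zero, map_zero, sub_zero, add_zero] at h2

/-- `H_0 - z + K` has dense range on the algebraic core: composed with `(l - A)⁻¹ ⊗ (1 + H_f)⁻¹` it
is the bounded operator `coreFn(H_f)`, whose range is dense. -/
theorem IsAtomicPoint.dense_coreMap
    (h : IsAtomicPoint A P e z C) :
    Dense {u : Fock E | ∃ p ∈ (freeCore A).graph, u = coreMap P z p} := by
  obtain ⟨l, hl⟩ := h.resolvent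
  set M : Submodule ℂ (Fock E) :=
    (Submodule.span ℂ (corePairs A)).map (coreMap P z).toLinearMap with hM
  have h1 : {u : Fock E | ∃ p ∈ (freeCore A).graph, u = coreMap P z p} = (M : Set (Fock E)) := by
    ext u
    rw [h.graph_freeCore]
    exact ⟨fun ⟨p, hp, hu⟩ => ⟨p, hp, hu.symm⟩, fun ⟨p, hp, hu⟩ => ⟨p, hp, hu.symm⟩⟩
  rw [h1]
  have h2 : Submodule.span ℂ {f : Fock E | ∃ (φ : E) (n : ℕ) (ψ : Sector ℂ n),
      f = tmul φ (lp.single 2 n ψ)} ≤ M.comap (opFn (coreFn A P z l)).toLinearMap := by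
    rw [Submodule.span_le]
    rintro _ ⟨v, n, ψ, rfl⟩
    have hd := (isResolventAt_res hl).mem v
    have hg := resHf_mem_graph_Hf (lp.single 2 n ψ)
    set ψ' : Fock ℂ := lp.single 2 n ψ with hψ'
    have hdf := LinearPMap.mem_domain_of_mem_graph hg
    refine ⟨_, Submodule.subset_span ⟨⟨res A l v, hd⟩, ⟨resHf ℂ ψ', hdf⟩, rfl⟩, ?_⟩
    change coreMap P z _ = opFn (coreFn A P z l) (tmul v ψ')
    refine fock_ext_ae fun m => ?_
    filter_upwards [coreMap_ae (P := P) (z := z) ⟨res A l v, hd⟩ ⟨resHf ℂ ψ', hdf⟩ m,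
      resHf_ae ψ' m, opFn_ae (coreFn A P z l) (tmul v ψ') m, tmul_ae v ψ' m] with k h3 h4 h5 h6
    rw [h3, h5, h6, map_smul, coreFn_apply hl P z _ v hd, h4, coe_nnEnergy, smul_smul, mul_comm,
      abs_of_nonneg (energy_nonneg k), smul_eq_mul]
    push_cast
    rw [mul_comm]
  refine dense_closure.1 ((dense_range_opFn (h.coreFn_surjective (z := z) hl)).mono ?_)
  rintro _ ⟨f, rfl⟩
  have h3 := image_closure_subset_closure_image (opFn (coreFn A P z l)).continuous
    ⟨f, dense_span_tmul (E := E) f, rfl⟩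
  refine closure_mono ?_ h3
  rintro _ ⟨f', hf', rfl⟩
  exact h2 hf'

/-- The graphs of `H_g - z`, in terms of the free resolvent and the bounded operator
`W(s) (1 + H_f)⁻¹`. -/
theorem IsAtomicPoint.graph_Hg {ν : ℕ}
    {T : (Fin ν → ℂ) → (E →ₗ.[ℂ] E)} {G : (Fin ν → ℂ) → WeakL2 E} {s : Fin ν → ℂ}
    (h : IsAtomicPoint (T s) P e z C) (hG : weightedNormSq (G s) ≠ ⊤)
    (hG' : weightedNormSq (G (star s)) ≠ ⊤) {g : ℝ}
    (hg : ‖(g : ℂ) • (boundedInteraction G s * opFn (regRes (T s) P e z))‖ < 1) :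
    (subScalar (Hg T G g s) z).IsClosed ∧ ∀ p, p ∈ (subScalar (Hg T G g s) z).graph ↔ ∃ u,
      p = (opFn (freeRes (T s) P e z) u,
        u - opFn (kappaFn P) (opFn (freeRes (T s) P e z) u) +
        ((g : ℂ) • (boundedInteraction G s * opFn (regRes (T s) P e z))) u) := by
  have h1 := graph_closure_perturbed (X := Fock E) (F := freeCore (T s))
    (W := (g : ℂ) • interaction G s) (R := opFn (freeRes (T s) P e z)) (K := opFn (kappaFn P))
    (B := (g : ℂ) • (boundedInteraction G s * opFn (regRes (T s) P e z))) (z := z)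
    (fun p hp => by
      rw [h.graph_freeCore] at hp
      exact h.opFn_freeRes_coreMap hp)
    h.opFn_freeRes_injective h.dense_coreMap
    (fun u => by
      refine mem_graph_smul (X := Fock E) (g : ℂ) ?_
      rw [freeRes, opFn_mul, ← resHf_eq_opFn]
      exact interaction_resHf_mem hG hG' _) hg
  refine ⟨isClosed_subScalar h1.1 z, fun p => ?_⟩
  obtain ⟨x, y⟩ := p
  rw [mem_graph_subScalar]
  refine (h1.2 _).trans (exists_congr fun u => ?_)
  rw [Prod.mk.injEq, Prod.mk.injEq]
  refine and_congr_right fun hx => ?_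
  rw [hx, add_right_comm, add_left_inj]

end HamiltonianGraph

/-! ### Cutoff operators -/

section OnePhoton

/-- One-photon configurations with energy in a given interval form a set of positive measure. -/
theorem exists_one_photon {a b : ℝ} (ha : 0 ≤ a) (hab : a < b) : ∃ S : Set (Fin 1 → Mode),
    MeasurableSet S ∧ configMeasure 1 S ≠ ⊤ ∧ configMeasure 1 S ≠ 0 ∧
      ∀ k ∈ S, a < energy k ∧ energy k < b := by
  set B : Set (EuclideanSpace ℝ (Fin 3)) := Metric.ball 0 b \ Metric.closedBall 0 a with hB
  have hopen : IsOpen B := Metric.isOpen_ball.sdiff Metric.isClosed_closedBall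
  have hne : B.Nonempty := by
    obtain ⟨x, hx⟩ := exists_norm_eq (EuclideanSpace ℝ (Fin 3)) (c := (a + b) / 2) (by linarith)
    refine ⟨x, ?_, ?_⟩
    · rw [mem_ball_zero_iff, hx]; linarith
    · rw [mem_closedBall_zero_iff, hx]; linarith
  have hvol : configMeasure 1 (Set.univ.pi fun _ => B ×ˢ (Set.univ : Set (Fin 2))) =
      volume B * 2 := by
    rw [configMeasure, Measure.pi_pi, Fin.prod_univ_one, modeMeasure, Measure.prod_prod,
      Measure.count_univ]
    simp
  refine ⟨Set.univ.pi fun _ => B ×ˢ (Set.univ : Set (Fin 2)), ?_, ?_, ?_, fun k hk => ?_⟩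
  · exact MeasurableSet.univ_pi fun _ => hopen.measurableSet.prod MeasurableSet.univ
  · rw [hvol]
    exact ENNReal.mul_ne_top
      ((measure_mono Set.sdiff_subset).trans_lt measure_ball_lt_top).ne (by norm_num)
  · rw [hvol]
    exact mul_ne_zero (hopen.measure_pos volume hne).ne' (by norm_num)
  · have h1 : energy k = ‖(k 0).1‖ := Fin.sum_univ_one _
    obtain ⟨⟨h2, h3⟩, -⟩ := hk 0 trivial
    rw [mem_ball_zero_iff] at h2
    rw [mem_closedBall_zero_iff, not_le] at h3
    rw [h1]
    exact ⟨h3, h2⟩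

variable {E : Type*} [NormedAddCommGroup E] [InnerProductSpace ℂ E]

/-- `F(H_f)` does not vanish if `F` does not vanish for the photon energies in some interval: it
acts non-trivially on one-photon states. -/
theorem opFn_ne_zero {F : EnergyFn E} {x : E} {a b : ℝ} (ha : 0 ≤ a) (hab : a < b)
    (h : ∀ q : ℝ≥0, a < q → q < b → F q x ≠ 0) : opFn F ≠ 0 := by
  intro h0
  obtain ⟨S, hS, hS1, hS2, hS3⟩ := exists_one_photon ha hab
  have hmem : indicatorConstLp 2 hS hS1 (1 : ℂ) ∈ Sector ℂ 1 := by
    refine sector_of_ae _ fun σ => Eventually.of_forall fun k => ?_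
    have : (fun i => k (σ i)) = k := funext fun i => congrArg k (Subsingleton.elim _ _)
    rw [this]
  set ψ : Fock ℂ := lp.single 2 1 ⟨_, hmem⟩ with hψ
  have h1 : ∀ᵐ k ∂configMeasure 1, k ∉ S := by
    filter_upwards [opFn_ae F (tmul x ψ) 1, tmul_ae x ψ 1, fock_zero_ae (E := E) 1,
      indicatorConstLp_coeFn (p := 2) (hs := hS) (hμs := hS1) (c := (1 : ℂ))] with k h1 h2 h3 h4 hk
    have h5 : (ψ 1 : Lp ℂ 2 (configMeasure 1)) k = 1 := by
      rw [hψ, lp.single_apply_self]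
      refine h4.trans ?_
      rw [Set.indicator_of_mem hk]
    rw [h2, h5, one_smul, h0] at h1
    obtain ⟨h6, h7⟩ := hS3 k hk
    rw [← coe_nnEnergy] at h6 h7
    exact h _ h6 h7 (h1.symm.trans h3)
  rw [ae_iff] at h1
  simp only [not_not, Set.ofPred_mem_eq] at h1
  exact hS2 h1

end OnePhoton

section Cutoffs

variable {E : Type*} [NormedAddCommGroup E] [InnerProductSpace ℂ E]

theorem opFn_comp_eq {F₁ F₂ F : EnergyFn E} (h : ∀ q v, F₁ q (F₂ q v) = F q v) (f : Fock E) :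
    opFn F₁ (opFn F₂ f) = opFn F f := by
  have h1 : F₁ * F₂ = F := by
    ext q v
    exact h q v
  rw [← h1, opFn_mul]
  rfl

theorem opFn_comm {F₁ F₂ : EnergyFn E} (h : ∀ q v, F₁ q (F₂ q v) = F₂ q (F₁ q v)) (f : Fock E) :
    opFn F₁ (opFn F₂ f) = opFn F₂ (opFn F₁ f) :=
  (opFn_comp_eq (F := F₂ * F₁) h f).trans (opFn_comp_eq (fun _ _ => rfl) f).symm

theorem opFn_comp_zero {F₁ F₂ : EnergyFn E} (h : ∀ q v, F₁ q (F₂ q v) = 0) (f : Fock E) :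
    opFn F₁ (opFn F₂ f) = 0 := by
  refine fock_ext_ae fun n => ?_
  filter_upwards [opFn_ae F₁ (opFn F₂ f) n, opFn_ae F₂ f n, fock_zero_ae (E := E) n] with k h1 h2 h3
  rw [h1, h2, h, h3]

theorem Cutoff.norm_chi_le (c : Cutoff) (t : ℝ) : ‖((c.chi t : ℝ) : ℂ)‖ ≤ 1 := by
  rw [Complex.norm_real, Real.norm_of_nonneg (c.mem t).1]
  exact (c.mem t).2

theorem Cutoff.norm_chi'_le (c : Cutoff) (t : ℝ) : ‖((c.chi' t : ℝ) : ℂ)‖ ≤ 1 := by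
  rw [Complex.norm_real, Real.norm_of_nonneg (c.mem' t).1]
  exact (c.mem' t).2

theorem Cutoff.chi'_eq_zero (c : Cutoff) {t : ℝ} (ht : t ≤ 3 / 4) : c.chi' t = 0 := by
  have h := c.sq_add_sq t
  rw [c.eq_one t ht] at h
  exact pow_eq_zero_iff (two_ne_zero) |>.1 (by linarith)

theorem Cutoff.chi'_eq_one (c : Cutoff) {t : ℝ} (ht : 1 ≤ t) : c.chi' t = 1 := by
  have h := c.sq_add_sq t
  rw [c.eq_zero t ht] at h
  have h1 := (c.mem' t).1
  nlinarith

/-- A continuous function `ℝ → ℝ` as a function on `[0, ∞)` with complex values is continuous. -/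
theorem continuous_ofReal_coe {f : ℝ → ℝ} (hf : Continuous f) :
    Continuous fun q : ℝ≥0 => ((f q : ℝ) : ℂ) :=
  Complex.continuous_ofReal.comp (hf.comp NNReal.continuous_coe)

variable [CompleteSpace E] [TopologicalSpace.SeparableSpace E]

variable (E) in
/-- The function `q ↦ χ(q)` of the photon energy. -/
def Cutoff.chiFn (c : Cutoff) : EnergyFn E :=
  scalarEnergyFn E (fun q => (c.chi q : ℂ)) (continuous_ofReal_coe c.smooth.continuous) 1
    fun q => c.norm_chi_le q

variable (E) in
/-- The function `q ↦ χ'(q)` of the photon energy. -/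
def Cutoff.chi'Fn (c : Cutoff) : EnergyFn E :=
  scalarEnergyFn E (fun q => (c.chi' q : ℂ)) (continuous_ofReal_coe c.smooth'.continuous) 1
    fun q => c.norm_chi'_le q

theorem Cutoff.chi₁_eq (c : Cutoff) : c.chi₁ E = opFn (c.chiFn E) :=
  fnHf_eq_opFn fun q => scalarEnergyFn_apply _ _ _ _ q

theorem Cutoff.chi'₁_eq (c : Cutoff) : c.chi'₁ E = opFn (c.chi'Fn E) :=
  fnHf_eq_opFn fun q => scalarEnergyFn_apply _ _ _ _ q

/-- The function of the photon energy whose operator is `P ⊗ χ₁`. -/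
def cutFn (c : Cutoff) (P : E →L[ℂ] E) : EnergyFn E :=
  BoundedContinuousFunction.const ℝ≥0 P * c.chiFn E

/-- The function of the photon energy whose operator is `(1 - P) ⊗ 1 + P ⊗ χ'₁`. -/
def cut'Fn (c : Cutoff) (P : E →L[ℂ] E) : EnergyFn E :=
  BoundedContinuousFunction.const ℝ≥0 (1 - P) +
    BoundedContinuousFunction.const ℝ≥0 P * c.chi'Fn E

theorem boldChi_eq (c : Cutoff) (P : E →L[ℂ] E) : boldChi c P = opFn (cutFn c P) := by
  rw [boldChi, cutFn, opFn_mul, amp_eq_opFn, c.chi₁_eq]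

theorem boldChi'_eq (c : Cutoff) (P : E →L[ℂ] E) : boldChi' c P = opFn (cut'Fn c P) := by
  rw [boldChi', cut'Fn, opFn_add, opFn_mul, amp_eq_opFn, amp_eq_opFn, c.chi'₁_eq]

theorem Cutoff.chiFn_apply (c : Cutoff) (q : ℝ≥0) (x : E) : c.chiFn E q x = (c.chi q : ℂ) • x := by
  rw [Cutoff.chiFn, scalarEnergyFn_apply]
  rfl

theorem Cutoff.chi'Fn_apply (c : Cutoff) (q : ℝ≥0) (x : E) :
    c.chi'Fn E q x = (c.chi' q : ℂ) • x := by
  rw [Cutoff.chi'Fn, scalarEnergyFn_apply]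
  rfl

theorem cutFn_apply (c : Cutoff) (P : E →L[ℂ] E) (q : ℝ≥0) (x : E) :
    cutFn c P q x = (c.chi q : ℂ) • P x := by
  change P (c.chiFn E q x) = _
  rw [c.chiFn_apply, map_smul]

theorem cut'Fn_apply (c : Cutoff) (P : E →L[ℂ] E) (q : ℝ≥0) (x : E) :
    cut'Fn c P q x = x - P x + (c.chi' q : ℂ) • P x := by
  change (x - P x) + P (c.chi'Fn E q x) = _
  rw [c.chi'Fn_apply, map_smul]

theorem cutFn_sq_add_sq (c : Cutoff) {P : E →L[ℂ] E} (hP : ∀ x, P (P x) = P x) (f : Fock E) :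
    opFn (cutFn c P) (opFn (cutFn c P) f) + opFn (cut'Fn c P) (opFn (cut'Fn c P) f) = f := by
  have h1 : cutFn c P * cutFn c P + cut'Fn c P * cut'Fn c P = 1 := by
    ext q v
    change cutFn c P q (cutFn c P q v) + cut'Fn c P q (cut'Fn c P q v) = v
    simp only [cutFn_apply, cut'Fn_apply, map_add, map_sub, map_smul, hP]
    have h2 : (c.chi q : ℂ) ^ 2 + (c.chi' q : ℂ) ^ 2 = 1 := by exact_mod_cast c.sq_add_sq q
    have h3 : P v = ((c.chi q : ℂ) ^ 2 + (c.chi' q : ℂ) ^ 2) • P v := by rw [h2, one_smul]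
    have h4 : v = (v - P v) + ((c.chi q : ℂ) ^ 2 + (c.chi' q : ℂ) ^ 2) • P v := by
      rw [← h3, sub_add_cancel]
    conv_rhs => rw [h4]
    module
  have h2 := congrArg opFn h1
  rw [opFn_add, opFn_mul, opFn_mul, opFn_one] at h2
  exact DFunLike.congr_fun h2 f

theorem norm_cut'Fn_le (c : Cutoff) (P : E →L[ℂ] E) : ‖cut'Fn c P‖ ≤ ‖1 - P‖ + ‖P‖ := by
  refine (BoundedContinuousFunction.norm_le (by positivity)).2 fun q => ?_
  refine ContinuousLinearMap.opNorm_le_bound _ (by positivity) fun x => ?_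
  rw [cut'Fn_apply, add_mul]
  refine (norm_add_le _ _).trans (add_le_add ((1 - P).le_opNorm x) ?_)
  rw [norm_smul]
  refine le_trans ?_ (P.le_opNorm x)
  exact mul_le_of_le_one_left (norm_nonneg _) (c.norm_chi'_le q)

end Cutoffs

/-! ### The Feshbach data of the Hamiltonian -/

section Feshbach

variable {E : Type*} [NormedAddCommGroup E] [InnerProductSpace ℂ E] [CompleteSpace E]
  [TopologicalSpace.SeparableSpace E] {A : E →ₗ.[ℂ] E} {P : E →L[ℂ] E} {e z : ℂ} {C : ℝ}

theorem norm_mul_theta_le (h : ‖e - z‖ < 1 / 2) {a : ℝ} (ha : a ∈ Set.Icc (0 : ℝ) 1) {q : ℝ≥0}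
    (hq : 1 ≤ (q : ℝ) → a = 0) : ‖(a : ℂ) * (e - z + (theta q : ℂ))‖ ≤ 2 := by
  rcases le_or_gt 1 (q : ℝ) with h1 | h1
  · rw [hq h1]
    simp
  · have h2 : theta q ≤ 1 := max_le h1.le (by norm_num)
    have h3 : ‖((theta q : ℝ) : ℂ)‖ ≤ 1 := by
      rw [Complex.norm_real, Real.norm_of_nonneg (by linarith [theta_ge q])]
      exact h2
    have h4 : ‖(a : ℂ)‖ ≤ 1 := by
      rw [Complex.norm_real, Real.norm_of_nonneg ha.1]
      exact ha.2
    rw [norm_mul]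
    have h5 := norm_add_le (e - z) (theta q : ℂ)
    calc ‖(a : ℂ)‖ * ‖e - z + (theta q : ℂ)‖ ≤ 1 * 2 :=
          mul_le_mul h4 (by linarith) (norm_nonneg _) zero_le_one
      _ = 2 := one_mul _

theorem continuous_mul_theta (e z : ℂ) {f : ℝ → ℝ} (hf : Continuous f) :
    Continuous fun q : ℝ≥0 => ((f q : ℝ) : ℂ) * (e - z + (theta q : ℂ)) :=
  (continuous_ofReal_coe hf).mul (continuous_const.add
    (Complex.continuous_ofReal.comp continuous_theta))

/-- The function `q ↦ f(q) (e - z + θ(q)) P` for a function `f` that vanishes on `[1, ∞)`. -/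
def liftFn (P : E →L[ℂ] E) (h : ‖e - z‖ < 1 / 2) (f : ℝ → ℝ) (hf : Continuous f)
    (hf' : ∀ t, f t ∈ Set.Icc (0 : ℝ) 1) (hf'' : ∀ t, 1 ≤ t → f t = 0) : EnergyFn E :=
  scalarEnergyFn E (fun q => ((f q : ℝ) : ℂ) * (e - z + (theta q : ℂ)))
    (continuous_mul_theta e z hf) 2 (fun q => norm_mul_theta_le h (hf' q) (hf'' q)) *
      BoundedContinuousFunction.const ℝ≥0 P

theorem liftFn_apply (h : ‖e - z‖ < 1 / 2) (f : ℝ → ℝ) (hf hf' hf'') (q : ℝ≥0) (x : E) :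
    liftFn P h f hf hf' hf'' q x = (((f q : ℝ) : ℂ) * (e - z + (theta q : ℂ))) • P x := by
  rw [liftFn, BoundedContinuousFunction.mul_apply, scalarEnergyFn_apply]
  rfl

theorem IsAtomicPoint.proj_freeRes (h : IsAtomicPoint A P e z C) (q : ℝ≥0) (x : E) :
    P (freeRes A P e z q x) = (e - z + (theta q : ℂ))⁻¹ • P x := by
  obtain ⟨hR, -⟩ := h.redRes_spec q
  rw [h.freeRes_apply, map_add, hR.proj_mul, map_smul, h.proj, zero_add]

theorem IsAtomicPoint.freeRes_proj (h : IsAtomicPoint A P e z C) (q : ℝ≥0) (x : E) :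
    freeRes A P e z q (P x) = (e - z + (theta q : ℂ))⁻¹ • P x := by
  obtain ⟨hR, -⟩ := h.redRes_spec q
  rw [h.freeRes_apply, hR.mul_proj, h.proj, zero_add]

/-- `f(H_f) P` factors through `R` for a function `f` that vanishes on `[1, ∞)`. -/
theorem IsAtomicPoint.liftFn_freeRes (h : IsAtomicPoint A P e z C) (f : ℝ → ℝ) (hf hf' hf'')
    (q : ℝ≥0) (x : E) :
    liftFn P h.close f hf hf' hf'' q (freeRes A P e z q x) = ((f q : ℝ) : ℂ) • P x := by
  obtain ⟨hne, -⟩ := norm_theta_le h.close q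
  rw [liftFn_apply, h.proj_freeRes, smul_smul, mul_assoc, mul_inv_cancel₀ hne, mul_one]

/-- `θ(q) = q` where `χ'(q) ≠ 0`. -/
theorem kappa_mul_chi' (c : Cutoff) (q : ℝ≥0) :
    ((theta q - q : ℝ) : ℂ) * (c.chi' q : ℂ) = 0 := by
  rcases le_total (q : ℝ) (3 / 4) with h | h
  · rw [c.chi'_eq_zero h, Complex.ofReal_zero, mul_zero]
  · rw [theta, max_eq_left h, sub_self, Complex.ofReal_zero, zero_mul]

/-- The Feshbach data of `H_g - z` and `H_0 - z`. -/
theorem IsAtomicPoint.exists_feshbachData {ν : ℕ}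
    {T : (Fin ν → ℂ) → (E →ₗ.[ℂ] E)} {G : (Fin ν → ℂ) → WeakL2 E} {s : Fin ν → ℂ}
    (h : IsAtomicPoint (T s) P e z C) (hG : weightedNormSq (G s) ≠ ⊤)
    (hG' : weightedNormSq (G (star s)) ≠ ⊤) (c : Cutoff) {g : ℝ}
    (hg : ‖(g : ℂ) • (boundedInteraction G s * opFn (regRes (T s) P e z))‖ < 1)
    (hg' : ‖boldChi' c P * ((g : ℂ) • (boundedInteraction G s * opFn (regRes (T s) P e z))) *
      boldChi' c P‖ < 1) : ∃ J J', FeshbachData (subScalar (Hg T G g s) z)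
        (subScalar (Hg T G 0 s) z) (boldChi c P) (boldChi' c P) (opFn (freeRes (T s) P e z))
        (opFn (kappaFn P)) ((g : ℂ) • (boundedInteraction G s * opFn (regRes (T s) P e z)))
        J J' := by
  obtain ⟨hH1, hH2⟩ := h.graph_Hg hG hG' hg
  obtain ⟨hT1, hT2⟩ := h.graph_Hg (g := 0) hG hG' (by
    rw [Complex.ofReal_zero, zero_smul]
    exact (norm_zero (E := Fock E →L[ℂ] Fock E)).trans_lt zero_lt_one)
  obtain ⟨x, hx⟩ : ∃ x, P x ≠ 0 := by
    by_contra! h0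
    exact h.ne_zero (ContinuousLinearMap.ext h0)
  have hone : ∀ t, 1 - c.chi' t ∈ Set.Icc (0 : ℝ) 1 := fun t =>
    ⟨by linarith [(c.mem' t).2], by linarith [(c.mem' t).1]⟩
  have hPc : ∀ q, P (cut'Fn c P q x) = (c.chi' q : ℂ) • P x := fun q => by
    rw [cut'Fn_apply, map_add, map_sub, map_smul, h.proj, sub_self, zero_add]
  refine ⟨opFn (liftFn P h.close (fun t => 1 - c.chi' t)
      (continuous_const.sub c.smooth'.continuous) hone
      fun t ht => by rw [c.chi'_eq_one ht, sub_self]),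
    opFn (liftFn P h.close c.chi c.smooth.continuous c.mem c.eq_zero), ?_⟩
  rw [boldChi'_eq] at hg' ⊢
  rw [boldChi_eq]
  exact
  { graph_T := fun p => by
      rw [hT2]
      simp
    graph_H := hH2
    closed_T := hT1
    closed_H := hH1
    comm := opFn_comm fun q v => by
      simp only [cutFn_apply, cut'Fn_apply, map_add, map_sub, map_smul, h.proj]
      module
    sq_add_sq := cutFn_sq_add_sq c h.proj
    ne_zero := opFn_ne_zero (x := x) (a := 1 / 4) (b := 1 / 2) (by norm_num) (by norm_num)
      fun q _ hq => by
        rw [cutFn_apply, c.eq_one q (by linarith), Complex.ofReal_one, one_smul]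
        exact hx
    ne_zero' := opFn_ne_zero (x := x) (a := 2) (b := 3) (by norm_num) (by norm_num)
      fun q hq _ h0 => by
        have h1 := hPc q
        rw [h0, map_zero, c.chi'_eq_one (by linarith), Complex.ofReal_one, one_smul] at h1
        exact hx h1.symm
    R_chi := opFn_comm fun q v => by
      rw [cutFn_apply, cutFn_apply, map_smul, h.freeRes_proj, h.proj_freeRes]
    R_chi' := opFn_comm fun q v => by
      rw [cut'Fn_apply, cut'Fn_apply, map_add, map_sub, map_smul, h.freeRes_proj, h.proj_freeRes]
    K_chi := opFn_comm fun q v => by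
      simp only [cutFn_apply, kappaFn_apply, map_smul, h.proj]
      module
    K_chi' := opFn_comp_zero fun q v => by
      rw [kappaFn_apply, cut'Fn_apply, map_add, map_sub, map_smul, h.proj, sub_self, zero_add,
        smul_smul, kappa_mul_chi', zero_smul]
    chi'_K := opFn_comp_zero fun q v => by
      rw [kappaFn_apply, cut'Fn_apply, map_smul, h.proj, sub_self, zero_add,
        smul_smul, mul_comm, kappa_mul_chi', zero_smul]
    J_R := fun f => by
      refine (opFn_comp_eq (F := 1 - cut'Fn c P) (fun q v => ?_) f).trans ?_
      · rw [h.liftFn_freeRes]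
        change _ = v - cut'Fn c P q v
        rw [cut'Fn_apply]
        push_cast
        module
      · rw [opFn_sub, opFn_one]
        rfl
    J_chi' := opFn_comm fun q v => by
      simp only [cut'Fn_apply, liftFn_apply, map_add, map_sub, map_smul, h.proj]
      module
    J'_R := opFn_comp_eq fun q v => by
      rw [h.liftFn_freeRes, cutFn_apply]
    small := hg' }

end Feshbach

/-! ### The atomic expectation -/

section Expectation

variable {E : Type*} [NormedAddCommGroup E] [InnerProductSpace ℂ E]

theorem amp_functional_tmul (l : E →L[ℂ] ℂ) (φ : E) (ψ : Fock ℂ) : amp l (tmul φ ψ) = l φ • ψ := by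
  rw [amp_tmul]
  refine fock_ext_ae fun n => ?_
  filter_upwards [tmul_ae (l φ) ψ n, fock_smul_ae (l φ) ψ n] with k h1 h2
  rw [h1, h2, smul_eq_mul, smul_eq_mul, mul_comm]

theorem tmul_smul_left (a : ℂ) (φ : E) (ψ : Fock ℂ) : tmul (a • φ) ψ = a • tmul φ ψ := by
  refine fock_ext_ae fun n => ?_
  filter_upwards [tmul_ae (a • φ) ψ n, tmul_ae φ ψ n, fock_smul_ae a (tmul φ ψ) n] with k h1 h2 h3
  rw [h1, h3, h2, smul_comm]

theorem tmul_right_injective {φ : E} (hφ : φ ≠ 0) : Function.Injective (tmul φ) := by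
  intro ψ ψ' h
  have h1 := congrArg (amp (innerSL ℂ φ)) h
  rw [amp_functional_tmul, amp_functional_tmul] at h1
  exact smul_right_injective (Fock ℂ) (inner_self_ne_zero.2 hφ) h1

/-- For a projection `P` of rank one, the operator `⟨L⟩` with `(P ⊗ 1) L (P ⊗ 1) = P ⊗ ⟨L⟩`. Here
`φ` and `η` are vectors with `⟨η, P φ⟩ ≠ 0`. -/
def atExp (P : E →L[ℂ] E) (φ η : E) (L : Fock E →L[ℂ] Fock E) : Fock ℂ →L[ℂ] Fock ℂ :=
  (amp ((inner ℂ η (P φ))⁻¹ • (innerSL ℂ η).comp P)).comp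
    (L.comp (amp (P.comp (ContinuousLinearMap.toSpanSingleton ℂ φ))))

theorem atExp_apply (P : E →L[ℂ] E) (φ η : E) (L : Fock E →L[ℂ] Fock E) (ψ : Fock ℂ) :
    atExp P φ η L ψ =
      amp ((inner ℂ η (P φ))⁻¹ • (innerSL ℂ η).comp P) (L (tmul (P φ) ψ)) := by
  have h : P.comp (ContinuousLinearMap.toSpanSingleton ℂ φ) =
      ContinuousLinearMap.toSpanSingleton ℂ (P φ) := by
    ext
    simp
  rw [atExp, h]
  rfl

variable {P : E →L[ℂ] E} {φ η : E}

/-- `P v = ℓ(v) P φ` with `ℓ(v) = ⟨η, P v⟩ / ⟨η, P φ⟩`. -/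
theorem rankOne_apply (h1 : ∃ x, ∀ y, ∃ c : ℂ, P y = c • x) (hne : inner ℂ η (P φ) ≠ (0 : ℂ)) (v : E) :
    P v = ((inner ℂ η (P φ))⁻¹ • (innerSL ℂ η).comp P) v • P φ := by
  obtain ⟨x, hx⟩ := h1
  obtain ⟨a, ha⟩ := hx v
  obtain ⟨b, hb⟩ := hx φ
  change P v = ((inner ℂ η (P φ))⁻¹ * inner ℂ η (P v)) • P φ
  rw [hb, inner_smul_right] at hne
  rw [ha, hb, inner_smul_right, inner_smul_right, smul_smul]
  congr 1
  have h2 := left_ne_zero_of_mul hne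
  have h3 := right_ne_zero_of_mul hne
  field_simp

/-- `P ⊗ 1` maps into `Ran P ⊗ 𝓕`, with second factor given by a functional on `𝓗_at`. -/
theorem amp_rankOne (h1 : ∃ x, ∀ y, ∃ c : ℂ, P y = c • x) (hne : inner ℂ η (P φ) ≠ (0 : ℂ))
    (f : Fock E) :
    amp P f = tmul (P φ) (amp ((inner ℂ η (P φ))⁻¹ • (innerSL ℂ η).comp P) f) := by
  refine fock_ext_ae fun n => ?_
  filter_upwards [amp_ae P f n, tmul_ae (P φ)
    (amp ((inner ℂ η (P φ))⁻¹ • (innerSL ℂ η).comp P) f) n,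
    amp_ae ((inner ℂ η (P φ))⁻¹ • (innerSL ℂ η).comp P) f n] with k h2 h3 h4
  rw [h2, h3, h4]
  exact rankOne_apply h1 hne _

/-- `atExp` is the only solution of the equation that characterizes the atomic expectation. -/
theorem isAtExpectation_iff (h1 : ∃ x, ∀ y, ∃ c : ℂ, P y = c • x)
    (hne : inner ℂ η (P φ) ≠ (0 : ℂ)) {L : Fock E →ₗ.[ℂ] Fock E} {L' : Fock E →L[ℂ] Fock E}
    (hL : ∀ f, (f, L' f) ∈ L.graph) {B : Fock ℂ →L[ℂ] Fock ℂ} :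
    IsAtExpectation P L B ↔ B = atExp P φ η L' := by
  have hval : ∀ (φ' : E) (ψ : Fock ℂ), amp P (L' (tmul (P φ') ψ)) =
      tmul (P φ') (atExp P φ η L' ψ) := by
    intro φ' ψ
    have h2 := rankOne_apply h1 hne φ'
    set a := ((inner ℂ η (P φ))⁻¹ • (innerSL ℂ η).comp P) φ' with ha
    rw [h2, tmul_smul_left, map_smul, map_smul, tmul_smul_left, amp_rankOne h1 hne, atExp_apply]
  have hPφ : P φ ≠ 0 := fun h0 => hne (by rw [h0, inner_zero_right])
  constructor
  · intro h
    ext1 ψ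
    obtain ⟨hd, h2⟩ := h φ ψ
    rw [apply_eq_of_mem_graph (hL _) hd, hval] at h2
    exact tmul_right_injective hPφ h2.symm
  · rintro rfl φ' ψ
    have hd := LinearPMap.mem_domain_of_mem_graph (hL (tmul (P φ') ψ))
    refine ⟨hd, ?_⟩
    rw [apply_eq_of_mem_graph (hL _) hd, hval]

end Expectation

/-! ### Operators on the reduced space -/

section Reduced

theorem fnHf_fnHf_eq {a b d : BddBorel} (h : ∀ t, 0 ≤ t → a.toFun t * b.toFun t = d.toFun t)
    (f : Fock ℂ) : fnHf ℂ a (fnHf ℂ b f) = fnHf ℂ d f := by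
  refine fock_ext_ae fun n => ?_
  filter_upwards [fnHf_ae a (fnHf ℂ b f) n, fnHf_ae b f n, fnHf_ae d f n] with k h1 h2 h3
  rw [h1, h2, h3, smul_smul, h _ (energy_nonneg k)]

theorem indicator_Hred (ψ : Hred) :
    fnHf ℂ unitIntervalIndicator (ψ : Fock ℂ) = ψ := by
  obtain ⟨_, f, rfl⟩ := ψ
  refine fnHf_fnHf_eq (fun t _ => ?_) f
  by_cases ht : t ∈ Set.Icc (0 : ℝ) 1
  · simp only [unitIntervalIndicator, Set.indicator_of_mem ht, one_mul]
  · simp only [unitIntervalIndicator, Set.indicator_of_notMem ht, zero_mul]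

/-- The bounded function `t ↦ t 1_{[0,1]}(t)`. -/
def idIndicator : BddBorel where
  toFun := (Set.Icc (0 : ℝ) 1).indicator fun t => (t : ℂ)
  measurable := Complex.measurable_ofReal.indicator measurableSet_Icc
  bound := 1
  norm_le := fun t => by
    by_cases h : t ∈ Set.Icc (0 : ℝ) 1
    · rw [Set.indicator_of_mem h, Complex.norm_real, Real.norm_of_nonneg h.1]
      exact h.2
    · rw [Set.indicator_of_notMem h, norm_zero]
      exact zero_le_one

theorem indicator_idIndicator (f : Fock ℂ) :
    fnHf ℂ unitIntervalIndicator (fnHf ℂ idIndicator f) = fnHf ℂ idIndicator f := by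
  refine fnHf_fnHf_eq (fun t _ => ?_) f
  by_cases ht : t ∈ Set.Icc (0 : ℝ) 1
  · simp only [unitIntervalIndicator, idIndicator, Set.indicator_of_mem ht, one_mul]
  · simp only [unitIntervalIndicator, idIndicator, Set.indicator_of_notMem ht, zero_mul]

/-- `H_f` is bounded on `𝓗_red`. -/
theorem Hred_mem_graph_Hf (ψ : Hred) : ((ψ : Fock ℂ), fnHf ℂ idIndicator ψ) ∈ Hf.graph := by
  refine mem_graph_Hf.2 fun n => ?_
  have h0 := indicator_Hred ψ
  filter_upwards [fnHf_ae idIndicator (ψ : Fock ℂ) n,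
    fnHf_ae unitIntervalIndicator (ψ : Fock ℂ) n] with k h1 h2
  refine h1.trans ?_
  rw [h0] at h2
  by_cases ht : energy k ∈ Set.Icc (0 : ℝ) 1
  · simp only [idIndicator, Set.indicator_of_mem ht, smul_eq_mul]
  · simp only [unitIntervalIndicator, Set.indicator_of_notMem ht, zero_smul] at h2
    simp only [idIndicator, Set.indicator_of_notMem ht, zero_smul]
    rw [h2, mul_zero]

theorem fnHf_chi_mem_Hred (c : Cutoff) (f : Fock ℂ) : c.chi₁ ℂ f ∈ Hred := by
  refine ⟨c.chi₁ ℂ f, ?_⟩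
  refine fnHf_fnHf_eq (fun t h0 => ?_) f
  by_cases ht : t ∈ Set.Icc (0 : ℝ) 1
  · simp only [unitIntervalIndicator, Set.indicator_of_mem ht, one_mul]
  · have h1 : 1 ≤ t := by
      by_contra! h2
      exact ht ⟨h0, h2.le⟩
    simp only [unitIntervalIndicator, Set.indicator_of_notMem ht, zero_mul, bddBorelOf,
      c.eq_zero t h1, Complex.ofReal_zero]

/-- The compression of a bounded operator to a closed subspace, by a given bounded operator into
this subspace. -/
def compressL {X : Type*} [NormedAddCommGroup X] [NormedSpace ℂ X] (Y : Submodule ℂ X)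
    (Q : X →L[ℂ] Y) : (X →L[ℂ] X) →L[ℂ] (Y →L[ℂ] Y) :=
  clmOfBound (A := X →L[ℂ] X) (B := Y →L[ℂ] Y) (fun D => Q.comp (D.comp Y.subtypeL))
    (fun D D' => by ext1 x; exact map_add Q _ _) (fun a D => by ext1 x; exact map_smul Q _ _)
    (‖Q‖ * ‖Y.subtypeL‖) (fun D => by
      refine (ContinuousLinearMap.opNorm_comp_le _ _).trans ?_
      calc ‖Q‖ * ‖D.comp Y.subtypeL‖ ≤ ‖Q‖ * (‖D‖ * ‖Y.subtypeL‖) :=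
            mul_le_mul_of_nonneg_left (ContinuousLinearMap.opNorm_comp_le _ _) Q.opNorm_nonneg
        _ = _ := by ring)

/-- `P_{[0,1]}(H_f)` as an operator onto `𝓗_red`. -/
def projHred : Fock ℂ →L[ℂ] Hred :=
  (fnHf ℂ unitIntervalIndicator).codRestrict Hred fun f => ⟨f, rfl⟩

theorem projHred_of_mem {f : Fock ℂ} (hf : f ∈ Hred) : (projHred f : Fock ℂ) = f :=
  indicator_Hred ⟨f, hf⟩

end Reduced

/-! ### The effective Hamiltonian at a point -/

section Effective

local infixr:80 " ∘ₚ " => pcomp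

variable {E : Type*} [NormedAddCommGroup E] [InnerProductSpace ℂ E] [CompleteSpace E]
  [TopologicalSpace.SeparableSpace E] {A : E →ₗ.[ℂ] E} {P : E →L[ℂ] E} {e z : ℂ} {C : ℝ}

theorem Cutoff.norm_weight_le (c : Cutoff) (q : ℝ≥0) :
    ‖((c.chi q : ℝ) : ℂ) * (1 + ((q : ℝ) : ℂ))‖ ≤ 2 := by
  have h1 : ((c.chi q : ℝ) : ℂ) * (1 + ((q : ℝ) : ℂ)) = ((c.chi q * (1 + q) : ℝ) : ℂ) := by
    push_cast; ring
  obtain ⟨h2, h3⟩ := c.mem q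
  have hq := NNReal.coe_nonneg q
  rw [h1, Complex.norm_real, Real.norm_of_nonneg (by positivity)]
  rcases le_or_gt 1 (q : ℝ) with h | h
  · rw [c.eq_zero q h]
    norm_num
  · nlinarith

variable (E) in
/-- The function `q ↦ (1 + q) χ(q)` of the photon energy. -/
def Cutoff.weightFn (c : Cutoff) : EnergyFn E :=
  scalarEnergyFn E (fun q => ((c.chi q : ℝ) : ℂ) * (1 + ((q : ℝ) : ℂ)))
    ((continuous_ofReal_coe c.smooth.continuous).mul (continuous_const.add
      (Complex.continuous_ofReal.comp NNReal.continuous_coe))) 2 c.norm_weight_le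

theorem Cutoff.resHf_weightFn (c : Cutoff) (f : Fock E) :
    resHf E (opFn (c.weightFn E) f) = c.chi₁ E f := by
  rw [resHf_eq_opFn, c.chi₁_eq]
  refine opFn_comp_eq (fun q v => ?_) f
  rw [resEnergyFn_apply', c.chiFn_apply, Cutoff.weightFn, scalarEnergyFn_apply]
  change _ • (((c.chi q : ℝ) : ℂ) * (1 + ((q : ℝ) : ℂ))) • v = _
  rw [smul_smul, mul_comm, mul_assoc, mul_inv_cancel₀ (one_add_ne_zero q), mul_one]

/-- The operator `χ₁ W χ₁`, written in terms of `w = W (1 + H_f)⁻¹`. -/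
def firstOrder (c : Cutoff) (w : Fock E →L[ℂ] Fock E) : Fock E →L[ℂ] Fock E :=
  c.chi₁ E * (w * opFn (c.weightFn E))

/-- The operator `χ' w ρ (1 + g χ' w ρ χ')⁻¹ χ' w` for operators on a Hilbert space. -/
def secondOrderCore {X : Type*} [NormedAddCommGroup X] [InnerProductSpace ℂ X] (g : ℝ)
    (w ρ χ' : X →L[ℂ] X) : X →L[ℂ] X :=
  w * (ρ * (χ' * (Ring.inverse (1 + χ' * ((g : ℂ) • (w * ρ)) * χ') * (χ' * w))))

/-- The operator `χ₁ W χ' (H_g - z)_{χ'}⁻¹ χ' W χ₁`, written in terms of `w = W (1 + H_f)⁻¹` and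
`ρ = (1 + H_f)(H_0 - z + P ⊗ (θ(H_f) - H_f))⁻¹`. -/
def secondOrder (c : Cutoff) (g : ℝ) (w ρ χ' : Fock E →L[ℂ] Fock E) : Fock E →L[ℂ] Fock E :=
  c.chi₁ E * (secondOrderCore (X := Fock E) g w ρ χ' * opFn (c.weightFn E))

theorem mem_graph_firstOrder {ν : ℕ} {G : (Fin ν → ℂ) → WeakL2 E} {s : Fin ν → ℂ}
    (hG : weightedNormSq (G s) ≠ ⊤) (hG' : weightedNormSq (G (star s)) ≠ ⊤) (c : Cutoff)
    (f : Fock E) : (f, firstOrder c (boundedInteraction G s) f) ∈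
      (ofBdd (c.chi₁ E) ∘ₚ interaction G s ∘ₚ ofBdd (c.chi₁ E)).graph := by
  refine mem_graph_pcomp (X := Fock E) (mem_graph_pcomp (X := Fock E) (mem_graph_ofBdd _ f) ?_)
    (mem_graph_ofBdd _ _)
  rw [← c.resHf_weightFn]
  exact interaction_resHf_mem hG hG' _

theorem mem_graph_secondOrder {ν : ℕ} {T : (Fin ν → ℂ) → (E →ₗ.[ℂ] E)}
    {G : (Fin ν → ℂ) → WeakL2 E} {s : Fin ν → ℂ}
    (hG : weightedNormSq (G s) ≠ ⊤) (hG' : weightedNormSq (G (star s)) ≠ ⊤) (c : Cutoff) {g : ℝ}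
    {J J' : Fock E →L[ℂ] Fock E}
    (D : FeshbachData (subScalar (Hg T G g s) z)
        (subScalar (Hg T G 0 s) z) (boldChi c P) (boldChi' c P) (opFn (freeRes (T s) P e z))
        (opFn (kappaFn P)) ((g : ℂ) • (boundedInteraction G s * opFn (regRes (T s) P e z)))
        J J') (f : Fock E) :
    (f, secondOrder c g (boundedInteraction G s) (opFn (regRes (T s) P e z)) (boldChi' c P) f) ∈
      (ofBdd (c.chi₁ E) ∘ₚ interaction G s ∘ₚ ofBdd (boldChi' c P) ∘ₚ
      inverseIn (dressed (subScalar (Hg T G g s) z) (subScalar (Hg T G 0 s) z) (boldChi' c P))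
        (LinearMap.range (boldChi' c P).toLinearMap) ∘ₚ
      ofBdd (boldChi' c P) ∘ₚ interaction G s ∘ₚ ofBdd (c.chi₁ E)).graph := by
  refine mem_graph_pcomp (X := Fock E) (mem_graph_pcomp (X := Fock E)
    (mem_graph_pcomp (X := Fock E) (mem_graph_pcomp (X := Fock E) (mem_graph_pcomp (X := Fock E)
    (mem_graph_pcomp (X := Fock E) (mem_graph_ofBdd _ f)
    (y := c.chi₁ E f) (w := boundedInteraction G s (opFn (c.weightFn E) f)) ?_)
    (mem_graph_ofBdd _ _)) (D.bddInvertibleIn_dressed.2 _)) (mem_graph_ofBdd _ _)) ?_)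
    (mem_graph_ofBdd _ _)
  · rw [← c.resHf_weightFn]
    exact interaction_resHf_mem hG hG' _
  · rw [← D.R_chi', freeRes, opFn_mul, ← resHf_eq_opFn]
    exact interaction_resHf_mem hG hG' _

/-- The operator `e - z + H_f + g ⟨χ₁ W χ₁⟩ - g² ⟨χ₁ W χ' (H_g - z)_{χ'}⁻¹ χ' W χ₁⟩`, with `H_f`
restricted to `𝓗_red`. -/
def effectiveOp (c : Cutoff) (P : E →L[ℂ] E) (φ η : E) (g : ℝ) (a : ℂ)
    (w ρ : Fock E →L[ℂ] Fock E) : Fock ℂ →L[ℂ] Fock ℂ :=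
  a • 1 + fnHf ℂ idIndicator + (g : ℂ) • atExp P φ η (firstOrder c w) -
    (g : ℂ) ^ 2 • atExp P φ η (secondOrder c g w ρ (boldChi' c P))

theorem atExp_chi₁_mem (c : Cutoff) (P : E →L[ℂ] E) (φ η : E) (L : Fock E →L[ℂ] Fock E)
    (ψ : Fock ℂ) : atExp P φ η (c.chi₁ E * L) ψ ∈ Hred := by
  rw [atExp_apply]
  change amp _ (c.chi₁ E (L (tmul (P φ) ψ))) ∈ Hred
  rw [Cutoff.chi₁, amp_comp_fnHf]
  exact fnHf_chi_mem_Hred c _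

theorem effectiveOp_mem (c : Cutoff) (P : E →L[ℂ] E) (φ η : E) (g : ℝ) (a : ℂ)
    (w ρ : Fock E →L[ℂ] Fock E) (ψ : Hred) : effectiveOp c P φ η g a w ρ ψ ∈ Hred := by
  refine Hred.sub_mem (Hred.add_mem (Hred.add_mem (Hred.smul_mem a ψ.2) ?_)
    (Hred.smul_mem _ ?_)) (Hred.smul_mem _ ?_)
  · exact ⟨fnHf ℂ idIndicator ψ, indicator_idIndicator ψ⟩
  · exact atExp_chi₁_mem c P φ η _ _
  · exact atExp_chi₁_mem c P φ η _ _

theorem isEffectiveHamiltonian_iff_of {H H₀ W : Fock E →ₗ.[ℂ] Fock E} {c : Cutoff} {g : ℝ}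
    {L₁ L₂ : Fock E →L[ℂ] Fock E}
    (hL₁ : ∀ f, (f, L₁ f) ∈ (ofBdd (c.chi₁ E) ∘ₚ W ∘ₚ ofBdd (c.chi₁ E)).graph)
    (hL₂ : ∀ f, (f, L₂ f) ∈ (ofBdd (c.chi₁ E) ∘ₚ W ∘ₚ ofBdd (boldChi' c P) ∘ₚ
      inverseIn (dressed (subScalar H z) (subScalar H₀ z) (boldChi' c P))
        (LinearMap.range (boldChi' c P).toLinearMap) ∘ₚ
      ofBdd (boldChi' c P) ∘ₚ W ∘ₚ ofBdd (c.chi₁ E)).graph)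
    (h1 : ∃ x, ∀ y, ∃ c : ℂ, P y = c • x) {φ η : E} (hne : inner ℂ η (P φ) ≠ (0 : ℂ))
    {B : Hred →L[ℂ] Hred} :
    IsEffectiveHamiltonian c H H₀ W P e g z B ↔ ∀ ψ : Hred, (B ψ : Fock ℂ) =
      (e - z) • (ψ : Fock ℂ) + fnHf ℂ idIndicator ψ + (g : ℂ) • atExp P φ η L₁ ψ -
        (g : ℂ) ^ 2 • atExp P φ η L₂ ψ := by
  constructor
  · rintro ⟨B₁, B₂, hB₁, hB₂, h⟩ ψ
    rw [isAtExpectation_iff h1 hne hL₁] at hB₁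
    rw [isAtExpectation_iff h1 hne hL₂] at hB₂
    obtain ⟨hd, h2⟩ := h ψ
    rw [h2, apply_eq_of_mem_graph (Hred_mem_graph_Hf ψ) hd, hB₁, hB₂]
  · intro h
    refine ⟨_, _, (isAtExpectation_iff h1 hne hL₁).2 rfl,
      (isAtExpectation_iff h1 hne hL₂).2 rfl, fun ψ => ?_⟩
    have hd := LinearPMap.mem_domain_of_mem_graph (Hred_mem_graph_Hf ψ)
    refine ⟨hd, ?_⟩
    rw [apply_eq_of_mem_graph (Hred_mem_graph_Hf ψ) hd]
    exact h ψ

theorem eq_compressL_iff {D : Fock ℂ →L[ℂ] Fock ℂ} (hD : ∀ ψ : Hred, D ψ ∈ Hred)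
    {B : Hred →L[ℂ] Hred} :
    B = compressL Hred projHred D ↔ ∀ ψ : Hred, (B ψ : Fock ℂ) = D ψ := by
  constructor
  · rintro rfl ψ
    exact projHred_of_mem (hD ψ)
  · intro h
    ext1 ψ
    exact Subtype.ext ((h ψ).trans (projHred_of_mem (hD ψ)).symm)

/-- The effective Hamiltonian exists and is unique. -/
theorem isEffectiveHamiltonian_iff {ν : ℕ} {T : (Fin ν → ℂ) → (E →ₗ.[ℂ] E)}
    {G : (Fin ν → ℂ) → WeakL2 E} {s : Fin ν → ℂ}
    (hG : weightedNormSq (G s) ≠ ⊤) (hG' : weightedNormSq (G (star s)) ≠ ⊤) (c : Cutoff) {g : ℝ}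
    {J J' : Fock E →L[ℂ] Fock E}
    (D : FeshbachData (subScalar (Hg T G g s) z)
        (subScalar (Hg T G 0 s) z) (boldChi c P) (boldChi' c P) (opFn (freeRes (T s) P e z))
        (opFn (kappaFn P)) ((g : ℂ) • (boundedInteraction G s * opFn (regRes (T s) P e z)))
        J J')
    (h1 : ∃ x, ∀ y, ∃ c : ℂ, P y = c • x) {φ η : E} (hne : inner ℂ η (P φ) ≠ (0 : ℂ))
    {B : Hred →L[ℂ] Hred} :
    IsEffectiveHamiltonian c (Hg T G g s) (Hg T G 0 s) (interaction G s) P e g z B ↔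
      B = compressL Hred projHred (effectiveOp c P φ η g (e - z) (boundedInteraction G s)
        (opFn (regRes (T s) P e z))) := by
  rw [eq_compressL_iff fun ψ => effectiveOp_mem c P φ η g (e - z) _ _ ψ]
  exact isEffectiveHamiltonian_iff_of (mem_graph_firstOrder hG hG' c)
    (mem_graph_secondOrder hG hG' c D) h1 hne

end Effective

/-! ### Analyticity of the effective Hamiltonian -/

section Analytic

theorem analyticAt_clm_comp {M X Y Z : Type*} [NormedAddCommGroup M] [NormedSpace ℂ M]
    [NormedAddCommGroup X] [NormedSpace ℂ X] [NormedAddCommGroup Y] [NormedSpace ℂ Y]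
    [NormedAddCommGroup Z] [NormedSpace ℂ Z] {f : M → (Y →L[ℂ] Z)} {h : M → (X →L[ℂ] Y)} {p : M}
    (hf : AnalyticAt ℂ f p) (hh : AnalyticAt ℂ h p) :
    AnalyticAt ℂ (fun p => (f p).comp (h p)) p :=
  AnalyticAt.comp (g := fun q : (Y →L[ℂ] Z) × (X →L[ℂ] Y) => q.1.comp q.2)
    (f := fun p => (f p, h p))
    ((ContinuousLinearMap.compL ℂ X Y Z).analyticAt_bilinear (f p, h p)) (hf.prod hh)

theorem analyticAt_mul' {M X : Type*} [NormedAddCommGroup M] [NormedSpace ℂ M]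
    [NormedAddCommGroup X] [NormedSpace ℂ X] {f h : M → (X →L[ℂ] X)} {p : M}
    (hf : AnalyticAt ℂ f p) (hh : AnalyticAt ℂ h p) : AnalyticAt ℂ (fun p => f p * h p) p :=
  analyticAt_clm_comp hf hh

theorem analyticAt_secondOrderCore {M X : Type*} [NormedAddCommGroup M] [NormedSpace ℂ M]
    [NormedAddCommGroup X] [InnerProductSpace ℂ X] [CompleteSpace X] (g : ℝ)
    {w ρ χ' : M → (X →L[ℂ] X)} {p : M} (hw : AnalyticAt ℂ w p) (hρ : AnalyticAt ℂ ρ p)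
    (hχ : AnalyticAt ℂ χ' p)
    (hsmall : ‖χ' p * ((g : ℂ) • (w p * ρ p)) * χ' p‖ < 1) :
    AnalyticAt ℂ (fun p => secondOrderCore g (w p) (ρ p) (χ' p)) p := by
  have hu : IsUnit (1 + χ' p * ((g : ℂ) • (w p * ρ p)) * χ' p) := by
    have h := isUnit_one_sub_of_norm_lt_one (x := -(χ' p * ((g : ℂ) • (w p * ρ p)) * χ' p))
      (by rwa [norm_neg])
    rwa [sub_neg_eq_add] at h
  have hB : AnalyticAt ℂ (fun p => (g : ℂ) • (w p * ρ p)) p :=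
    clm_comp_analyticAt (Q := X →L[ℂ] X) ((g : ℂ) • ContinuousLinearMap.id ℂ (X →L[ℂ] X))
      (analyticAt_mul' hw hρ)
  have hN : AnalyticAt ℂ (fun p => 1 + χ' p * ((g : ℂ) • (w p * ρ p)) * χ' p) p :=
    analyticAt_const.add (analyticAt_mul' (analyticAt_mul' hχ hB) hχ)
  have hinv : AnalyticAt ℂ Ring.inverse (1 + χ' p * ((g : ℂ) • (w p * ρ p)) * χ' p) := by
    obtain ⟨u, hu⟩ := hu
    rw [← hu]
    exact analyticAt_inverse u
  have hI := AnalyticAt.comp (f := fun p => 1 + χ' p * ((g : ℂ) • (w p * ρ p)) * χ' p) hinv hN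
  exact analyticAt_mul' hw (analyticAt_mul' hρ (analyticAt_mul' hχ
    (analyticAt_mul' hI (analyticAt_mul' hχ hw))))

variable {E : Type*} [NormedAddCommGroup E] [InnerProductSpace ℂ E] [CompleteSpace E]
  [TopologicalSpace.SeparableSpace E]

theorem analyticAt_boldChi' {M : Type*} [NormedAddCommGroup M] [NormedSpace ℂ M] (c : Cutoff)
    {P : M → (E →L[ℂ] E)} {p : M} (hP : AnalyticAt ℂ P p) :
    AnalyticAt ℂ (fun p => boldChi' c (P p)) p := by
  have h1 : AnalyticAt ℂ (fun p => 1 - P p) p := analyticAt_const.sub hP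
  have h2 := clm_comp_analyticAt (Q := E →L[ℂ] E) (B := Fock E →L[ℂ] Fock E) (ampL E E) h1
  have h3 := clm_comp_analyticAt (Q := E →L[ℂ] E) (B := Fock E →L[ℂ] Fock E) (ampL E E) hP
  exact AnalyticAt.add (F := Fock E →L[ℂ] Fock E) h2
    (analyticAt_mul' (X := Fock E) h3 analyticAt_const)

theorem analyticAt_atExp {M : Type*} [NormedAddCommGroup M] [NormedSpace ℂ M] {φ η : E}
    {P : M → (E →L[ℂ] E)} {L : M → (Fock E →L[ℂ] Fock E)} {p : M} (hP : AnalyticAt ℂ P p)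
    (hL : AnalyticAt ℂ L p) (hne : inner ℂ η (P p φ) ≠ (0 : ℂ)) :
    AnalyticAt ℂ (fun p => atExp (P p) φ η (L p)) p := by
  have h1 : AnalyticAt ℂ (fun p => inner ℂ η (P p φ)) p :=
    clm_comp_analyticAt (Q := E →L[ℂ] E) (B := ℂ)
      ((innerSL ℂ η).comp (ContinuousLinearMap.apply ℂ E φ)) hP
  have h2 : AnalyticAt ℂ (fun p => (innerSL ℂ η).comp (P p)) p :=
    analyticAt_clm_comp analyticAt_const hP
  have h3 := clm_comp_analyticAt (Q := E →L[ℂ] ℂ) (B := Fock E →L[ℂ] Fock ℂ) (ampL E ℂ)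
    ((h1.inv hne).smul h2)
  have h4 : AnalyticAt ℂ (fun p => (P p).comp (ContinuousLinearMap.toSpanSingleton ℂ φ)) p :=
    analyticAt_clm_comp hP analyticAt_const
  have h5 := clm_comp_analyticAt (Q := ℂ →L[ℂ] E) (B := Fock ℂ →L[ℂ] Fock E) (ampL ℂ E) h4
  exact analyticAt_clm_comp (X := Fock ℂ) (Y := Fock E) (Z := Fock ℂ) h3
    (analyticAt_clm_comp (X := Fock ℂ) (Y := Fock E) (Z := Fock E) hL h5)

theorem analyticAt_combination {M B : Type*} [NormedAddCommGroup M] [NormedSpace ℂ M]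
    [NormedAddCommGroup B] [NormedSpace ℂ B] {a : M → ℂ} {b₁ b₂ : M → B} {p : M} (x y : B)
    (k₁ k₂ : ℂ) (ha : AnalyticAt ℂ a p) (h₁ : AnalyticAt ℂ b₁ p) (h₂ : AnalyticAt ℂ b₂ p) :
    AnalyticAt ℂ (fun p => a p • x + y + k₁ • b₁ p - k₂ • b₂ p) p :=
  (((ha.smul analyticAt_const).add analyticAt_const).add (analyticAt_const.smul h₁)).sub
    (analyticAt_const.smul h₂)

theorem analyticAt_effectiveOp {M : Type*} [NormedAddCommGroup M] [NormedSpace ℂ M] (c : Cutoff)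
    {φ η : E} {g : ℝ} {P : M → (E →L[ℂ] E)} {a : M → ℂ} {w ρ : M → (Fock E →L[ℂ] Fock E)} {p : M}
    (hP : AnalyticAt ℂ P p) (ha : AnalyticAt ℂ a p) (hw : AnalyticAt ℂ w p)
    (hρ : AnalyticAt ℂ ρ p) (hne : inner ℂ η (P p φ) ≠ (0 : ℂ))
    (hsmall : ‖boldChi' c (P p) * ((g : ℂ) • (w p * ρ p)) * boldChi' c (P p)‖ < 1) :
    AnalyticAt ℂ (fun p => effectiveOp c (P p) φ η g (a p) (w p) (ρ p)) p := by
  have h1 : AnalyticAt ℂ (fun p => firstOrder c (w p)) p :=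
    analyticAt_mul' (X := Fock E) analyticAt_const
      (analyticAt_mul' (X := Fock E) hw analyticAt_const)
  have h2 : AnalyticAt ℂ (fun p => secondOrder c g (w p) (ρ p) (boldChi' c (P p))) p :=
    analyticAt_mul' (X := Fock E) analyticAt_const (analyticAt_mul' (X := Fock E)
      (analyticAt_secondOrderCore (X := Fock E) g hw hρ (analyticAt_boldChi' c hP) hsmall)
      analyticAt_const)
  exact analyticAt_combination (B := Fock ℂ →L[ℂ] Fock ℂ) _ _ _ _ ha
    (analyticAt_atExp hP h1 hne) (analyticAt_atExp hP h2 hne)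

end Analytic

/-! ### Uniform smallness of the interaction -/

section Smallness

theorem exists_coupling_bound {a d : ℝ} (ha : 0 ≤ a) (hd : 1 ≤ d) : ∃ g₀ : ℝ, 0 < g₀ ∧
    ∀ g : ℝ, 0 ≤ g → g < g₀ → g * a < 1 ∧ d * (g * a) * d < 1 := by
  have hpos : 0 < d * (a + 1) * d := by positivity
  refine ⟨(d * (a + 1) * d)⁻¹, inv_pos.2 hpos, fun g hg hg' => ?_⟩
  have h3 : g * (d * (a + 1) * d) < 1 := by
    have h := mul_lt_mul_of_pos_right hg' hpos
    rwa [inv_mul_cancel₀ hpos.ne'] at h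
  have h4 : g * a ≤ g * (d * (a + 1) * d) := by
    refine mul_le_mul_of_nonneg_left ?_ hg
    nlinarith [mul_le_mul hd hd zero_le_one (zero_le_one.trans hd)]
  have h5 : d * (g * a) * d ≤ g * (d * (a + 1) * d) := by
    have : 0 ≤ g * (d * d) := by positivity
    nlinarith
  exact ⟨h4.trans_lt h3, h5.trans_lt h3⟩

theorem norm_smul_mul_le {X : Type*} [NormedAddCommGroup X] [NormedSpace ℂ X] {w ρ χ' : X →L[ℂ] X}
    {a b d g : ℝ} (hg : 0 ≤ g) (ha : 0 ≤ a) (hd : 0 ≤ d) (hw : ‖w‖ ≤ a)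
    (hρ : ‖ρ‖ ≤ b) (hχ : ‖χ'‖ ≤ d) : ‖(g : ℂ) • (w * ρ)‖ ≤ g * (a * b) ∧
      ‖χ' * ((g : ℂ) • (w * ρ)) * χ'‖ ≤ d * (g * (a * b)) * d := by
  have h1 : ‖(g : ℂ) • (w * ρ)‖ ≤ g * (a * b) := by
    rw [norm_smul, Complex.norm_real, Real.norm_of_nonneg hg]
    exact mul_le_mul_of_nonneg_left
      ((norm_mul_le _ _).trans (mul_le_mul hw hρ ρ.opNorm_nonneg ha)) hg
  have h0 : 0 ≤ g * (a * b) := le_trans (norm_nonneg _) h1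
  refine ⟨h1, (norm_mul_le _ _).trans (mul_le_mul ((norm_mul_le _ _).trans
    (mul_le_mul hχ h1 (norm_nonneg _) hd)) hχ (norm_nonneg _) (mul_nonneg hd h0))⟩

variable {E : Type*} [NormedAddCommGroup E] [InnerProductSpace ℂ E] [CompleteSpace E]
  [TopologicalSpace.SeparableSpace E] {ν : ℕ}
  {V : Set (Fin ν → ℂ)} {G : (Fin ν → ℂ) → WeakL2 E} {T : (Fin ν → ℂ) → (E →ₗ.[ℂ] E)}
  {s₀ : Fin ν → ℂ} {E₀ r : ℝ} {𝒰 : Set ((Fin ν → ℂ) × ℂ)}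

/-- For small coupling the interaction is a small perturbation, uniformly on `𝒰`. -/
theorem exists_small_coupling (hV : IsOpen V) (hV' : ∀ s ∈ V, star s ∈ V) (hG : HypG V G)
    (hT : HypH V T s₀ E₀) (hR : HypR V T s₀ E₀ r 𝒰) (c : Cutoff) :
    ∃ g₀ : ℝ, 0 < g₀ ∧ ∀ g : ℝ, 0 ≤ g → g < g₀ → ∀ p ∈ 𝒰,
      ‖(g : ℂ) • (boundedInteraction G p.1 *
        opFn (regRes (T p.1) (Pat T E₀ r p.1) (Eat T E₀ r p.1) p.2))‖ < 1 ∧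
      ‖boldChi' c (Pat T E₀ r p.1) * ((g : ℂ) • (boundedInteraction G p.1 *
        opFn (regRes (T p.1) (Pat T E₀ r p.1) (Eat T E₀ r p.1) p.2))) *
        boldChi' c (Pat T E₀ r p.1)‖ < 1 := by
  obtain ⟨C, hC, hpt⟩ := HypR.isAtomicPoint hT hR
  obtain ⟨-, a, ha, hw⟩ := analyticOnNhd_boundedInteraction hV hV' hG
  have hb0 : 0 ≤ C + 7 * (1 + C) := by positivity
  have hd0 : 1 ≤ C + (1 + C) := by linarith
  obtain ⟨g₀, hg₀, hg₀'⟩ := exists_coupling_bound (mul_nonneg ha hb0) hd0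
  refine ⟨g₀, hg₀, fun g hg hg' p hp => ?_⟩
  have h0 : ‖boldChi' c (Pat T E₀ r p.1)‖ ≤ C + (1 + C) := by
    rw [boldChi'_eq]
    exact (norm_opFn_le _).trans ((norm_cut'Fn_le c _).trans
      (add_le_add (hpt p hp).norm_one_sub_le (hpt p hp).norm_proj_le))
  obtain ⟨h1, h2⟩ := norm_smul_mul_le (X := Fock E) hg ha (zero_le_one.trans hd0)
    (hw _ (hR.subset p hp).1) ((norm_opFn_le _).trans (hpt p hp).norm_regRes_le) h0
  obtain ⟨h3, h4⟩ := hg₀' g hg hg'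
  exact ⟨lt_of_le_of_lt h1 h3, lt_of_le_of_lt h2 h4⟩

end Smallness

/-! ### The family of effective Hamiltonians -/

section Main

/-- A family of objects characterized by a unique solvability property is analytic if it is locally
given by analytic functions. -/
theorem exists_analytic_of_unique {M B : Type*} [NormedAddCommGroup M] [NormedSpace ℂ M]
    [NormedAddCommGroup B] [NormedSpace ℂ B] {S : M → B → Prop} {U : Set M}
    (h : ∀ p ∈ U, ∃ F : M → B, AnalyticAt ℂ F p ∧ ∀ᶠ p' in 𝓝 p, ∀ b, S p' b ↔ b = F p') :
    ∃ H : M → B, (∀ p ∈ U, ∀ b, S p b ↔ b = H p) ∧ AnalyticOnNhd ℂ H U := by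
  have heq : ∀ p b, (∀ b', S p b' ↔ b' = b) → Classical.epsilon (S p) = b := fun p b hb =>
    (hb _).1 (Classical.epsilon_spec ⟨b, (hb b).2 rfl⟩)
  refine ⟨fun p => Classical.epsilon (S p), fun p hp b => ?_, fun p hp => ?_⟩
  · obtain ⟨F, -, hF⟩ := h p hp
    have h1 := hF.self_of_nhds
    change S p b ↔ b = Classical.epsilon (S p)
    rw [heq p _ h1]
    exact h1 b
  · obtain ⟨F, hF, hF'⟩ := h p hp
    refine hF.congr ?_
    filter_upwards [hF'] with p' hp'
    exact (heq p' _ hp').symm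

variable {E : Type*} [NormedAddCommGroup E] [InnerProductSpace ℂ E] [CompleteSpace E]
  [TopologicalSpace.SeparableSpace E] {ν : ℕ}
  {V : Set (Fin ν → ℂ)} {G : (Fin ν → ℂ) → WeakL2 E} {T : (Fin ν → ℂ) → (E →ₗ.[ℂ] E)}
  {s₀ : Fin ν → ℂ} {E₀ r : ℝ} {𝒰 : Set ((Fin ν → ℂ) × ℂ)}

/-- The effective Hamiltonian, written with vectors `φ`, `η` such that `⟨η, P_at(s) φ⟩ ≠ 0`. -/
def effectiveFamily (G : (Fin ν → ℂ) → WeakL2 E) (T : (Fin ν → ℂ) → (E →ₗ.[ℂ] E)) (E₀ r : ℝ)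
    (c : Cutoff) (g : ℝ) (φ η : E) (p : (Fin ν → ℂ) × ℂ) : Hred →L[ℂ] Hred :=
  compressL Hred projHred (effectiveOp c (Pat T E₀ r p.1) φ η g (Eat T E₀ r p.1 - p.2)
    (boundedInteraction G p.1) (opFn (regRes (T p.1) (Pat T E₀ r p.1) (Eat T E₀ r p.1) p.2)))

theorem analyticAt_effectiveFamily (hV : IsOpen V) (hV' : ∀ s ∈ V, star s ∈ V) (hG : HypG V G)
    (hT : HypH V T s₀ E₀) (hR : HypR V T s₀ E₀ r 𝒰) (c : Cutoff) {g : ℝ} {φ η : E}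
    {p : (Fin ν → ℂ) × ℂ} (hp : p ∈ 𝒰) (hne : inner ℂ η (Pat T E₀ r p.1 φ) ≠ (0 : ℂ))
    (hsmall : ‖boldChi' c (Pat T E₀ r p.1) * ((g : ℂ) • (boundedInteraction G p.1 *
        opFn (regRes (T p.1) (Pat T E₀ r p.1) (Eat T E₀ r p.1) p.2))) *
        boldChi' c (Pat T E₀ r p.1)‖ < 1) :
    AnalyticAt ℂ (effectiveFamily G T E₀ r c g φ η) p := by
  obtain ⟨hP, hE⟩ := HypR.analyticAt_proj hT hR hp
  have hP' : AnalyticAt ℂ (fun p : (Fin ν → ℂ) × ℂ => Pat T E₀ r p.1) p :=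
    AnalyticAt.comp (f := Prod.fst) (g := Pat T E₀ r) hP analyticAt_fst
  have hE' : AnalyticAt ℂ (fun p : (Fin ν → ℂ) × ℂ => Eat T E₀ r p.1 - p.2) p :=
    (AnalyticAt.comp (f := Prod.fst) (g := Eat T E₀ r) hE analyticAt_fst).sub analyticAt_snd
  have hw : AnalyticAt ℂ (fun p : (Fin ν → ℂ) × ℂ => boundedInteraction G p.1) p :=
    AnalyticAt.comp (G := Fock E →L[ℂ] Fock E) (f := Prod.fst)
      (g := boundedInteraction G)
      ((analyticOnNhd_boundedInteraction hV hV' hG).1 _ (hR.subset p hp).1) analyticAt_fst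
  have hρ := clm_comp_analyticAt (Q := EnergyFn E)
    (B := Fock E →L[ℂ] Fock E) (opFnL E)
    (HypR.analyticOnNhd_regRes hT hR p hp)
  have h1 := analyticAt_effectiveOp c (φ := φ) (η := η) (g := g) hP' hE' hw hρ hne hsmall
  exact clm_comp_analyticAt (Q := Fock ℂ →L[ℂ] Fock ℂ)
    (B := Hred →L[ℂ] Hred) (compressL Hred projHred) h1

theorem isEffectiveHamiltonian_iff_effectiveFamily {p : (Fin ν → ℂ) × ℂ}
    (hG : weightedNormSq (G p.1) ≠ ⊤) (hG' : weightedNormSq (G (star p.1)) ≠ ⊤) (c : Cutoff) {g : ℝ}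
    (D : ∃ J J', FeshbachData (subScalar (Hg T G g p.1) p.2)
        (subScalar (Hg T G 0 p.1) p.2) (boldChi c (Pat T E₀ r p.1))
        (boldChi' c (Pat T E₀ r p.1))
        (opFn (freeRes (T p.1) (Pat T E₀ r p.1) (Eat T E₀ r p.1) p.2))
        (opFn (kappaFn (Pat T E₀ r p.1))) ((g : ℂ) • (boundedInteraction G p.1 *
          opFn (regRes (T p.1) (Pat T E₀ r p.1) (Eat T E₀ r p.1) p.2))) J J')
    (h1 : ∃ x, ∀ y, ∃ c : ℂ, Pat T E₀ r p.1 y = c • x) {φ η : E}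
    (hne : inner ℂ η (Pat T E₀ r p.1 φ) ≠ (0 : ℂ)) (B : Hred →L[ℂ] Hred) :
    IsEffectiveHamiltonian c (Hg T G g p.1) (Hg T G 0 p.1) (interaction G p.1)
        (Pat T E₀ r p.1) (Eat T E₀ r p.1) g p.2 B ↔ B = effectiveFamily G T E₀ r c g φ η p := by
  obtain ⟨J, J', D⟩ := D
  unfold effectiveFamily
  exact isEffectiveHamiltonian_iff hG hG' c D h1 hne

set_option maxHeartbeats 1000000 in
/-- Near each point of `𝒰` the effective Hamiltonian is given by an analytic function: vectors `φ`,
`η` with `⟨η, P_at φ⟩ ≠ 0` at the point have this property nearby, too. -/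
theorem exists_effectiveFamily (hV : IsOpen V) (hV' : ∀ s ∈ V, star s ∈ V) (hG : HypG V G)
    (hT : HypH V T s₀ E₀) (hR : HypR V T s₀ E₀ r 𝒰) (c : Cutoff) {g : ℝ}
    (hsmall : ∀ p ∈ 𝒰, ‖boldChi' c (Pat T E₀ r p.1) * ((g : ℂ) • (boundedInteraction G p.1 *
        opFn (regRes (T p.1) (Pat T E₀ r p.1) (Eat T E₀ r p.1) p.2))) *
        boldChi' c (Pat T E₀ r p.1)‖ < 1)
    (hdata : ∀ p ∈ 𝒰, ∃ J J', FeshbachData (subScalar (Hg T G g p.1) p.2)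
        (subScalar (Hg T G 0 p.1) p.2) (boldChi c (Pat T E₀ r p.1))
        (boldChi' c (Pat T E₀ r p.1))
        (opFn (freeRes (T p.1) (Pat T E₀ r p.1) (Eat T E₀ r p.1) p.2))
        (opFn (kappaFn (Pat T E₀ r p.1))) ((g : ℂ) • (boundedInteraction G p.1 *
          opFn (regRes (T p.1) (Pat T E₀ r p.1) (Eat T E₀ r p.1) p.2))) J J')
    {p : (Fin ν → ℂ) × ℂ} (hp : p ∈ 𝒰) :
    ∃ F : (Fin ν → ℂ) × ℂ → (Hred →L[ℂ] Hred), AnalyticAt ℂ F p ∧ ∀ᶠ p' in 𝓝 p, ∀ B,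
      IsEffectiveHamiltonian c (Hg T G g p'.1) (Hg T G 0 p'.1) (interaction G p'.1)
        (Pat T E₀ r p'.1) (Eat T E₀ r p'.1) g p'.2 B ↔ B = F p' := by
  obtain ⟨C, hC, hpt⟩ := HypR.isAtomicPoint hT hR
  obtain ⟨K, -, hK⟩ := hG.exists_uniform
  obtain ⟨φ, hφ⟩ : ∃ φ, Pat T E₀ r p.1 φ ≠ 0 := by
    by_contra! h0
    exact (hpt p hp).ne_zero (ContinuousLinearMap.ext h0)
  set η := Pat T E₀ r p.1 φ with hη
  have hne : inner ℂ η (Pat T E₀ r p.1 φ) ≠ (0 : ℂ) := inner_self_ne_zero.2 hφ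
  refine ⟨effectiveFamily G T E₀ r c g φ η,
    analyticAt_effectiveFamily hV hV' hG hT hR c hp hne (hsmall p hp), ?_⟩
  have hP : AnalyticAt ℂ (fun p : (Fin ν → ℂ) × ℂ => Pat T E₀ r p.1) p :=
    AnalyticAt.comp (f := Prod.fst) (g := Pat T E₀ r) (HypR.analyticAt_proj hT hR hp).1
      analyticAt_fst
  have hc : ContinuousAt (fun p : (Fin ν → ℂ) × ℂ => inner ℂ η (Pat T E₀ r p.1 φ)) p :=
    (clm_comp_analyticAt (Q := E →L[ℂ] E) (B := ℂ)
      ((innerSL ℂ η).comp (ContinuousLinearMap.apply ℂ E φ)) hP).continuousAt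
  filter_upwards [hR.isOpen.mem_nhds hp, hc.eventually_ne hne] with p' hp' hne' B
  exact isEffectiveHamiltonian_iff_effectiveFamily (hK _ (hR.subset p' hp').1).1
    (hK _ (hV' _ (hR.subset p' hp').1)).1 c (hdata p' hp') (hpt p' hp').rankOne hne' B

end Main

end

end QED

theorem mainTheorem9 {Hat : Type*} [NormedAddCommGroup Hat] [InnerProductSpace ℂ Hat]
    [CompleteSpace Hat] [TopologicalSpace.SeparableSpace Hat] {ν : ℕ}
    (V : Set (Fin ν → ℂ)) (hV : IsOpen V) (hV_star : ∀ s ∈ V, star s ∈ V)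
    (G : (Fin ν → ℂ) → QED.WeakL2 Hat) (hG : QED.HypG V G)
    (T : (Fin ν → ℂ) → (Hat →ₗ.[ℂ] Hat)) (s₀ : Fin ν → ℂ) (E₀ : ℝ) (hT : QED.HypH V T s₀ E₀)
    (r : ℝ) (𝒰 : Set ((Fin ν → ℂ) × ℂ)) (hR : QED.HypR V T s₀ E₀ r 𝒰)
    (c : QED.Cutoff) :
    ∃ g₀ : ℝ, 0 < g₀ ∧ ∀ g : ℝ, 0 ≤ g → g < g₀ →
      (∀ p ∈ 𝒰, QED.IsFeshbachPair
        (QED.subScalar (QED.Hg T G g p.1) p.2) (QED.subScalar (QED.Hg T G 0 p.1) p.2)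
        (QED.boldChi c (QED.Pat T E₀ r p.1)) (QED.boldChi' c (QED.Pat T E₀ r p.1))) ∧
      ∃ Heff : (Fin ν → ℂ) × ℂ → (QED.Hred →L[ℂ] QED.Hred),
        (∀ p ∈ 𝒰, ∀ B : QED.Hred →L[ℂ] QED.Hred,
          QED.IsEffectiveHamiltonian c (QED.Hg T G g p.1) (QED.Hg T G 0 p.1)
            (QED.interaction G p.1) (QED.Pat T E₀ r p.1) (QED.Eat T E₀ r p.1) g p.2 B ↔
          B = Heff p) ∧
        AnalyticOnNhd ℂ Heff 𝒰 := by
  obtain ⟨g₀, hg₀, hsmall⟩ := QED.exists_small_coupling hV hV_star hG hT hR c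
  obtain ⟨C, hC, hpt⟩ := QED.HypR.isAtomicPoint hT hR
  obtain ⟨K, -, hK⟩ := hG.exists_uniform
  refine ⟨g₀, hg₀, fun g hg hg' => ?_⟩
  have hdata := fun p hp => (hpt p hp).exists_feshbachData
    (hK _ (hR.subset p hp).1).1 (hK _ (hV_star _ (hR.subset p hp).1)).1 c
    (hsmall g hg hg' p hp).1 (hsmall g hg hg' p hp).2
  refine ⟨fun p hp => ?_, QED.exists_analytic_of_unique fun p hp =>
    QED.exists_effectiveFamily hV hV_star hG hT hR c
      (fun p hp => (hsmall g hg hg' p hp).2) hdata hp⟩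
  obtain ⟨J, J', D⟩ := hdata p hp
  exact D.isFeshbachPair
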